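/- Let $n\ge 1$, $T^n=\mathbb R^n/\mathbb Z^n$, and let $h\in C_c^\infty(\mathbb R^n,\mathbb R)$. Regard $h=h(p)$ as an integrable Hamiltonian on $T^*T^n=\{(q,p)\}$, with flow $\varphi_t$ given by $\dot q=\partial h/\partial p$, $\dot p=-\partial h/\partial q=0$. For a Hamiltonian map $\varphi(q,p)=(Q,P)$ of $T^*T^n$ that is the time-one map of a compactly supported isotopy, let $\overline\Gamma(\varphi)\subset T^*(T^n\times S^n)$ be the union of the set of all points $$\Bigl(\tfrac{q+Q}{2},\ \tfrac{p+P}{2},\ p-P,\ Q-q\Bigr)\in T^*(T^n\times\mathbb R^n)$$ and the zero section over $T^n\times\{\infty\}$, where $S^n=\mathbb R^n\cup\{\infty\}$ and $Q-q\in\mathbb R^n$ is the continuous determination that vanishes near infinity. A generating function quadratic at infinity (G.F.Q.I.) of $\overline\Gamma(\varphi)$ is a smooth function $S(m;\xi)$ on $(T^n\times S^n)\times\mathbb R^k$, for some $k\ge 0$, such that: $|\nabla_\xi S-\nabla B|\le C$ for some constant $C$ and some nondegenerate quadratic form $B$ on $\mathbb R^k$; zero is a regular value of $\partial S/\partial\xi$;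 and $(m;\xi)\mapsto(m,\partial S/\partial m)$ maps $\{\partial S/\partial\xi=0\}$ bijectively onto $\overline\Gamma(\varphi)$. It is normalized if its critical value at the critical points over $T^n\times\{\infty\}$ is $0$. Write $S^a=\{S\le a\}$, let $D^-$ be the unit disc of the negative eigenspace of $B$, and let $T$ be a generator of $H^*(D^-,\partial D^-;\mathbb Z)\simeq\mathbb Z$. For $\alpha\in H^*(T^n\times S^n;\mathbb Z)\setminus\{0\}$ let $c(\alpha,S)$ be the infimum of the levels $a\in[-c,c]$ at which the class $\alpha\otimes T$ in $H^*(S^c,S^{-c})\simeq H^*(T^n\times S^n)\otimes H^*(D^-,\partial D^-)$, $c$ large, has non-zero restriction to $H^*(S^a,S^{-c})$. With $\mu\in H^{2n}(T^n\times S^n;\mathbb Z)\setminus\{0\}$ and $1\in H^0(T^n\times S^n;\mathbb Z)$, put $c_+(\varphi)=c(\mu,S)$ and $c_-(\varphi)=c(1,S)$ for a normalized G.F.Q.I. $S$ of $\overline\Gamma(\varphi)$, and $\gamma(\varphi)=c(\mu,S)-c(1,S)$ for any G.F.Q.I. $S$ of $\overline\Gamma(\varphi)$. Then $$c_+(\varphi_1)=\sup_{p}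 h,\qquad c_-(\varphi_1)=\inf_{p} h,\qquad \gamma(\varphi_1)=\sup_p h-\inf_p h=\operatorname{osc}_p h .$$ In each case such an $S$ exists for $\varphi=\varphi_1$, and the value is the same for every choice of $S$ (and of $\mu$ and $T$). -/

import Mathlib

open scoped ContDiff

noncomputable section

namespace TorusCapacity

/-! ### Relative singular cohomology with integer coefficients

Cochains are functions on all singular simplices of an ambient space `X`. For `B ⊆ A ⊆ X`, the
cohomology `H^m(A, B)` is computed by cochains vanishing on the simplices of `B`, two cochains being
identified when they agree on the simplices of `A`. -/

/-- Singular `m`-simplices of `X`. -/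
abbrev SingularSimplex (X : Type) [TopologicalSpace X] (m : ℕ) : Type :=
  C(stdSimplex ℝ (Fin (m + 1)), X)

/-- The composition of a singular simplex with the affine map of standard simplices induced by a
map of vertices. -/
def SingularSimplex.pull {X : Type} [TopologicalSpace X] {m l : ℕ} (s : SingularSimplex X m)
    (f : Fin (l + 1) → Fin (m + 1)) : SingularSimplex X l :=
  s.comp ⟨stdSimplex.map f, stdSimplex.continuous_map f⟩

/-- The simplex `s` has its image in `A`. -/
def SingularSimplex.LiesIn {X : Type} [TopologicalSpace X] {m : ℕ} (s : SingularSimplex X m)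
    (A : Set X) : Prop :=
  ∀ p, s p ∈ A

/-- Integer singular cochains of degree `m`. -/
abbrev Cochain (X : Type) [TopologicalSpace X] (m : ℕ) : Type := SingularSimplex X m → ℤ

/-- The singular coboundary. -/
def coboundary {X : Type} [TopologicalSpace X] {m : ℕ} (u : Cochain X m) : Cochain X (m + 1) :=
  fun s => ∑ i : Fin (m + 2), (-1 : ℤ) ^ (i : ℕ) * u (s.pull i.succAbove)

/-- The cochain `u` vanishes on all simplices of `A`. -/
def VanishesOn {X : Type} [TopologicalSpace X] {m : ℕ} (A : Set X) (u : Cochain X m) : Prop :=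
  ∀ s : SingularSimplex X m, s.LiesIn A → u s = 0

/-- `u` represents a class in `H^m(A, B)`. -/
def IsRelCocycle {X : Type} [TopologicalSpace X] {m : ℕ} (A B : Set X) (u : Cochain X m) : Prop :=
  VanishesOn B u ∧ VanishesOn A (coboundary u)

/-- The class of `u` in `H^m(A, B)` is zero. -/
def IsRelCoboundary {X : Type} [TopologicalSpace X] (A B : Set X) :
    {m : ℕ} → Cochain X m → Prop
  | 0, u => VanishesOn A u
  | _ + 1, u => ∃ w, VanishesOn B w ∧ VanishesOn A (u - coboundary w)

/-- `t` represents a generator of the group `H^m(A, B)`, assumed cyclic. -/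
def IsGenerator {X : Type} [TopologicalSpace X] {m : ℕ} (A B : Set X) (t : Cochain X m) : Prop :=
  IsRelCocycle A B t ∧
    ∀ t' : Cochain X m, IsRelCocycle A B t' → ∃ j : ℤ, IsRelCoboundary A B (t' - j • t)

/-- The pull-back of a cochain by a continuous map. -/
def Cochain.pullback {X Y : Type} [TopologicalSpace X] [TopologicalSpace Y] {m : ℕ}
    (u : Cochain Y m) (f : C(X, Y)) : Cochain X m :=
  fun s => u (f.comp s)

/-- The cross product `pr₁^* a ∪ pr₂^* b` (Alexander–Whitney formula). -/
def Cochain.cross {X Y : Type} [TopologicalSpace X] [TopologicalSpace Y] {m d : ℕ}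
    (a : Cochain X m) (b : Cochain Y d) : Cochain (X × Y) (m + d) :=
  fun s =>
    a (SingularSimplex.pull (ContinuousMap.fst.comp s) (Fin.castLE (by lia))) *
      b (SingularSimplex.pull (ContinuousMap.snd.comp s) (Fin.natAdd m))

/-! ### The min-max values `c(α, S)` -/

/-- Euclidean space `ℝ^n`. -/
abbrev Vec (n : ℕ) : Type := EuclideanSpace ℝ (Fin n)

/-- The sublevel set `S^a`. -/
def sublevel {M : Type} {k : ℕ} (S : M × Vec k → ℝ) (a : ℝ) : Set (M × Vec k) := {z | S z ≤ a}

/-- The negative eigenspace of the quadratic form `v ↦ ⟪A v, v⟫`. -/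
def negSpace {k : ℕ} (A : Vec k →ₗ[ℝ] Vec k) : Submodule ℝ (Vec k) :=
  ⨆ (l : ℝ) (_ : l < 0), Module.End.eigenspace A l

/-- The map `M × V⁻ → M × ℝ^k`, `(m, v) ↦ (m, R v)`. On the unit disc `D⁻` of the negative
eigenspace it is the inclusion of the disc of radius `R`. -/
def discMap (M : Type) [TopologicalSpace M] {k : ℕ} (A : Vec k →ₗ[ℝ] Vec k) (R : ℝ) :
    C(M × negSpace A, M × Vec k) where
  toFun z := (z.1, R • (z.2 : Vec k))
  continuous_toFun := by fun_prop

/-- The levels `a ∈ [-c, c]` at which the class `α ⊗ T` of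
`H^*(S^c, S^{-c}) ≃ H^*(M) ⊗ H^*(D⁻, ∂D⁻)` has non-zero restriction to `H^*(S^a, S^{-c})`. The class
is represented by a cocycle `u` whose restriction to `(M × D⁻, M × ∂D⁻)`, the disc having been
rescaled to radius `R`, is cohomologous to the cross product of `α` and `T`. -/
def essentialLevels {M : Type} [TopologicalSpace M] {k m d : ℕ} (A : Vec k →ₗ[ℝ] Vec k)
    (S : M × Vec k → ℝ) (α : Cochain M m) (T : Cochain (negSpace A) d) (c R : ℝ) : Set ℝ :=
  {a | -c ≤ a ∧ a ≤ c ∧ ∃ u : Cochain (M × Vec k) (m + d),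
    IsRelCocycle (sublevel S c) (sublevel S (-c)) u ∧
    IsRelCoboundary (Set.univ ×ˢ Metric.closedBall 0 1) (Set.univ ×ˢ Metric.sphere 0 1)
      (u.pullback (discMap M A R) - α.cross T) ∧
    ¬ IsRelCoboundary (sublevel S a) (sublevel S (-c)) u}

/-- `x = c(α, S)`, for `S` quadratic at infinity with quadratic form `⟪A v, v⟫`: the infimum of the
levels at which `α ⊗ T` is non-zero, where `T` generates `H^d(D⁻, ∂D⁻; ℤ)` with `d = dim D⁻`, the
reference level `c` is large, and the radius `R` of the disc is large with respect to `c`. -/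
def IsMinMax {M : Type} [TopologicalSpace M] {k m : ℕ} (A : Vec k →ₗ[ℝ] Vec k)
    (S : M × Vec k → ℝ) (α : Cochain M m) (x : ℝ) : Prop :=
  ∃ c₀ : ℝ, ∀ c ≥ c₀, ∃ R₀ : ℝ, ∀ R ≥ R₀,
    ∀ T : Cochain (negSpace A) (Module.finrank ℝ (negSpace A)),
      IsGenerator (Metric.closedBall 0 1) (Metric.sphere 0 1) T →
      IsGLB (essentialLevels A S α T c R) x

/-! ### The torus, its cotangent bundle, and the compactification `T^n × S^n` -/

/-- The torus `T^n = ℝ^n / ℤ^n`. -/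
abbrev Torus (n : ℕ) : Type := UnitAddTorus (Fin n)

/-- The projection `ℝ^n → T^n`. -/
def toTorus {n : ℕ} (x : Vec n) : Torus n := fun i => (x i : UnitAddCircle)

/-- The cotangent bundle `T^*T^n = T^n × ℝ^n`, with points `(q, p)`. -/
abbrev CotTorus (n : ℕ) : Type := Torus n × Vec n

/-- The sphere `S^n`, compactifying `ℝ^n`. -/
abbrev Sph (n : ℕ) : Type := Metric.sphere (0 : Vec (n + 1)) 1

/-- The point at infinity of `S^n`. -/
def infPt (n : ℕ) : Sph n := ⟨EuclideanSpace.single 0 1, by simp⟩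

/-- The closed manifold `T^n × S^n`, compactifying `T^n × ℝ^n`. -/
abbrev Base (n : ℕ) : Type := Torus n × Sph n

/-- The inverse of the stereographic projection from `s`. -/
def stereoInv {n : ℕ} (s : Sph n) (y : Vec n) : Sph n :=
  haveI := Fact.mk (@finrank_euclideanSpace_fin ℝ _ (n + 1))
  (stereographic' n s).symm y

/-- Two local parametrizations `ℝ^n × ℝ^n → T^n × S^n` whose images cover. The first one, `false`,
gives the identification of `T^n × ℝ^n` with the complement of infinity; the second one, `true`,
sends `(x, 0)` to the point `(x, ∞)`. They define the smooth structure of `T^n × S^n`. -/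
def param {n : ℕ} : Bool → Vec n × Vec n → Base n
  | false, z => (toTorus z.1, stereoInv (infPt n) z.2)
  | true, z => (toTorus z.1, stereoInv (-infPt n) z.2)

/-! ### Generating functions quadratic at infinity -/

/-- The expression of `S` in the local coordinates `b`. -/
def localExpr {n k : ℕ} (S : Base n × Vec k → ℝ) (b : Bool) (z : (Vec n × Vec n) × Vec k) : ℝ :=
  S (param b z.1, z.2)

/-- The fibre derivative `∂S/∂ξ`, in the local coordinates `b`. -/
def fibreDeriv {n k : ℕ} (S : Base n × Vec k → ℝ) (b : Bool) (z : (Vec n × Vec n) × Vec k) :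
    Vec k →L[ℝ] ℝ :=
  fderiv ℝ (fun v => localExpr S b (z.1, v)) z.2

/-- The base derivative `∂S/∂q`, in the local coordinates `b`. -/
def baseDeriv {n k : ℕ} (S : Base n × Vec k → ℝ) (b : Bool) (z : (Vec n × Vec n) × Vec k) :
    (Vec n × Vec n) →L[ℝ] ℝ :=
  fderiv ℝ (fun w => localExpr S b (w, z.2)) z.1

/-- Let `L ⊆ T^*(T^n × ℝ^n)` be a set of points `((x, y), (ξ, η))`, standing for the covector
`ξ dx + η dy` at `(x, y)`, which is the zero section near infinity. `IsGFQI A S L` says that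
`S : (T^n × S^n) × ℝ^k → ℝ` is a generating function quadratic at infinity, with quadratic form
`⟪A v, v⟫`, of the submanifold of `T^*(T^n × S^n)` obtained by adding to `L` the zero section over
the points `(x, ∞)`. -/
structure IsGFQI {n k : ℕ} (A : Vec k →ₗ[ℝ] Vec k) (S : Base n × Vec k → ℝ)
    (L : Set ((Torus n × Vec n) × (Vec n × Vec n))) : Prop where
  /-- `S` is smooth. -/
  smooth : ∀ b, ContDiff ℝ ∞ (localExpr S b)
  /-- The quadratic form is given by a symmetric operator. -/
  symm : A.IsSymmetric
  /-- The quadratic form is nondegenerate. -/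
  nondegenerate : Function.Injective A
  /-- `S` is quadratic at infinity. -/
  quadratic : ∃ C : ℝ, ∀ (m : Base n) (v : Vec k),
    ‖fderiv ℝ (fun w => S (m, w)) v - fderiv ℝ (fun w => inner ℝ (A w) w) v‖ ≤ C
  /-- Zero is a regular value of `∂S/∂ξ`. -/
  regular : ∀ b z, fibreDeriv S b z = 0 → Function.Surjective (fderiv ℝ (fibreDeriv S b) z)
  /-- The map `(q; ξ) ↦ (q, ∂S/∂q)` is injective on the critical set `∂S/∂ξ = 0`. -/
  injective : ∀ b w v v', fibreDeriv S b (w, v) = 0 → fibreDeriv S b (w, v') = 0 →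
    baseDeriv S b (w, v) = baseDeriv S b (w, v') → v = v'
  /-- Its image over `T^n × ℝ^n` is `L`. -/
  generates : ∀ x y ξ η : Vec n, ((toTorus x, y), (ξ, η)) ∈ L ↔
    ∃ v, fibreDeriv S false ((x, y), v) = 0 ∧
      ∀ a b, baseDeriv S false ((x, y), v) (a, b) = inner ℝ ξ a + inner ℝ η b
  /-- Its image over `T^n × {∞}` is the zero section. -/
  generates_infty : ∀ (x : Vec n) (β : (Vec n × Vec n) →L[ℝ] ℝ), β = 0 ↔
    ∃ v, fibreDeriv S true ((x, 0), v) = 0 ∧ baseDeriv S true ((x, 0), v) = β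

/-- The normalization of `S`: its critical value at the critical points over infinity is zero. -/
def IsNormalized {n k : ℕ} (S : Base n × Vec k → ℝ) : Prop :=
  ∀ (θ : Torus n) (v : Vec k), fderiv ℝ (fun w => S ((θ, infPt n), w)) v = 0 →
    S ((θ, infPt n), v) = 0

/-! ### Hamiltonian maps of `T^*T^n` and the invariants `c₊`, `c₋`, `γ` -/

/-- `φ` is the flow of the autonomous Hamiltonian `H` on `T^*T^n`: `q' = ∂H/∂p`, `p' = -∂H/∂q`. -/
def IsHamiltonianFlow {n : ℕ} (H : CotTorus n → ℝ) (φ : ℝ → CotTorus n → CotTorus n) : Prop :=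
  ∀ x p : Vec n, ∃ X P : ℝ → Vec n, X 0 = x ∧ P 0 = p ∧
    (∀ t, HasDerivAt X (gradient (fun p' => H (toTorus (X t), p')) (P t)) t) ∧
    (∀ t, HasDerivAt P (-gradient (fun x' => H (toTorus x', P t)) (X t)) t) ∧
    ∀ t, φ t (toTorus x, p) = (toTorus (X t), P t)

/-- `D` is the continuous determination of `Q - q` in `ℝ^n` which vanishes near infinity, where
`φ (q, p) = (Q, P)`. For `φ` the time one map of a compactly supported Hamiltonian isotopy it is
unique, and it is the determination obtained by continuation from `0` along the isotopy. -/
def IsDisplacement {n : ℕ} (φ : CotTorus n → CotTorus n) (D : CotTorus n → Vec n) : Prop :=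
  Continuous D ∧ HasCompactSupport D ∧ ∀ z, (φ z).1 = z.1 + toTorus (D z)

/-- The lift of the graph of `φ` to `T^*(T^n × ℝ^n)`: the set of all
`((q + Q) / 2, (p + P) / 2, p - P, Q - q)`, where `φ (q, p) = (Q, P)`. -/
def graphLift {n : ℕ} (φ : CotTorus n → CotTorus n) : Set ((Torus n × Vec n) × (Vec n × Vec n)) :=
  {g | ∃ D, IsDisplacement φ D ∧ ∃ z : CotTorus n,
    g = ((z.1 + toTorus ((1 / 2 : ℝ) • D z), (1 / 2 : ℝ) • (z.2 + (φ z).2)),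
      (z.2 - (φ z).2, D z))}

/-- `μ` represents a non-zero class in `H^{2n}(T^n × S^n; ℤ)`. -/
def IsTopClass {n : ℕ} (μ : Cochain (Base n) (2 * n)) : Prop :=
  IsRelCocycle Set.univ ∅ μ ∧ ¬ IsRelCoboundary Set.univ ∅ μ

/-- The cocycle representing the unit `1 ∈ H^0(T^n × S^n; ℤ)`. -/
def unitClass (n : ℕ) : Cochain (Base n) 0 := fun _ => 1

/-- `c₊(φ) = x`: there is a normalized generating function quadratic at infinity of the compactified
graph of `φ`, and `c(μ, S) = x` for each of them. -/
def HasCPlus {n : ℕ} (φ : CotTorus n → CotTorus n) (x : ℝ) : Prop :=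
  (∃ (k : ℕ) (A : Vec k →ₗ[ℝ] Vec k) (S : Base n × Vec k → ℝ),
    IsGFQI A S (graphLift φ) ∧ IsNormalized S) ∧
  ∀ (k : ℕ) (A : Vec k →ₗ[ℝ] Vec k) (S : Base n × Vec k → ℝ),
    IsGFQI A S (graphLift φ) → IsNormalized S →
    ∀ μ : Cochain (Base n) (2 * n), IsTopClass μ → IsMinMax A S μ x

/-- `c₋(φ) = x`: there is a normalized generating function quadratic at infinity of the compactified
graph of `φ`, and `c(1, S) = x` for each of them. -/
def HasCMinus {n : ℕ} (φ : CotTorus n → CotTorus n) (x : ℝ) : Prop :=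
  (∃ (k : ℕ) (A : Vec k →ₗ[ℝ] Vec k) (S : Base n × Vec k → ℝ),
    IsGFQI A S (graphLift φ) ∧ IsNormalized S) ∧
  ∀ (k : ℕ) (A : Vec k →ₗ[ℝ] Vec k) (S : Base n × Vec k → ℝ),
    IsGFQI A S (graphLift φ) → IsNormalized S → IsMinMax A S (unitClass n) x

/-- `γ(φ) = g`: there is a generating function quadratic at infinity of the compactified graph of
`φ`, and `c(μ, S) - c(1, S) = g` for each of them, normalized or not. -/
def HasGamma {n : ℕ} (φ : CotTorus n → CotTorus n) (g : ℝ) : Prop :=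
  (∃ (k : ℕ) (A : Vec k →ₗ[ℝ] Vec k) (S : Base n × Vec k → ℝ), IsGFQI A S (graphLift φ)) ∧
  ∀ (k : ℕ) (A : Vec k →ₗ[ℝ] Vec k) (S : Base n × Vec k → ℝ),
    IsGFQI A S (graphLift φ) → ∀ μ : Cochain (Base n) (2 * n), IsTopClass μ →
    ∃ x y : ℝ, IsMinMax A S μ x ∧ IsMinMax A S (unitClass n) y ∧ x - y = g

end TorusCapacity

end

noncomputable section

namespace TorusCapacity

/-! ### Alternating double sums -/

/-! Since the flow fixes `p` and translates `q` by `gradient h p`, the midpoint coordinates turn the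
graph of the time-one map into the graph of `dh`, where `h` is regarded as a function on `T^n × S^n`
vanishing at infinity (`mem_graphLift_iff`, `baseExt`). This function is itself a normalized
generating function with no fibre variables, so existence is immediate.

For an arbitrary generating function `S`, no uniqueness theorem is needed. The graph of `dh` meets
each cotangent fibre once, so `S` has exactly one fibre critical point over each base point, and its
base derivative there is `dh`. Hence `S - h` has zero derivative along the fibre critical set, which
is a regular level set of `∂S/∂ξ`; it is locally constant there, hence constant because the base is
connected (`exists_isFibreQuadratic`). Normalization makes the constant zero, and for `γ` it
cancels.

It remains to compute min-max values of a function that is quadratic at infinity and has a single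
critical value `f m` over each `m` (`IsFibreQuadratic.isMinMax`). If a class `α` has a
representative vanishing on an open `W`, and `f ≥ x` off `W`, then below level `x` the points over
the complement of `W` can be pushed down to very low levels, so `α ⊗ T` restricts to zero. If `α` is
non-zero on a set `K` where `f ≤ x`, a large disc bundle over `K` can be pushed below any level
above `x`, so `α ⊗ T` survives there. For `1`, take `W` empty and `K` a minimum point. For `μ`, take
`W` the complement of a maximum point and `K` the whole base; this is possible because a punctured
`T^n × S^n` has no cohomology in degree `2n`.

The topology is developed from singular cochains. Homotopy invariance and subdivision both come from
one acyclic-models argument (`Realization.isCob_op_sub_op`). Small simplices give Mayer–Vietoris,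
hence the vanishing of cohomology in high degrees. Injectivity of the product with `T` is proved by
comparing `T` with a product of coordinate classes, so the cohomology of the disc is never computed.
The descent uses finitely many explicit steps along the fibre gradient instead of a flow. -/

theorem sum_alternating_eq_zero {G : Type*} [AddCommGroup G] {m : ℕ}
    (F : Fin (m + 3) → Fin (m + 2) → G)
    (hF : ∀ i j : Fin (m + 2), i ≤ j → F j.succ i = F i.castSucc j) :
    ∑ i : Fin (m + 3), ∑ j : Fin (m + 2), (-1 : ℤ) ^ (i : ℕ) • (-1 : ℤ) ^ (j : ℕ) • F i j = 0 := by
  rw [Finset.sum_comm]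
  simp only [← Finset.sum_product']
  let P := Fin (m + 2) × Fin (m + 3)
  let S : Finset P := {ij : P | (ij.2 : ℕ) ≤ (ij.1 : ℕ)}
  rw [Finset.univ_product_univ, ← Finset.sum_add_sum_compl S, ← eq_neg_iff_add_eq_zero,
    ← Finset.sum_neg_distrib]
  -- The usual pairing behind `d² = 0`: the term with indices `i ≤ j` cancels the one with indices
  -- `j + 1, i`, whose sign is opposite.
  let φ : ∀ ij : P, ij ∈ S → P := fun ij hij =>
    (Fin.castLT ij.2 (lt_of_le_of_lt (Finset.mem_filter.mp hij).right (Fin.is_lt ij.1)), ij.1.succ)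
  apply Finset.sum_bij φ
  · intro ij hij
    simp_rw [S, φ, Finset.compl_filter, Finset.mem_filter_univ, Fin.val_succ,
      Fin.val_castLT] at hij ⊢
    lia
  · rintro ⟨i, j⟩ hij ⟨i', j'⟩ hij' h
    rw [Prod.mk_inj]
    exact ⟨by simpa [φ] using! congr_arg Prod.snd h,
      by simpa [φ, Fin.castSucc_castLT] using! congr_arg Fin.castSucc (congr_arg Prod.fst h)⟩
  · rintro ⟨i', j'⟩ hij'
    simp_rw [S, Finset.compl_filter, Finset.mem_filter_univ, not_le] at hij'
    refine ⟨(j'.pred <| ?_, Fin.castSucc i'), ?_, ?_⟩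
    · rintro rfl
      simp only [Fin.val_zero, not_lt_zero] at hij'
    · simpa [S] using! Nat.le_sub_one_of_lt hij'
    · simp only [φ, Fin.castLT_castSucc, Fin.succ_pred]
  · rintro ⟨i, j⟩ hij
    have h1 : (j : ℕ) ≤ i := by simpa [S] using hij
    have h2 := hF (j.castLT (lt_of_le_of_lt h1 i.2)) i (by simpa [Fin.le_def] using h1)
    rw [Fin.castSucc_castLT] at h2
    simp only [φ, h2, smul_smul, ← neg_smul]
    congr 1
    simp only [Fin.val_succ, Fin.val_castLT, pow_succ]
    ring

theorem succAbove_comp_succAbove {m : ℕ} (i j : Fin (m + 2)) (h : i ≤ j) :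
    (j.succ.succAbove ∘ i.succAbove : Fin (m + 1) → Fin (m + 3)) =
      i.castSucc.succAbove ∘ j.succAbove := by
  funext x
  simp only [Function.comp_apply, Fin.ext_iff, Fin.succAbove, Fin.lt_def, Fin.le_def] at h ⊢
  grind

/-! ### Chains of tuples -/

/-- Formal combinations of `(l + 1)`-tuples of points of `K`. -/
abbrev TupleChain (l : ℕ) (K : Type) : Type := (Fin (l + 1) → K) →₀ ℤ

namespace TupleChain

variable {K K' : Type} {l m : ℕ}

/-- The boundary of a chain of tuples. -/
def bd : TupleChain (l + 1) K →ₗ[ℤ] TupleChain l K :=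
  Finsupp.linearCombination ℤ fun f =>
    ∑ i : Fin (l + 2), (-1 : ℤ) ^ (i : ℕ) • Finsupp.single (f ∘ i.succAbove) 1

/-- The sum of the coefficients of a chain of points. -/
def augmentation : TupleChain 0 K →ₗ[ℤ] ℤ := Finsupp.linearCombination ℤ fun _ => 1

/-- The cone with apex `b`. -/
def cone (b : K) : TupleChain l K →ₗ[ℤ] TupleChain (l + 1) K :=
  Finsupp.linearCombination ℤ fun f => Finsupp.single (Fin.cons b f : Fin (l + 2) → K) 1

/-- The image of a chain of tuples under a map of points. -/
def push (φ : K → K') : TupleChain l K →ₗ[ℤ] TupleChain l K' :=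
  Finsupp.linearCombination ℤ fun f => Finsupp.single (φ ∘ f) 1

/-- The value of a function of tuples on a chain. -/
def eval (e : (Fin (l + 1) → K) → ℤ) : TupleChain l K →ₗ[ℤ] ℤ := Finsupp.linearCombination ℤ e

theorem cons_comp_succ_succAbove (b : K) (f : Fin (l + 2) → K) (i : Fin (l + 2)) :
    (Fin.cons b f : Fin (l + 3) → K) ∘ i.succ.succAbove = Fin.cons b (f ∘ i.succAbove) := by
  funext x
  refine Fin.cases ?_ (fun y => ?_) x
  · simp
  · simp [Fin.succ_succAbove_succ]

theorem cons_comp_zero_succAbove (b : K) (f : Fin (l + 1) → K) :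
    (Fin.cons b f : Fin (l + 2) → K) ∘ (0 : Fin (l + 2)).succAbove = f := by
  funext x
  simp

/-- Deleting the apex returns the chain; deleting any other vertex occurs one place later than in
the base, whence the minus sign. In particular a cycle is the boundary of its cone, the only
acyclicity used below. -/
theorem bd_cone (b : K) (c : TupleChain (l + 1) K) : bd (cone b c) = c - cone b (bd c) := by
  suffices h : (bd ∘ₗ cone b : TupleChain (l + 1) K →ₗ[ℤ] _) =
      LinearMap.id - cone b ∘ₗ bd by simpa using LinearMap.congr_fun h c
  refine Finsupp.lhom_ext' fun f => LinearMap.ext_ring ?_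
  simp only [bd, cone, LinearMap.comp_apply, Finsupp.lsingle_apply,
    Finsupp.linearCombination_single, one_smul, LinearMap.sub_apply, LinearMap.id_apply, map_sum,
    map_smul]
  rw [Fin.sum_univ_succ]
  simp only [cons_comp_succ_succAbove, cons_comp_zero_succAbove, Fin.val_zero, pow_zero, one_smul,
    Fin.val_succ, pow_succ, mul_neg, mul_one, neg_smul, Finset.sum_neg_distrib]
  rw [sub_eq_add_neg]

/-- Over a point the second face of the cone is the apex itself, so the augmentation is the
obstruction in degree zero. -/
theorem bd_cone_zero (b : K) (c : TupleChain 0 K) :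
    bd (cone b c) = c - augmentation c • Finsupp.single (fun _ => b) 1 := by
  suffices h : (bd ∘ₗ cone b : TupleChain 0 K →ₗ[ℤ] _) =
      LinearMap.id - augmentation.smulRight (Finsupp.single (fun _ => b) 1) by
    simpa using LinearMap.congr_fun h c
  refine Finsupp.lhom_ext' fun f => LinearMap.ext_ring ?_
  simp only [bd, cone, LinearMap.comp_apply, Finsupp.lsingle_apply, augmentation,
    Finsupp.linearCombination_single, one_smul, LinearMap.sub_apply, LinearMap.id_apply,
    LinearMap.smulRight_apply]
  rw [Fin.sum_univ_two]
  rw [cons_comp_zero_succAbove]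
  have : (Fin.cons b f : Fin 2 → K) ∘ (1 : Fin 2).succAbove = fun _ => b := by
    funext x
    fin_cases x
    rfl
  rw [this]
  simp [sub_eq_add_neg]

theorem bd_push (φ : K → K') (c : TupleChain (l + 1) K) : bd (push φ c) = push φ (bd c) := by
  suffices h : (bd ∘ₗ push φ : TupleChain (l + 1) K →ₗ[ℤ] _) = push φ ∘ₗ bd by
    simpa using LinearMap.congr_fun h c
  refine Finsupp.lhom_ext' fun f => LinearMap.ext_ring ?_
  simp [bd, push, Function.comp_assoc]

theorem augmentation_push (φ : K → K') (c : TupleChain 0 K) :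
    augmentation (push φ c) = augmentation c := by
  suffices h : (augmentation ∘ₗ push φ : TupleChain 0 K →ₗ[ℤ] _) = augmentation by
    simpa using LinearMap.congr_fun h c
  refine Finsupp.lhom_ext' fun f => LinearMap.ext_ring ?_
  simp [augmentation, push]

theorem push_push {K'' : Type} (φ : K → K') (ψ : K' → K'') (c : TupleChain l K) :
    push ψ (push φ c) = push (ψ ∘ φ) c := by
  suffices h : (push ψ ∘ₗ push φ : TupleChain l K →ₗ[ℤ] _) = push (ψ ∘ φ) by
    simpa using LinearMap.congr_fun h c
  refine Finsupp.lhom_ext' fun f => LinearMap.ext_ring ?_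
  simp [push, Function.comp_assoc]

theorem eval_push (φ : K → K') (e : (Fin (l + 1) → K') → ℤ) (c : TupleChain l K) :
    eval e (push φ c) = eval (fun f => e (φ ∘ f)) c := by
  suffices h : (eval e ∘ₗ push φ : TupleChain l K →ₗ[ℤ] _) = eval (fun f => e (φ ∘ f)) by
    simpa using LinearMap.congr_fun h c
  refine Finsupp.lhom_ext' fun f => LinearMap.ext_ring ?_
  simp [push, eval]

theorem eval_bd (e : (Fin (l + 1) → K) → ℤ) (c : TupleChain (l + 1) K) :
    eval e (bd c) =
      eval (fun f => ∑ i : Fin (l + 2), (-1 : ℤ) ^ (i : ℕ) * e (f ∘ i.succAbove)) c := by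
  suffices h : (eval e ∘ₗ bd : TupleChain (l + 1) K →ₗ[ℤ] _) =
      eval (fun f => ∑ i : Fin (l + 2), (-1 : ℤ) ^ (i : ℕ) * e (f ∘ i.succAbove)) by
    simpa using LinearMap.congr_fun h c
  refine Finsupp.lhom_ext' fun f => LinearMap.ext_ring ?_
  simp [bd, eval]

theorem eval_eq_zero (e : (Fin (l + 1) → K) → ℤ) (c : TupleChain l K)
    (h : ∀ f ∈ c.support, e f = 0) : eval e c = 0 := by
  rw [eval, Finsupp.linearCombination_apply, Finsupp.sum]
  exact Finset.sum_eq_zero fun f hf => by simp [h f hf]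

theorem exists_of_mem_support_push [DecidableEq (Fin (l + 1) → K')] {φ : K → K'} {c : TupleChain l K}
    {f : Fin (l + 1) → K'} (h : f ∈ (push φ c).support) : ∃ g ∈ c.support, f = φ ∘ g := by
  by_contra! hc
  rw [Finsupp.mem_support_iff] at h
  apply h
  rw [push, Finsupp.linearCombination_apply, Finsupp.sum, Finsupp.finsetSum_apply]
  exact Finset.sum_eq_zero fun g hg => by
    rw [Finsupp.smul_apply, Finsupp.single_apply, if_neg (fun h => hc g hg h.symm), smul_zero]

theorem exists_of_mem_support_cone {b : K} {c : TupleChain l K}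
    {f : Fin (l + 2) → K} (h : f ∈ (cone b c).support) : ∃ g ∈ c.support, f = Fin.cons b g := by
  classical
  by_contra! hc
  rw [Finsupp.mem_support_iff] at h
  apply h
  rw [cone, Finsupp.linearCombination_apply, Finsupp.sum, Finsupp.finsetSum_apply]
  exact Finset.sum_eq_zero fun g hg => by
    rw [Finsupp.smul_apply, Finsupp.single_apply, if_neg (fun h => hc g hg h.symm), smul_zero]

end TupleChain

/-! ### Natural chains on a cosimplicial family of point sets -/

/-- A sequence of sets with coface maps satisfying the cosimplicial identity. -/
structure CofaceFamily where
  /-- The sets. -/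
  pt : ℕ → Type
  /-- The coface maps. -/
  coface : ∀ {m : ℕ}, Fin (m + 2) → pt m → pt (m + 1)
  coface_comp : ∀ {m : ℕ} (i j : Fin (m + 2)), i ≤ j →
    (coface j.succ ∘ coface i : pt m → pt (m + 2)) = coface i.castSucc ∘ coface j

namespace CofaceFamily

variable (K : CofaceFamily)

/-- The alternating sum of the coface maps. -/
def diff {l m : ℕ} : TupleChain l (K.pt m) →ₗ[ℤ] TupleChain l (K.pt (m + 1)) :=
  ∑ i : Fin (m + 2), (-1 : ℤ) ^ (i : ℕ) • TupleChain.push (K.coface i)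

theorem bd_diff {l m : ℕ} (c : TupleChain (l + 1) (K.pt m)) :
    TupleChain.bd (K.diff c) = K.diff (TupleChain.bd c) := by
  simp only [diff, LinearMap.sum_apply, LinearMap.smul_apply, map_sum, map_smul,
    TupleChain.bd_push]

theorem diff_diff {l m : ℕ} (c : TupleChain l (K.pt m)) : K.diff (K.diff c) = 0 := by
  simp only [diff, LinearMap.sum_apply, LinearMap.smul_apply, map_sum, map_smul,
    TupleChain.push_push, Finset.smul_sum]
  rw [← sum_alternating_eq_zero (G := TupleChain l (K.pt (m + 2)))
    (fun i j => TupleChain.push (K.coface i ∘ K.coface j) c)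
    (fun i j hij => by rw [K.coface_comp i j hij]), Finset.sum_comm]
  simp only [smul_smul, mul_comm]

theorem augmentation_diff {m : ℕ} (c : TupleChain 0 (K.pt m)) :
    TupleChain.augmentation (K.diff c) =
      (∑ i : Fin (m + 2), (-1 : ℤ) ^ (i : ℕ)) * TupleChain.augmentation c := by
  simp only [diff, LinearMap.sum_apply, LinearMap.smul_apply, map_sum, map_smul,
    TupleChain.augmentation_push, Finset.sum_mul, smul_eq_mul]

/-- A family of chains whose boundary is the alternating sum of the cofaces. -/
def IsNatural (c : ∀ m, TupleChain m (K.pt m)) : Prop :=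
  ∀ m, TupleChain.bd (c (m + 1)) = K.diff (c m)

/-- The homotopy between two natural families, by coning off. -/
def htpy (b : ∀ m, K.pt m) (c c' : ∀ m, TupleChain m (K.pt m)) :
    ∀ m, TupleChain (m + 1) (K.pt m)
  | 0 => TupleChain.cone (b 0) (c 0 - c' 0)
  | m + 1 => TupleChain.cone (b (m + 1)) (c (m + 1) - c' (m + 1) - K.diff (htpy b c c' m))

theorem bd_htpy_zero (b : ∀ m, K.pt m) (c c' : ∀ m, TupleChain m (K.pt m))
    (h0 : TupleChain.augmentation (c 0) = TupleChain.augmentation (c' 0)) :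
    TupleChain.bd (K.htpy b c c' 0) = c 0 - c' 0 := by
  rw [htpy, TupleChain.bd_cone_zero, map_sub, h0, sub_self, zero_smul, sub_zero]

theorem bd_htpy_succ (b : ∀ m, K.pt m) {c c' : ∀ m, TupleChain m (K.pt m)}
    (hc : K.IsNatural c) (hc' : K.IsNatural c')
    (h0 : TupleChain.augmentation (c 0) = TupleChain.augmentation (c' 0)) (m : ℕ) :
    TupleChain.bd (K.htpy b c c' (m + 1)) =
      c (m + 1) - c' (m + 1) - K.diff (K.htpy b c c' m) := by
  -- The chain to be coned off is a cycle: by naturality its boundary is `diff` of the defect in the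
  -- previous degree, and the inductive formula together with `diff_diff` kills it.
  have key : TupleChain.bd (c (m + 1) - c' (m + 1) - K.diff (K.htpy b c c' m)) = 0 := by
    rw [map_sub, map_sub, hc, hc', bd_diff, sub_eq_zero, ← map_sub]
    cases m with
    | zero => rw [bd_htpy_zero K b c c' h0]
    | succ m => rw [bd_htpy_succ b hc hc' h0 m, map_sub K.diff (c (m + 1) - c' (m + 1)), diff_diff, sub_zero,
        map_sub]
  rw [htpy, TupleChain.bd_cone, key, map_zero, sub_zero]

end CofaceFamily

/-! ### Cochains -/

section Cochains

variable {X Y Z : Type} [TopologicalSpace X] [TopologicalSpace Y] [TopologicalSpace Z] {m l : ℕ}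

theorem SingularSimplex.pull_pull {r : ℕ} (s : SingularSimplex X m)
    (f : Fin (l + 1) → Fin (m + 1)) (g : Fin (r + 1) → Fin (l + 1)) :
    (s.pull f).pull g = s.pull (f ∘ g) := by
  ext p
  simp [SingularSimplex.pull, stdSimplex.map_comp_apply]

theorem SingularSimplex.pull_id (s : SingularSimplex X m) : s.pull id = s := by
  ext p
  simp [SingularSimplex.pull]

theorem SingularSimplex.LiesIn.mono {s : SingularSimplex X m} {A B : Set X} (h : s.LiesIn A)
    (hAB : A ⊆ B) : s.LiesIn B := fun p => hAB (h p)

theorem SingularSimplex.LiesIn.pull {s : SingularSimplex X m} {A : Set X} (h : s.LiesIn A)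
    (f : Fin (l + 1) → Fin (m + 1)) : (s.pull f).LiesIn A := fun _ => h _

theorem SingularSimplex.LiesIn.comp {s : SingularSimplex X m} {A : Set X} {B : Set Y}
    (h : s.LiesIn A) {f : C(X, Y)} (hf : Set.MapsTo f A B) :
    SingularSimplex.LiesIn (f.comp s : SingularSimplex Y m) B := fun p => hf (h p)

theorem coboundary_add (u v : Cochain X m) :
    coboundary (u + v) = coboundary u + coboundary v := by
  funext s
  simp [coboundary, mul_add, Finset.sum_add_distrib]

theorem coboundary_neg (u : Cochain X m) : coboundary (-u) = -coboundary u := by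
  funext s
  simp [coboundary]

theorem coboundary_sub (u v : Cochain X m) :
    coboundary (u - v) = coboundary u - coboundary v := by
  rw [sub_eq_add_neg, coboundary_add, coboundary_neg, sub_eq_add_neg]

theorem coboundary_zero : coboundary (0 : Cochain X m) = 0 := by
  funext s
  simp [coboundary]

theorem coboundary_zsmul (j : ℤ) (u : Cochain X m) : coboundary (j • u) = j • coboundary u := by
  funext s
  simp only [coboundary, Pi.smul_apply, smul_eq_mul, Finset.mul_sum]
  exact Finset.sum_congr rfl fun i _ => by ring

theorem coboundary_coboundary (u : Cochain X m) : coboundary (coboundary u) = 0 := by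
  funext s
  have := sum_alternating_eq_zero (G := ℤ) (m := m)
    (fun i j => u ((s.pull i.succAbove).pull j.succAbove)) (fun i j hij => by
      simp only [SingularSimplex.pull_pull, succAbove_comp_succAbove i j hij])
  simpa [coboundary, Finset.mul_sum] using this

theorem coboundary_pullback (u : Cochain Y m) (f : C(X, Y)) :
    coboundary (u.pullback f) = (coboundary u).pullback f := rfl

theorem VanishesOn.mono {A B : Set X} {u : Cochain X m} (h : VanishesOn B u) (hAB : A ⊆ B) :
    VanishesOn A u := fun s hs => h s (hs.mono hAB)

theorem VanishesOn.add {A : Set X} {u v : Cochain X m} (hu : VanishesOn A u)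
    (hv : VanishesOn A v) : VanishesOn A (u + v) := fun s hs => by simp [hu s hs, hv s hs]

theorem VanishesOn.sub {A : Set X} {u v : Cochain X m} (hu : VanishesOn A u)
    (hv : VanishesOn A v) : VanishesOn A (u - v) := fun s hs => by simp [hu s hs, hv s hs]

theorem VanishesOn.zsmul {A : Set X} {u : Cochain X m} (hu : VanishesOn A u) (j : ℤ) :
    VanishesOn A (j • u) := fun s hs => by simp [hu s hs]

theorem VanishesOn.coboundary {A : Set X} {u : Cochain X m} (hu : VanishesOn A u) :
    VanishesOn A (coboundary u) := fun s hs => by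
  simp only [TorusCapacity.coboundary]
  exact Finset.sum_eq_zero fun i _ => by rw [hu _ (hs.pull _), mul_zero]

theorem VanishesOn.pullback {A : Set X} {B : Set Y} {u : Cochain Y m} (hu : VanishesOn B u)
    {f : C(X, Y)} (hf : Set.MapsTo f A B) : VanishesOn A (u.pullback f) :=
  fun _ hs => hu _ (hs.comp hf)

theorem vanishesOn_zero (A : Set X) : VanishesOn A (0 : Cochain X m) := fun _ _ => rfl

theorem vanishesOn_empty (u : Cochain X m) : VanishesOn ∅ u :=
  fun _ hs => (hs (stdSimplex.vertex 0)).elim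

/-- On the simplices of `A`, the cochain `u` is the coboundary of a cochain which vanishes on the
simplices of each member of `𝓑`. -/
def IsCob (A : Set X) (𝓑 : Set (Set X)) : {m : ℕ} → Cochain X m → Prop
  | 0, u => VanishesOn A u
  | _ + 1, u => ∃ w, (∀ B ∈ 𝓑, VanishesOn B w) ∧ VanishesOn A (u - coboundary w)

theorem isRelCoboundary_iff_isCob {A B : Set X} {u : Cochain X m} :
    IsRelCoboundary A B u ↔ IsCob A {B} u := by
  cases m <;> simp [IsRelCoboundary, IsCob]

variable {A A' : Set X} {𝓑 𝓑' : Set (Set X)} {u v : Cochain X m}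

theorem IsCob.of_vanishesOn (h : VanishesOn A u) (𝓑 : Set (Set X)) : IsCob A 𝓑 u := by
  cases m with
  | zero => exact h
  | succ m => exact ⟨0, fun B _ => vanishesOn_zero B, by rwa [coboundary_zero, sub_zero]⟩

theorem isCob_coboundary {w : Cochain X m} (A : Set X) (h : ∀ B ∈ 𝓑, VanishesOn B w) :
    IsCob A 𝓑 (coboundary w) :=
  ⟨w, h, by rw [sub_self]; exact vanishesOn_zero A⟩

theorem IsCob.add (hu : IsCob A 𝓑 u) (hv : IsCob A 𝓑 v) : IsCob A 𝓑 (u + v) := by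
  cases m with
  | zero => exact VanishesOn.add hu hv
  | succ m =>
    obtain ⟨w, hw, h⟩ := hu
    obtain ⟨w', hw', h'⟩ := hv
    refine ⟨w + w', fun B hB => (hw B hB).add (hw' B hB), ?_⟩
    rw [coboundary_add, add_sub_add_comm]
    exact h.add h'

theorem IsCob.zsmul (hu : IsCob A 𝓑 u) (j : ℤ) : IsCob A 𝓑 (j • u) := by
  cases m with
  | zero => exact VanishesOn.zsmul hu j
  | succ m =>
    obtain ⟨w, hw, h⟩ := hu
    refine ⟨j • w, fun B hB => (hw B hB).zsmul j, ?_⟩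
    rw [coboundary_zsmul, ← smul_sub]
    exact h.zsmul j

theorem IsCob.neg (hu : IsCob A 𝓑 u) : IsCob A 𝓑 (-u) := by
  simpa using hu.zsmul (-1)

theorem IsCob.sub (hu : IsCob A 𝓑 u) (hv : IsCob A 𝓑 v) : IsCob A 𝓑 (u - v) := by
  rw [sub_eq_add_neg]
  exact hu.add hv.neg

theorem IsCob.of_sub (h : IsCob A 𝓑 (u - v)) (hv : IsCob A 𝓑 v) : IsCob A 𝓑 u := by
  simpa using h.add hv

theorem IsCob.mono (hu : IsCob A 𝓑 u) (hA : A' ⊆ A) (h𝓑 : ∀ B' ∈ 𝓑', ∃ B ∈ 𝓑, B' ⊆ B) :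
    IsCob A' 𝓑' u := by
  cases m with
  | zero => exact VanishesOn.mono hu hA
  | succ m =>
    obtain ⟨w, hw, h⟩ := hu
    refine ⟨w, fun B' hB' => ?_, h.mono hA⟩
    obtain ⟨B, hB, hBB'⟩ := h𝓑 B' hB'
    exact (hw B hB).mono hBB'

theorem IsCob.pullback {A : Set Y} {𝓑 : Set (Set Y)} {u : Cochain Y m} (hu : IsCob A 𝓑 u)
    {f : C(X, Y)} (hA : Set.MapsTo f A' A) (h𝓑 : ∀ B' ∈ 𝓑', ∃ B ∈ 𝓑, Set.MapsTo f B' B) :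
    IsCob A' 𝓑' (u.pullback f) := by
  cases m with
  | zero => exact VanishesOn.pullback hu hA
  | succ m =>
    obtain ⟨w, hw, h⟩ := hu
    refine ⟨w.pullback f, fun B' hB' => ?_, ?_⟩
    · obtain ⟨B, hB, hBB'⟩ := h𝓑 B' hB'
      exact (hw B hB).pullback hBB'
    · rw [coboundary_pullback]
      exact h.pullback hA

/-- A cochain cohomologous to zero on `A` is cohomologous on the whole space to one which vanishes
on `A`. -/
theorem IsCob.exists_vanishesOn (hu : IsCob A 𝓑 u) :
    ∃ u', VanishesOn A u' ∧ coboundary u' = coboundary u ∧ ∀ A', IsCob A' 𝓑 (u - u') := by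
  cases m with
  | zero => exact ⟨u, hu, rfl, fun A' => by
      rw [sub_self]; exact IsCob.of_vanishesOn (vanishesOn_zero A') _⟩
  | succ m =>
    obtain ⟨w, hw, h⟩ := hu
    refine ⟨u - coboundary w, h, ?_, fun A' => ⟨w, hw, ?_⟩⟩
    · rw [coboundary_sub, coboundary_coboundary, sub_zero]
    · rw [sub_sub_cancel, sub_self]
      exact vanishesOn_zero A'

end Cochains

/-! ### Operators on cochains given by chains of tuples -/

/-- A natural way to turn tuples into singular simplices. -/
structure Realization (K : CofaceFamily) (X Y : Type) [TopologicalSpace X]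
    [TopologicalSpace Y] where
  /-- The simplex given by a tuple. -/
  simplex : ∀ {m l : ℕ}, SingularSimplex X m → (Fin (l + 1) → K.pt m) → SingularSimplex Y l
  pull_simplex : ∀ {m l : ℕ} (s : SingularSimplex X m) (f : Fin (l + 2) → K.pt m)
    (i : Fin (l + 2)), (simplex s f).pull i.succAbove = simplex s (f ∘ i.succAbove)
  simplex_pull : ∀ {m l : ℕ} (s : SingularSimplex X (m + 1)) (f : Fin (l + 1) → K.pt m)
    (i : Fin (m + 2)), simplex (s.pull i.succAbove) f = simplex s (K.coface i ∘ f)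

namespace Realization

variable {K : CofaceFamily} {X Y : Type} [TopologicalSpace X] [TopologicalSpace Y] {m l : ℕ}
  (ρ : Realization K X Y)

/-- The operator on cochains given by a chain of tuples. -/
def op (c : TupleChain l (K.pt m)) (u : Cochain Y l) : Cochain X m :=
  fun s => TupleChain.eval (fun f => u (ρ.simplex s f)) c

theorem op_coboundary (c : TupleChain (l + 1) (K.pt m)) (u : Cochain Y l) :
    ρ.op c (coboundary u) = ρ.op (TupleChain.bd c) u := by
  funext s
  simp only [op, TupleChain.eval_bd, coboundary, ρ.pull_simplex]

/-- Together with `op_coboundary` this moves the coboundary on either side of an operator into its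
chain, so natural families give cochain maps and `htpy` gives cochain homotopies. -/
theorem coboundary_op (c : TupleChain l (K.pt m)) (u : Cochain Y l) :
    coboundary (ρ.op c u) = ρ.op (K.diff c) u := by
  funext s
  simp only [op, coboundary, CofaceFamily.diff, LinearMap.sum_apply, LinearMap.smul_apply,
    map_sum, map_smul, TupleChain.eval_push, ρ.simplex_pull, smul_eq_mul]

theorem op_sub (c c' : TupleChain l (K.pt m)) (u : Cochain Y l) :
    ρ.op (c - c') u = ρ.op c u - ρ.op c' u := by
  funext s
  simp [op]

theorem op_single (f : Fin (l + 1) → K.pt m) (u : Cochain Y l) (s : SingularSimplex X m) :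
    ρ.op (Finsupp.single f 1) u s = u (ρ.simplex s f) := by
  simp [op, TupleChain.eval]

theorem vanishesOn_op {A : Set X} {A' : Set Y}
    (hA : ∀ {m l : ℕ} (s : SingularSimplex X m) (f : Fin (l + 1) → K.pt m), s.LiesIn A →
      (ρ.simplex s f).LiesIn A') {u : Cochain Y l} (hu : VanishesOn A' u)
    (c : TupleChain l (K.pt m)) : VanishesOn A (ρ.op c u) :=
  fun s hs => TupleChain.eval_eq_zero _ _ fun f _ => hu _ (hA s f hs)

variable (b : ∀ m, K.pt m) {c c' : ∀ m, TupleChain m (K.pt m)}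

theorem op_sub_op_zero
    (h0 : TupleChain.augmentation (c 0) = TupleChain.augmentation (c' 0)) (u : Cochain Y 0) :
    ρ.op (c 0) u - ρ.op (c' 0) u = ρ.op (K.htpy b c c' 0) (coboundary u) := by
  rw [op_coboundary, K.bd_htpy_zero b c c' h0, op_sub]

theorem op_sub_op_succ (hc : K.IsNatural c) (hc' : K.IsNatural c')
    (h0 : TupleChain.augmentation (c 0) = TupleChain.augmentation (c' 0))
    (u : Cochain Y (m + 1)) :
    ρ.op (c (m + 1)) u - ρ.op (c' (m + 1)) u =
      ρ.op (K.htpy b c c' (m + 1)) (coboundary u) + coboundary (ρ.op (K.htpy b c c' m) u) := by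
  rw [op_coboundary, K.bd_htpy_succ b hc hc' h0, coboundary_op, op_sub, op_sub, sub_add_cancel]

/-- The homotopy formula with supports. The term containing `coboundary u` dies on `A`, because
realized simplices stay in `A'`; the remaining term is the coboundary of a cochain that vanishes on
every member of `𝓑`, for the same reason. -/
theorem isCob_op_sub_op (b : ∀ m, K.pt m) {c c' : ∀ m, TupleChain m (K.pt m)} (hc : K.IsNatural c) (hc' : K.IsNatural c')
    (h0 : TupleChain.augmentation (c 0) = TupleChain.augmentation (c' 0))
    (u : Cochain Y m) {A : Set X} {A' : Set Y} {𝓑 : Set (Set X)}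
    (hA : ∀ {m l : ℕ} (s : SingularSimplex X m) (f : Fin (l + 1) → K.pt m), s.LiesIn A →
      (ρ.simplex s f).LiesIn A') (hu : VanishesOn A' (coboundary u))
    (h𝓑 : ∀ B ∈ 𝓑, ∃ B', (∀ {m l : ℕ} (s : SingularSimplex X m) (f : Fin (l + 1) → K.pt m),
      s.LiesIn B → (ρ.simplex s f).LiesIn B') ∧ VanishesOn B' u) :
    IsCob A 𝓑 (ρ.op (c m) u - ρ.op (c' m) u) := by
  cases m with
  | zero =>
    rw [ρ.op_sub_op_zero b h0 u]
    exact ρ.vanishesOn_op hA hu _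
  | succ m =>
    rw [ρ.op_sub_op_succ b hc hc' h0 u]
    refine ⟨ρ.op (K.htpy b c c' m) u, fun B hB => ?_, ?_⟩
    · obtain ⟨B', hB', hu'⟩ := h𝓑 B hB
      exact ρ.vanishesOn_op hB' hu' _
    · rw [add_sub_cancel_right]
      exact ρ.vanishesOn_op hA hu _

end Realization

/-! ### Homotopy invariance -/

/-- The vertices of the prisms `Δ^1 × Δ^m`. -/
abbrev prismFamily : CofaceFamily where
  pt m := Fin 2 × Fin (m + 1)
  coface i := Prod.map id i.succAbove
  coface_comp i j hij := by
    rw [Prod.map_comp_map, Prod.map_comp_map, succAbove_comp_succAbove i j hij]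

/-- The bottom or top face of the prism. -/
def prismEnd (e : Fin 2) (m : ℕ) : TupleChain m (prismFamily.pt m) :=
  Finsupp.single (fun j => (e, j) : Fin (m + 1) → prismFamily.pt m) 1

theorem prismEnd_isNatural (e : Fin 2) : prismFamily.IsNatural (prismEnd e) := fun m => by
  simp only [TupleChain.bd, prismEnd, Finsupp.linearCombination_single, one_smul,
    CofaceFamily.diff, TupleChain.push, LinearMap.sum_apply, LinearMap.smul_apply]
  rfl

section Homotopy

variable {X Y : Type} [TopologicalSpace X] [TopologicalSpace Y] {m : ℕ}

/-- The simplices of the prisms, mapped by a homotopy. -/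
def prismRealization (H : C(unitInterval × X, Y)) : Realization prismFamily X Y where
  simplex s f := H.comp (ContinuousMap.prodMk
    ⟨fun x => stdSimplexHomeomorphUnitInterval (stdSimplex.map (fun j => (f j).1) x),
      stdSimplexHomeomorphUnitInterval.continuous.comp (stdSimplex.continuous_map _)⟩
    (s.pull (fun j => (f j).2)))
  pull_simplex s f i := by
    ext p
    simp [SingularSimplex.pull, stdSimplex.map_comp_apply, Function.comp_def]
  simplex_pull s f i := by
    ext p
    simp [SingularSimplex.pull, stdSimplex.map_comp_apply, Function.comp_def]

theorem prismRealization_op_end (H : C(unitInterval × X, Y)) (u : Cochain Y m) (e : Fin 2) :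
    (prismRealization H).op (prismEnd e m) u =
      u.pullback (H.curry (stdSimplexHomeomorphUnitInterval (stdSimplex.vertex e))) := by
  funext s
  rw [prismEnd, Realization.op_single]
  congr 1
  ext p
  have h : stdSimplex.map (S := ℝ) (fun _ : Fin (m + 1) => e) p = stdSimplex.vertex e := by
    ext i
    have := p.2.2
    by_cases h : e = i <;>
      simp [FunOnFinite.linearMap_apply_apply, h, eq_comm]
  have h2 : stdSimplex.map (S := ℝ) (fun j : Fin (m + 1) => j) p = p := stdSimplex.map_id_apply p
  change H (stdSimplexHomeomorphUnitInterval (stdSimplex.map (fun _ => e) p),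
    s (stdSimplex.map (fun j => j) p)) = H (_, s p)
  rw [h, h2]

/-- The two ends of the prism are natural families with equal augmentation, so the acyclic-models
comparison supplies the prism operator without triangulating anything. It suffices that each slice
of the homotopy respects the subsets. -/
theorem isCob_homotopy (H : C(unitInterval × X, Y)) (u : Cochain Y m) {A : Set X} {A' : Set Y}
    {𝓑 : Set (Set X)} (hA : ∀ t, Set.MapsTo (H.curry t) A A') (hu : VanishesOn A' (coboundary u))
    (h𝓑 : ∀ B ∈ 𝓑, ∃ B', (∀ t, Set.MapsTo (H.curry t) B B') ∧ VanishesOn B' u) :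
    IsCob A 𝓑 (u.pullback (H.curry 1) - u.pullback (H.curry 0)) := by
  have key := (prismRealization H).isCob_op_sub_op (fun m => (0, 0)) (prismEnd_isNatural 1)
    (prismEnd_isNatural 0) (by simp [prismEnd, TupleChain.augmentation]) u (A := A) (A' := A')
    (𝓑 := 𝓑) (fun s f hs p => hA _ (hs.pull _ p)) hu (fun B hB => by
      obtain ⟨B', h1, h2⟩ := h𝓑 B hB
      exact ⟨B', fun s f hs p => h1 _ (hs.pull _ p), h2⟩)
  rw [prismRealization_op_end, prismRealization_op_end] at key
  exact key

end Homotopy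

/-! ### Affine simplices -/

section Affine

variable {ι κ κ' : Type} [Fintype ι] [Fintype κ] [Fintype κ']

/-- The affine map of standard simplices with given vertices. -/
def affineMap (g : ι → stdSimplex ℝ κ) : C(stdSimplex ℝ ι, stdSimplex ℝ κ) where
  toFun x := ⟨∑ j, x j • (g j).1, (convex_stdSimplex ℝ κ).sum_mem (fun j _ => x.2.1 j) x.2.2
    fun j _ => (g j).2⟩
  continuous_toFun := by
    refine Continuous.subtype_mk (continuous_finsetSum _ fun j _ => ?_) _
    exact ((continuous_apply j).comp continuous_subtype_val).smul continuous_const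

theorem affineMap_coe (g : ι → stdSimplex ℝ κ) (x : stdSimplex ℝ ι) :
    (affineMap g x).1 = ∑ j, x j • (g j).1 := rfl

theorem sum_map_smul {E : Type*} [AddCommGroup E] [Module ℝ E] (φ : ι → κ) (x : stdSimplex ℝ ι)
    (h : κ → E) : ∑ k, (stdSimplex.map φ x) k • h k = ∑ j, x j • h (φ j) := by
  classical
  simp only [stdSimplex.map_coe, FunOnFinite.linearMap_apply_apply, Finset.sum_smul]
  rw [← Finset.sum_fiberwise Finset.univ φ]
  refine Finset.sum_congr rfl fun k _ => Finset.sum_congr rfl fun j hj => ?_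
  rw [(Finset.mem_filter.mp hj).2]

theorem affineMap_map (g : κ → stdSimplex ℝ κ') (φ : ι → κ) (x : stdSimplex ℝ ι) :
    affineMap g (stdSimplex.map φ x) = affineMap (g ∘ φ) x :=
  Subtype.ext (sum_map_smul φ x fun k => (g k).1)

theorem map_affineMap (φ : κ → κ') (g : ι → stdSimplex ℝ κ) (x : stdSimplex ℝ ι) :
    stdSimplex.map φ (affineMap g x) = affineMap (stdSimplex.map φ ∘ g) x := by
  refine Subtype.ext ?_
  change FunOnFinite.linearMap ℝ ℝ φ (∑ j, x j • (g j).1) = _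
  rw [map_sum]
  simp only [map_smul]
  rfl

theorem affineMap_vertex [DecidableEq ι] (x : stdSimplex ℝ ι) :
    affineMap (stdSimplex.vertex : ι → stdSimplex ℝ ι) x = x := by
  refine Subtype.ext (funext fun i => ?_)
  simp [affineMap_coe, Finset.sum_apply, Pi.single_apply]
  rfl

theorem sum_affineMap_smul {E : Type*} [AddCommGroup E] [Module ℝ E] (g : ι → stdSimplex ℝ κ)
    (x : stdSimplex ℝ ι) (h : κ → E) :
    ∑ k, (affineMap g x) k • h k = ∑ j, x j • ∑ k, g j k • h k := by
  have : ∀ k, (affineMap g x) k = ∑ j, x j * g j k := fun k => by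
    change (affineMap g x).1 k = _
    rw [affineMap_coe, Finset.sum_apply]
    rfl
  simp only [this, Finset.sum_smul, Finset.smul_sum, smul_smul]
  exact Finset.sum_comm

theorem affineMap_affineMap (h : κ → stdSimplex ℝ κ') (g : ι → stdSimplex ℝ κ)
    (x : stdSimplex ℝ ι) : affineMap h (affineMap g x) = affineMap (affineMap h ∘ g) x :=
  Subtype.ext (sum_affineMap_smul g x fun k => (h k).1)

theorem norm_sum_smul_sub_le {E : Type*} [NormedAddCommGroup E] [NormedSpace ℝ E]
    (x : stdSimplex ℝ ι) (h : ι → E) (c : E) {r : ℝ} (hr : ∀ j, ‖h j - c‖ ≤ r) :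
    ‖∑ j, x j • h j - c‖ ≤ r := by
  have := (convex_closedBall c r).sum_mem (t := Finset.univ) (w := x) (z := h)
    (fun j _ => x.2.1 j) x.2.2 (fun j _ => mem_closedBall_iff_norm.mpr (hr j))
  exact mem_closedBall_iff_norm.mp this

end Affine

/-- The points of the standard simplices. -/
abbrev simplexFamily : CofaceFamily where
  pt m := stdSimplex ℝ (Fin (m + 1))
  coface i := stdSimplex.map i.succAbove
  coface_comp i j hij := by
    funext x
    simp only [Function.comp_apply, stdSimplex.map_comp_apply]
    rw [succAbove_comp_succAbove i j hij]

/-- Affine simplices in singular simplices. -/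
def affineRealization (X : Type) [TopologicalSpace X] : Realization simplexFamily X X where
  simplex s g := s.comp (affineMap g)
  pull_simplex s f i := by
    ext p
    simp [SingularSimplex.pull, affineMap_map]
  simplex_pull s f i := by
    ext p
    simp [SingularSimplex.pull, map_affineMap]

/-! ### Barycentric subdivision -/

/-- The simplices themselves. -/
def vertexChain (m : ℕ) : TupleChain m (simplexFamily.pt m) :=
  Finsupp.single (stdSimplex.vertex : Fin (m + 1) → simplexFamily.pt m) 1

/-- The barycentric subdivision of the standard simplices. -/
def subdivision : ∀ m, TupleChain m (simplexFamily.pt m)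
  | 0 => vertexChain 0
  | m + 1 => TupleChain.cone stdSimplex.barycenter (simplexFamily.diff (subdivision m))

theorem vertexChain_isNatural : simplexFamily.IsNatural vertexChain := fun m => by
  rw [vertexChain, TupleChain.bd, Finsupp.linearCombination_single, one_smul,
    CofaceFamily.diff, LinearMap.sum_apply]
  refine Finset.sum_congr rfl fun i _ => ?_
  rw [LinearMap.smul_apply, vertexChain, TupleChain.push, Finsupp.linearCombination_single,
    one_smul]
  congr 2
  funext j
  simp

theorem subdivision_isNatural : simplexFamily.IsNatural subdivision := fun m => by
  cases m with
  | zero =>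
    -- The two endpoints of an edge have signs `1` and `-1`, so the augmentation term vanishes.
    rw [subdivision.eq_def, TupleChain.bd_cone_zero, simplexFamily.augmentation_diff]
    simp [Fin.sum_univ_two]
  | succ m =>
    rw [subdivision, TupleChain.bd_cone, simplexFamily.bd_diff, subdivision_isNatural m,
      simplexFamily.diff_diff, map_zero, sub_zero]

theorem exists_of_mem_support_diff {K : CofaceFamily} {l m : ℕ} {c : TupleChain l (K.pt m)}
    {f : Fin (l + 1) → K.pt (m + 1)} (h : f ∈ (K.diff c).support) :
    ∃ i, ∃ g ∈ c.support, f = K.coface i ∘ g := by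
  classical
  by_contra! hc
  rw [Finsupp.mem_support_iff] at h
  apply h
  rw [CofaceFamily.diff, LinearMap.sum_apply, Finsupp.finsetSum_apply]
  refine Finset.sum_eq_zero fun i _ => ?_
  rw [LinearMap.smul_apply, Finsupp.smul_apply]
  by_contra h0
  have : f ∈ (TupleChain.push (K.coface i) c).support := by
    rw [Finsupp.mem_support_iff]
    intro h1
    rw [h1, smul_zero] at h0
    exact h0 rfl
  obtain ⟨g, hg, hf⟩ := TupleChain.exists_of_mem_support_push this
  exact hc i g hg hf

/-- The difference is the average of the `m + 2` vectors `h k - h j`, one of which is zero; this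
gives the factor `(m + 1) / (m + 2)`. -/
theorem norm_barycenter_sub_le {E : Type*} [NormedAddCommGroup E] [NormedSpace ℝ E] {m : ℕ}
    (h : Fin (m + 2) → E) {D : ℝ} (hD : ∀ i j, ‖h i - h j‖ ≤ D) (j : Fin (m + 2)) :
    ‖∑ k, (stdSimplex.barycenter : stdSimplex ℝ (Fin (m + 2))) k • h k - h j‖ ≤
      ((m + 1 : ℕ) / (m + 2 : ℕ) : ℝ) * D := by
  have hb : ∀ k, (stdSimplex.barycenter : stdSimplex ℝ (Fin (m + 2))) k = ((m + 2 : ℕ) : ℝ)⁻¹ :=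
    fun k => by
      change (stdSimplex.barycenter : stdSimplex ℝ (Fin (m + 2))).1 k = _
      rw [stdSimplex.barycenter_apply, Fintype.card_fin]
  have hm : ((m + 2 : ℕ) : ℝ) ≠ 0 := by positivity
  have h1 : ∑ k, (stdSimplex.barycenter : stdSimplex ℝ (Fin (m + 2))) k • h k - h j =
      ((m + 2 : ℕ) : ℝ)⁻¹ • ∑ k, (h k - h j) := by
    simp only [hb, ← Finset.smul_sum, Finset.sum_sub_distrib, Finset.sum_const, Finset.card_univ,
      Fintype.card_fin, smul_sub]
    rw [← Nat.cast_smul_eq_nsmul ℝ, smul_smul, inv_mul_cancel₀ hm, one_smul]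
  rw [h1, norm_smul, norm_inv, RCLike.norm_natCast, Fin.sum_univ_succAbove _ j, sub_self, zero_add,
    div_eq_inv_mul, mul_assoc]
  refine mul_le_mul_of_nonneg_left ?_ (by positivity)
  refine (norm_sum_le _ _).trans ((Finset.sum_le_sum fun i _ => hD _ j).trans ?_)
  simp

/-- An edge of the subdivision either ends at the barycentre or lies in a subdivided face, which is
handled by induction. Arbitrary vertices `h` in a normed space are allowed so that the estimate can
be iterated on affine pieces of pieces. -/
theorem norm_subdivision_le {E : Type*} [NormedAddCommGroup E] [NormedSpace ℝ E] {m : ℕ} :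
    ∀ (h : Fin (m + 1) → E) {D : ℝ}, (∀ i j, ‖h i - h j‖ ≤ D) →
    ∀ g ∈ (subdivision m).support, ∀ a b,
      ‖∑ k, g a k • h k - ∑ k, g b k • h k‖ ≤ ((m : ℕ) / (m + 1 : ℕ) : ℝ) * D := by
  induction m with
  | zero =>
    intro h D hD g hg a b
    rw [show a = b by lia, sub_self, norm_zero]
    simp
  | succ m ih =>
    intro h D hD g hg
    have hD0 : 0 ≤ D := (norm_nonneg _).trans (hD 0 0)
    obtain ⟨g', hg', rfl⟩ := TupleChain.exists_of_mem_support_cone hg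
    obtain ⟨i, g, hgm, rfl⟩ := exists_of_mem_support_diff hg'
    have hs : ∀ a : Fin (m + 1), ‖∑ k, (stdSimplex.barycenter : stdSimplex ℝ (Fin (m + 2))) k • h k -
        ∑ k, (stdSimplex.map i.succAbove (g a)) k • h k‖ ≤ ((m + 1 : ℕ) / (m + 2 : ℕ) : ℝ) * D := by
      intro a
      rw [norm_sub_rev]
      refine norm_sum_smul_sub_le _ _ _ fun j => ?_
      rw [norm_sub_rev]
      exact norm_barycenter_sub_le h hD j
    intro a b
    refine Fin.cases ?_ (fun a => ?_) a <;> refine Fin.cases ?_ (fun b => ?_) b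
    · rw [sub_self, norm_zero]
      positivity
    · exact hs b
    · rw [norm_sub_rev]
      exact hs a
    · have := ih (h ∘ i.succAbove) (D := D) (fun _ _ => hD _ _) g hgm a b
      simp only [Fin.cons_succ, Function.comp_apply, sum_map_smul]
      refine this.trans (mul_le_mul_of_nonneg_right ?_ hD0)
      -- The contraction factor of a face, `m / (m + 1)`, does not exceed that of the simplex, `(m +
      -- 1) / (m + 2)`.
      rw [div_le_div_iff₀ (by positivity) (by positivity)]
      norm_cast
      nlinarith

section SmallSimplices

variable {X : Type} [TopologicalSpace X] {m : ℕ}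

/-- The subdivision operator on cochains. -/
def subdivide (u : Cochain X m) : Cochain X m := (affineRealization X).op (subdivision m) u

theorem coboundary_subdivide (u : Cochain X m) :
    coboundary (subdivide u) = subdivide (coboundary u) := by
  rw [subdivide, subdivide, Realization.coboundary_op, Realization.op_coboundary,
    subdivision_isNatural]

theorem coboundary_subdivide_iterate (u : Cochain X m) (j : ℕ) :
    coboundary (subdivide^[j] u) = subdivide^[j] (coboundary u) := by
  induction j with
  | zero => rfl
  | succ j ih => rw [Function.iterate_succ_apply', Function.iterate_succ_apply',
      coboundary_subdivide, ih]

theorem subdivide_sub (u v : Cochain X m) : subdivide (u - v) = subdivide u - subdivide v := by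
  funext s
  change TupleChain.eval _ _ = TupleChain.eval _ _ - TupleChain.eval _ _
  simp only [TupleChain.eval, Finsupp.linearCombination_apply, ← Finsupp.sum_sub, Pi.sub_apply,
    smul_sub]

theorem subdivide_iterate_sub (u v : Cochain X m) (j : ℕ) :
    subdivide^[j] (u - v) = subdivide^[j] u - subdivide^[j] v := by
  induction j with
  | zero => rfl
  | succ j ih => rw [Function.iterate_succ_apply', ih, subdivide_sub,
      Function.iterate_succ_apply', Function.iterate_succ_apply']

/-- The homotopy between the identity and the subdivision. -/
def subdivisionHtpy (u : Cochain X (m + 1)) : Cochain X m :=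
  (affineRealization X).op
    (simplexFamily.htpy (fun _ => stdSimplex.barycenter) vertexChain subdivision m) u

theorem affineRealization_liesIn {A : Set X} {l : ℕ} (s : SingularSimplex X m)
    (f : Fin (l + 1) → simplexFamily.pt m) (hs : s.LiesIn A) :
    ((affineRealization X).simplex s f).LiesIn A := fun _ => hs _

theorem VanishesOn.subdivide {A : Set X} {u : Cochain X m} (h : VanishesOn A u) :
    VanishesOn A (subdivide u) :=
  (affineRealization X).vanishesOn_op affineRealization_liesIn h _

theorem VanishesOn.subdivide_iterate {A : Set X} {u : Cochain X m} (h : VanishesOn A u) (j : ℕ) :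
    VanishesOn A (TorusCapacity.subdivide^[j] u) := by
  induction j with
  | zero => exact h
  | succ j ih => rw [Function.iterate_succ_apply']; exact ih.subdivide

theorem VanishesOn.subdivisionHtpy {A : Set X} {u : Cochain X (m + 1)} (h : VanishesOn A u) :
    VanishesOn A (subdivisionHtpy u) :=
  (affineRealization X).vanishesOn_op affineRealization_liesIn h _

theorem op_vertexChain (u : Cochain X m) : (affineRealization X).op (vertexChain m) u = u := by
  funext s
  rw [vertexChain, Realization.op_single]
  congr 1
  ext p
  simp only [affineRealization, ContinuousMap.comp_apply]
  rw [affineMap_vertex]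

theorem sub_subdivide (u : Cochain X (m + 1)) :
    u - subdivide u = subdivisionHtpy (coboundary u) + coboundary (subdivisionHtpy u) := by
  have := (affineRealization X).op_sub_op_succ (fun _ => stdSimplex.barycenter)
    vertexChain_isNatural subdivision_isNatural rfl u
  rwa [op_vertexChain] at this

/-- The iterated pieces of `s` shrink geometrically, so by the Lebesgue number lemma each of them
eventually lies in one member of the cover, where `v` vanishes. -/
theorem subdivide_iterate_eq_zero {ι : Type} {A : Set X} {O : ι → Set X} (hO : ∀ i, IsOpen (O i))
    (hA : A ⊆ ⋃ i, O i) (s : SingularSimplex X m) (hs : s.LiesIn A) :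
    ∃ N, ∀ j ≥ N, ∀ v : Cochain X m, (∀ i, VanishesOn (A ∩ O i) v) → (subdivide^[j] v) s = 0 := by
  obtain ⟨δ, hδ, hball⟩ := lebesgue_number_lemma_of_metric (s := Set.univ) (c := fun i => s ⁻¹' O i)
    isCompact_univ (fun i => (hO i).preimage s.continuous) (fun p _ => by
      obtain ⟨i, hi⟩ := Set.mem_iUnion.mp (hA (hs p))
      exact Set.mem_iUnion.mpr ⟨i, hi⟩)
  set θ : ℝ := (m : ℕ) / (m + 1 : ℕ) with hθ
  have hθ0 : 0 ≤ θ := by positivity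
  have hθ1 : θ < 1 := by
    rw [hθ, div_lt_one (by positivity)]
    norm_cast
    lia
  -- The induction must range over all affine simplices `h`: the outermost subdivision replaces `h`
  -- by its pieces, whose diameter is at most `θ * D`.
  have step : ∀ j, ∀ (h : Fin (m + 1) → stdSimplex ℝ (Fin (m + 1))) (D : ℝ),
      (∀ a b, ‖(h a).1 - (h b).1‖ ≤ D) → θ ^ j * D < δ → ∀ v : Cochain X m,
      (∀ i, VanishesOn (A ∩ O i) v) → (subdivide^[j] v) (s.comp (affineMap h)) = 0 := by
    intro j
    induction j with
    | zero =>
      intro h D hD hlt v hv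
      obtain ⟨i, hi⟩ := hball (h 0) (Set.mem_univ _)
      refine hv i _ fun p => ⟨hs _, hi ?_⟩
      rw [Metric.mem_ball, Subtype.dist_eq, dist_eq_norm]
      refine lt_of_le_of_lt (norm_sum_smul_sub_le p (fun j => (h j).1) _ fun j => hD j 0) ?_
      simpa using hlt
    | succ j ih =>
      intro h D hD hlt v hv
      rw [Function.iterate_succ_apply']
      refine TupleChain.eval_eq_zero _ _ fun g hg => ?_
      have hcomp : (affineRealization X).simplex (s.comp (affineMap h)) g =
          s.comp (affineMap (affineMap h ∘ g)) := by
        ext p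
        simp only [affineRealization, ContinuousMap.comp_apply, affineMap_affineMap]
      rw [hcomp]
      refine ih _ (θ * D) (fun a b => ?_) (by rwa [← mul_assoc, ← pow_succ]) v hv
      exact norm_subdivision_le (fun k => (h k).1) hD g hg a b
  have htend : Filter.Tendsto (fun j : ℕ => θ ^ j * 1) Filter.atTop (nhds 0) := by
    simpa using tendsto_pow_atTop_nhds_zero_of_lt_one hθ0 hθ1
  obtain ⟨N, hN⟩ := Filter.eventually_atTop.mp (htend.eventually (gt_mem_nhds hδ))
  refine ⟨N, fun j hj v hv => ?_⟩
  have := step j stdSimplex.vertex 1 (fun a b => ?_) (hN j hj) v hv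
  · convert this using 2
    ext p
    rw [ContinuousMap.comp_apply, affineMap_vertex]
  · rw [← dist_eq_norm]
    exact (Metric.dist_le_diam_of_mem (bounded_stdSimplex _) (stdSimplex.vertex a).2
      (stdSimplex.vertex b).2).trans diam_stdSimplex_le

/-- A cocycle which vanishes on the simplices subordinate to an open cover is the coboundary of
such a cochain. -/
theorem isCob_of_vanishesOn_small {ι : Type} {A : Set X} {O : ι → Set X}
    (hO : ∀ i, IsOpen (O i)) (hA : A ⊆ ⋃ i, O i) {u : Cochain X m}
    (hδ : VanishesOn A (coboundary u)) (hu : ∀ i, VanishesOn (A ∩ O i) u) :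
    IsCob A (Set.range fun i => A ∩ O i) u := by
  cases m with
  | zero =>
    intro s hs
    obtain ⟨i, hi⟩ := Set.mem_iUnion.mp (hA (hs (stdSimplex.vertex 0)))
    refine hu i s fun p => ?_
    have : p = stdSimplex.vertex 0 := Subsingleton.elim _ _
    rw [this]
    exact ⟨hs _, hi⟩
  | succ m =>
    classical
    -- On `A`, the coboundary of `y j` is the difference of the `j`-th and the `(j + 1)`-st
    -- subdivisions of `u`. The primitive is the infinite telescoping sum of the `y j`, which makes
    -- sense because only finitely many terms are non-zero on any given simplex of `A`.
    set y : ℕ → Cochain X m := fun j => subdivide^[j] (subdivisionHtpy u)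
    have hy : ∀ j i, VanishesOn (A ∩ O i) (y j) := fun j i =>
      (hu i).subdivisionHtpy.subdivide_iterate j
    have hN : ∀ s : SingularSimplex X m, ∃ N, s.LiesIn A → ∀ j ≥ N, y j s = 0 := by
      intro s
      by_cases hs : s.LiesIn A
      · obtain ⟨N, hN⟩ := subdivide_iterate_eq_zero hO hA s hs
        exact ⟨N, fun _ j hj => hN j hj _ fun i => (hu i).subdivisionHtpy⟩
      · exact ⟨0, fun h => absurd h hs⟩
    choose N hN using hN
    set w : Cochain X m := fun s => ∑ j ∈ Finset.range (N s), y j s with hw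
    have hwN : ∀ s : SingularSimplex X m, s.LiesIn A → ∀ n ≥ N s,
        w s = ∑ j ∈ Finset.range n, y j s := fun s hs n hn =>
      Finset.sum_subset (Finset.range_mono hn) fun j _ hj =>
        hN s hs j (by simpa using hj)
    refine ⟨w, ?_, ?_⟩
    · rintro _ ⟨i, rfl⟩ s hs
      exact Finset.sum_eq_zero fun j _ => hy j i s hs
    · intro s hs
      obtain ⟨N₀, hN₀⟩ := subdivide_iterate_eq_zero hO hA s hs
      -- One truncation length that serves `s` and all its faces.
      set n := N₀ + ∑ i : Fin (m + 2), N (s.pull i.succAbove) with hn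
      have hni : ∀ i : Fin (m + 2), N (s.pull i.succAbove) ≤ n := fun i =>
        (Finset.single_le_sum (f := fun i : Fin (m + 2) => N (s.pull i.succAbove))
          (fun _ _ => Nat.zero_le _) (Finset.mem_univ i)).trans (Nat.le_add_left _ _)
      have h1 : coboundary w s = ∑ j ∈ Finset.range n, coboundary (y j) s := by
        simp only [coboundary]
        rw [Finset.sum_comm]
        refine Finset.sum_congr rfl fun i _ => ?_
        rw [hwN _ (hs.pull _) n (hni i), Finset.mul_sum]
      have h2 : ∀ j, coboundary (y j) s = (subdivide^[j] u) s - (subdivide^[j + 1] u) s := by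
        intro j
        have h3 : coboundary (subdivisionHtpy u) =
            u - subdivide u - subdivisionHtpy (coboundary u) := by
          rw [sub_subdivide]
          abel
        have h4 : (subdivide^[j] (subdivisionHtpy (coboundary u))) s = 0 :=
          hδ.subdivisionHtpy.subdivide_iterate j s hs
        rw [coboundary_subdivide_iterate, h3, subdivide_iterate_sub, subdivide_iterate_sub,
          Pi.sub_apply, h4, sub_zero, Pi.sub_apply, ← Function.iterate_succ_apply]
      rw [Pi.sub_apply, h1]
      simp only [h2]
      rw [Finset.sum_range_sub', hN₀ n (Nat.le_add_right _ _) u hu]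
      simp

end SmallSimplices

/-! ### Vanishing of cohomology in high degrees -/

section CohDim

variable {X Y : Type} [TopologicalSpace X] [TopologicalSpace Y]

/-- The cohomology of `A` vanishes in the degrees above `N`. -/
def CohDimLE (A : Set X) (N : ℕ) : Prop :=
  ∀ m > N, ∀ u : Cochain X m, VanishesOn A (coboundary u) → IsCob A ∅ u

theorem CohDimLE.mono {A : Set X} {N N' : ℕ} (h : CohDimLE A N) (hN : N ≤ N') : CohDimLE A N' :=
  fun m hm => h m (by lia)

theorem cohDimLE_empty (N : ℕ) : CohDimLE (∅ : Set X) N :=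
  fun _ _ u _ => IsCob.of_vanishesOn (vanishesOn_empty u) _

/-- The extension by zero of a cochain of a subspace. -/
def Cochain.extend {A : Set X} {m : ℕ} (u : Cochain A m) : Cochain X m :=
  open Classical in
  fun s => if h : s.LiesIn A then u ⟨fun p => ⟨s p, h p⟩, s.continuous.subtype_mk _⟩ else 0

/-- The inclusion of a subspace. -/
def inclusionMap (A : Set X) : C(A, X) := ⟨Subtype.val, continuous_subtype_val⟩

theorem Cochain.extend_apply {A : Set X} {m : ℕ} (u : Cochain A m) {s : SingularSimplex X m}
    (hs : s.LiesIn A) : u.extend s = u ⟨fun p => ⟨s p, hs p⟩, s.continuous.subtype_mk _⟩ := by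
  simp only [Cochain.extend]
  rw [dif_pos hs]

theorem Cochain.pullback_extend {A : Set X} {m : ℕ} (u : Cochain A m) :
    u.extend.pullback (inclusionMap A) = u := by
  funext s
  have h : SingularSimplex.LiesIn ((inclusionMap A).comp s : SingularSimplex X m) A :=
    fun p => (s p).2
  simp only [Cochain.pullback, Cochain.extend]
  rw [dif_pos h]
  rfl

theorem Cochain.extend_pullback_apply {A : Set X} {m : ℕ} (u : Cochain X m)
    {s : SingularSimplex X m} (hs : s.LiesIn A) :
    (u.pullback (inclusionMap A)).extend s = u s := by
  simp only [Cochain.extend]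
  rw [dif_pos hs]
  rfl

theorem coboundary_extend_apply {A : Set X} {m : ℕ} (u : Cochain A m)
    {s : SingularSimplex X (m + 1)} (hs : s.LiesIn A) :
    coboundary u.extend s = (coboundary u).extend s := by
  rw [Cochain.extend_apply _ hs]
  simp only [coboundary]
  refine Finset.sum_congr rfl fun i _ => ?_
  rw [Cochain.extend_apply _ (hs.pull _)]
  rfl

/-- Cochains live on the ambient space, whereas homotopy equivalences between subsets are only
defined on the subsets. Extension by zero commutes with the coboundary on simplices of `A`, which
makes the two points of view interchangeable. -/
theorem cohDimLE_subtype {A : Set X} {N : ℕ} :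
    CohDimLE (Set.univ : Set A) N ↔ CohDimLE A N := by
  constructor
  · intro h m hm u hu
    have h1 := h m hm (u.pullback (inclusionMap A)) (fun s _ => by
      rw [coboundary_pullback]
      exact hu _ fun p => (s p).2)
    cases m with
    | zero => lia
    | succ m =>
      obtain ⟨w, -, hw⟩ := h1
      refine ⟨w.extend, fun _ h => h.elim, fun s hs => ?_⟩
      have := hw ⟨fun p => ⟨s p, hs p⟩, s.continuous.subtype_mk _⟩ (fun _ => trivial)
      rw [Pi.sub_apply, coboundary_extend_apply _ hs, ← u.extend_pullback_apply hs]
      simp only [Cochain.extend]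
      rw [dif_pos hs, dif_pos hs]
      exact this
  · intro h m hm u hu
    have h1 := h m hm u.extend (fun s hs => by
      rw [coboundary_extend_apply _ hs]
      simp only [Cochain.extend]
      rw [dif_pos hs]
      exact hu _ fun _ => trivial)
    have h2 := h1.pullback (f := inclusionMap A) (A' := Set.univ) (𝓑' := ∅)
      (fun p _ => p.2) (fun _ h => h.elim)
    rwa [u.pullback_extend] at h2

theorem CohDimLE.of_homotopy {A : Set X} {B : Set Y} {N : ℕ} (h : CohDimLE B N) (f : C(A, B))
    (g : C(B, A)) (hgf : (g.comp f).Homotopic (ContinuousMap.id A)) : CohDimLE A N := by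
  rw [← cohDimLE_subtype] at h ⊢
  intro m hm u hu
  obtain ⟨H⟩ := hgf
  have h1 := isCob_homotopy H.toContinuousMap u (A := Set.univ) (A' := Set.univ) (𝓑 := ∅)
    (fun _ _ _ => trivial) hu (fun _ h => h.elim)
  have e1 : H.toContinuousMap.curry 1 = ContinuousMap.id A := by ext x; simp
  have e0 : H.toContinuousMap.curry 0 = g.comp f := by ext x; simp
  rw [e1, e0] at h1
  refine IsCob.of_sub (u := u) h1 ?_
  have h2 := h m hm (u.pullback g) (hu.pullback (fun _ _ => trivial))
  exact h2.pullback (f := f) (fun _ _ => trivial) (fun _ h => h.elim)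

theorem CohDimLE.of_openPartialHomeomorph (e : OpenPartialHomeomorph X Y) {A : Set X} {B : Set Y}
    {N : ℕ} (h : CohDimLE B N) (hA : A ⊆ e.source) (hAB : Set.MapsTo e A B)
    (hB : B ⊆ e.target) (hBA : Set.MapsTo e.symm B A) : CohDimLE A N := by
  refine h.of_homotopy
    ⟨hAB.restrict, (e.continuousOn.mono hA).mapsToRestrict hAB⟩
    ⟨hBA.restrict, (e.symm.continuousOn.mono hB).mapsToRestrict hBA⟩ ?_
  have : ContinuousMap.comp ⟨hBA.restrict, (e.symm.continuousOn.mono hB).mapsToRestrict hBA⟩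
      ⟨hAB.restrict, (e.continuousOn.mono hA).mapsToRestrict hAB⟩ = ContinuousMap.id A := by
    ext x
    exact e.left_inv (hA x.2)
  rw [this]

/-- Use `a` on the simplices of `U` and `b` on all others. On simplices of `V` the result agrees
with `b`, because `a` and `b` agree on the overlap. Thus `u` minus its coboundary vanishes on
simplices subordinate to `U` and `V`, and the small simplices theorem applies. -/
theorem isCob_of_glue {U V : Set X} (hU : IsOpen U) (hV : IsOpen V) {m : ℕ}
    {u : Cochain X (m + 1)} (hu : VanishesOn (U ∪ V) (coboundary u)) {a b : Cochain X m}
    (ha : VanishesOn U (u - coboundary a)) (hb : VanishesOn V (u - coboundary b))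
    (hab : VanishesOn (U ∩ V) (a - b)) : IsCob (U ∪ V) ∅ u := by
  classical
  set w : Cochain X m := fun s => if s.LiesIn U then a s else b s with hw
  have hwV : VanishesOn V (w - b) := by
    intro s hs
    by_cases h : s.LiesIn U
    · simpa [hw, h] using hab s fun p => ⟨h p, hs p⟩
    · simp [hw, h]
  have hwU : VanishesOn U (w - a) := fun s hs => by simp [hw, hs]
  have h1 : VanishesOn U (u - coboundary w) := by
    have := ha.sub hwU.coboundary
    rwa [coboundary_sub, sub_sub_sub_cancel_right] at this
  have h2 : VanishesOn V (u - coboundary w) := by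
    have := hb.sub hwV.coboundary
    rwa [coboundary_sub, sub_sub_sub_cancel_right] at this
  have h3 : IsCob (U ∪ V) _ (u - coboundary w) :=
    isCob_of_vanishesOn_small (A := U ∪ V) (O := fun i : Bool => cond i U V)
      (fun i => by cases i <;> assumption)
      (fun x hx => by
        rcases hx with hx | hx
        · exact Set.mem_iUnion.mpr ⟨true, hx⟩
        · exact Set.mem_iUnion.mpr ⟨false, hx⟩)
      (by rwa [coboundary_sub, coboundary_coboundary, sub_zero])
      (fun i => by
        cases i
        · exact h2.mono Set.inter_subset_right
        · exact h1.mono Set.inter_subset_right)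
  exact (h3.mono subset_rfl (fun _ h => h.elim)).of_sub
    (isCob_coboundary _ (fun _ h => h.elim))

/-- Mayer–Vietoris. -/
theorem CohDimLE.union {U V : Set X} (hU : IsOpen U) (hV : IsOpen V) {N : ℕ}
    (h1 : CohDimLE U (N + 1)) (h2 : CohDimLE V (N + 1)) (h3 : CohDimLE (U ∩ V) N) :
    CohDimLE (U ∪ V) (N + 1) := by
  intro m hm u hu
  obtain ⟨m, rfl⟩ : ∃ k, m = k + 2 := ⟨m - 2, by lia⟩
  obtain ⟨a, -, ha⟩ := h1 _ hm u (hu.mono Set.subset_union_left)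
  obtain ⟨b, -, hb⟩ := h2 _ hm u (hu.mono Set.subset_union_right)
  obtain ⟨c, -, hc⟩ := h3 (m + 1) (by lia) (a - b) (by
    have h := (hb.mono (A := U ∩ V) Set.inter_subset_right).sub
      (ha.mono (A := U ∩ V) Set.inter_subset_left)
    rwa [sub_sub_sub_cancel_left, ← coboundary_sub] at h)
  -- The primitives differ on the overlap by a cocycle, which is exact there; adding `coboundary c`
  -- makes them agree without changing the coboundary of `b`.
  refine isCob_of_glue hU hV hu (a := a) (b := b + coboundary c) ha ?_ ?_
  · rwa [coboundary_add, coboundary_coboundary, add_zero]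
  · rwa [← sub_sub]

theorem CohDimLE.union_of_disjoint {U V : Set X} (hU : IsOpen U) (hV : IsOpen V) {N : ℕ}
    (h1 : CohDimLE U N) (h2 : CohDimLE V N) (h3 : U ∩ V = ∅) : CohDimLE (U ∪ V) N := by
  intro m hm u hu
  obtain ⟨m, rfl⟩ : ∃ k, m = k + 1 := ⟨m - 1, by lia⟩
  obtain ⟨a, -, ha⟩ := h1 _ hm u (hu.mono Set.subset_union_left)
  obtain ⟨b, -, hb⟩ := h2 _ hm u (hu.mono Set.subset_union_right)
  refine isCob_of_glue hU hV hu ha hb ?_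
  rw [h3]
  exact vanishesOn_empty _

theorem sum_neg_one_pow_fin (m : ℕ) :
    ∑ i : Fin m, (-1 : ℤ) ^ (i : ℕ) = if Even m then 0 else 1 := by
  rw [Fin.sum_univ_eq_sum_range (fun i => (-1 : ℤ) ^ i)]
  exact neg_one_geom_sum

/-- There is at most one simplex in each degree, and the coboundary is alternately zero and the
identity. -/
theorem cohDimLE_of_subsingleton [Subsingleton X] (N : ℕ) : CohDimLE (Set.univ : Set X) N := by
  intro m hm u hu
  obtain ⟨m, rfl⟩ : ∃ k, m = k + 1 := ⟨m - 1, by lia⟩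
  have hsub : ∀ {l : ℕ} (s t : SingularSimplex X l), s = t :=
    fun s t => ContinuousMap.ext fun p => Subsingleton.elim _ _
  have hδ : ∀ {l : ℕ} (v : Cochain X l) (s : SingularSimplex X (l + 1)) (t : SingularSimplex X l),
      coboundary v s = (if Even (l + 2) then 0 else 1) * v t := by
    intro l v s t
    rw [← sum_neg_one_pow_fin, Finset.sum_mul]
    exact Finset.sum_congr rfl fun i _ => by rw [hsub (s.pull _) t]
  by_cases hm : Even (m + 1)
  · refine ⟨fun s => u ⟨fun _ => s (stdSimplex.vertex 0), continuous_const⟩,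
      fun _ h => h.elim, fun s _ => ?_⟩
    rw [Pi.sub_apply, hδ _ s (s.pull (0 : Fin (m + 2)).succAbove), if_neg (by grind), one_mul,
      sub_eq_zero]
    exact congrArg u (hsub _ _)
  · refine IsCob.of_vanishesOn (fun s _ => ?_) _
    have := hu ⟨fun _ => s (stdSimplex.vertex 0), continuous_const⟩ (fun _ => trivial)
    rwa [hδ u _ s, if_neg (by grind), one_mul] at this

theorem cohDimLE_of_contractible (A : Set X) [ContractibleSpace A] (N : ℕ) : CohDimLE A N := by
  obtain ⟨e⟩ := ContractibleSpace.hequiv_unit A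
  refine (cohDimLE_of_subsingleton (X := Unit) N).of_homotopy
    ((Homeomorph.Set.univ Unit).symm.toHomotopyEquiv.toFun.comp e.toFun)
    (e.invFun.comp (Homeomorph.Set.univ Unit).toHomotopyEquiv.toFun) ?_
  exact e.left_inv

theorem cohDimLE_of_convex {E : Type} [AddCommGroup E] [Module ℝ E] [TopologicalSpace E]
    [IsTopologicalAddGroup E] [ContinuousSMul ℝ E] {C : Set E} (hC : Convex ℝ C) (N : ℕ) :
    CohDimLE C N := by
  rcases C.eq_empty_or_nonempty with rfl | hne
  · exact cohDimLE_empty N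
  · have := hC.contractibleSpace hne
    exact cohDimLE_of_contractible C N

/-- Each set `ℓ i ≠ 0` cuts `C` into two disjoint convex pieces. Adding one functional by
Mayer–Vietoris, the overlap is two copies of the previous situation, over the halves of `C`; this is
why the induction is over all convex open `C`. -/
theorem cohDimLE_exists_ne_zero {E : Type} [NormedAddCommGroup E] [NormedSpace ℝ E]
    (ℓ : ℕ → E →L[ℝ] ℝ) (j : ℕ) : ∀ {C : Set E}, Convex ℝ C → IsOpen C →
    CohDimLE (C ∩ {x | ∃ i < j + 1, ℓ i x ≠ 0}) j := by
  have hpos : ∀ i, IsOpen {x | 0 < ℓ i x} ∧ Convex ℝ {x | 0 < ℓ i x} := fun i =>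
    ⟨isOpen_lt continuous_const (ℓ i).continuous, convex_halfSpace_gt (ℓ i).isLinear 0⟩
  have hneg : ∀ i, IsOpen {x | ℓ i x < 0} ∧ Convex ℝ {x | ℓ i x < 0} := fun i =>
    ⟨isOpen_lt (ℓ i).continuous continuous_const, convex_halfSpace_lt (ℓ i).isLinear 0⟩
  have hsplit : ∀ (D : Set E) (i : ℕ),
      D ∩ {x | ℓ i x ≠ 0} = (D ∩ {x | 0 < ℓ i x}) ∪ (D ∩ {x | ℓ i x < 0}) := by
    intro D i
    ext x
    simp only [Set.mem_inter_iff, Set.mem_ofPred_eq, Set.mem_union, ne_iff_lt_or_gt]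
    tauto
  have hdisj : ∀ (D D' : Set E) (i : ℕ), (D ∩ {x | 0 < ℓ i x}) ∩ (D' ∩ {x | ℓ i x < 0}) = ∅ := by
    intro D D' i
    ext x
    simp only [Set.mem_inter_iff, Set.mem_ofPred_eq, Set.mem_empty_iff_false, iff_false]
    rintro ⟨⟨-, h1⟩, -, h2⟩
    linarith
  induction j with
  | zero =>
    intro C hC hCo
    have : {x : E | ∃ i < 0 + 1, ℓ i x ≠ 0} = {x | ℓ 0 x ≠ 0} := by
      ext x
      simp
    rw [this, hsplit]
    exact CohDimLE.union_of_disjoint (hCo.inter (hpos 0).1) (hCo.inter (hneg 0).1)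
      (cohDimLE_of_convex (hC.inter (hpos 0).2) 0) (cohDimLE_of_convex (hC.inter (hneg 0).2) 0)
      (hdisj _ _ _)
  | succ j ih =>
    intro C hC hCo
    set Q := {x : E | ∃ i < j + 1, ℓ i x ≠ 0} with hQ
    have hQo : IsOpen Q := by
      have : Q = ⋃ i, ⋃ (_ : i < j + 1), {x | ℓ i x ≠ 0} := by
        ext x
        simp [hQ]
      rw [this]
      exact isOpen_iUnion fun i => isOpen_iUnion fun _ =>
        isOpen_ne_fun (ℓ i).continuous continuous_const
    have h1 : C ∩ {x : E | ∃ i < j + 1 + 1, ℓ i x ≠ 0} =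
        (C ∩ Q) ∪ (C ∩ {x | ℓ (j + 1) x ≠ 0}) := by
      ext x
      simp only [hQ, Set.mem_inter_iff, Set.mem_ofPred_eq, Set.mem_union, Nat.lt_succ_iff_lt_or_eq]
      grind
    have h2 : (C ∩ Q) ∩ (C ∩ {x | ℓ (j + 1) x ≠ 0}) =
        ((C ∩ {x | 0 < ℓ (j + 1) x}) ∩ Q) ∪ ((C ∩ {x | ℓ (j + 1) x < 0}) ∩ Q) := by
      rw [hsplit]
      ext x
      simp only [Set.mem_inter_iff, Set.mem_union]
      tauto
    have hCp := hCo.inter (hpos (j + 1)).1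
    have hCn := hCo.inter (hneg (j + 1)).1
    rw [h1]
    refine CohDimLE.union (hCo.inter hQo)
      (hCo.inter (isOpen_ne_fun (ℓ (j + 1)).continuous continuous_const))
      ((ih hC hCo).mono (by lia)) ?_ ?_
    · rw [hsplit]
      exact CohDimLE.union_of_disjoint hCp hCn (cohDimLE_of_convex (hC.inter (hpos _).2) _)
        (cohDimLE_of_convex (hC.inter (hneg _).2) _) (hdisj _ _ _)
    · rw [h2]
      refine CohDimLE.union_of_disjoint (hCp.inter hQo) (hCn.inter hQo)
        (ih (hC.inter (hpos _).2) hCp) (ih (hC.inter (hneg _).2) hCn) ?_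
      have := hdisj C C (j + 1)
      ext x
      have h3 := Set.ext_iff.mp this x
      simp only [Set.mem_inter_iff, Set.mem_empty_iff_false, iff_false] at h3 ⊢
      tauto

theorem cohDimLE_compl_zero (n : ℕ) : CohDimLE ({0}ᶜ : Set (Vec (n + 1))) n := by
  have h := cohDimLE_exists_ne_zero (E := Vec (n + 1))
    (fun i => if h : i < n + 1 then EuclideanSpace.proj (𝕜 := ℝ) ⟨i, h⟩ else 0) n
    convex_univ isOpen_univ
  have e : (Set.univ ∩ {x : Vec (n + 1) | ∃ i < n + 1, (if h : i < n + 1 then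
      EuclideanSpace.proj (𝕜 := ℝ) (⟨i, h⟩ : Fin (n + 1)) else 0 : Vec (n + 1) →L[ℝ] ℝ) x ≠ 0}) =
      {0}ᶜ := by
    ext x
    simp only [Set.univ_inter, Set.mem_ofPred_eq, Set.mem_compl_iff, Set.mem_singleton_iff]
    constructor
    · rintro ⟨i, hi, h⟩ rfl
      exact h (by simp)
    · intro hx
      by_contra! hc
      refine hx (PiLp.ext fun i => ?_)
      have := hc i i.2
      simpa [i.2] using this
  rwa [e] at h

end CohDim

/-! ### The sphere -/

section Sphere

variable {n : ℕ}

/-- The stereographic projection from a point of the sphere. -/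
def stereo (s : Sph n) : OpenPartialHomeomorph (Sph n) (Vec n) :=
  haveI := Fact.mk (@finrank_euclideanSpace_fin ℝ _ (n + 1))
  stereographic' n s

theorem stereo_source (s : Sph n) : (stereo s).source = {s}ᶜ := by
  simp [stereo]

theorem stereo_target (s : Sph n) : (stereo s).target = Set.univ := by
  simp [stereo]

theorem stereo_symm_eq (s : Sph n) : ⇑(stereo s).symm = stereoInv s := rfl

theorem stereo_neg (s : Sph n) : stereo s (-s) = 0 := by
  simp [stereo, stereographic']

theorem stereoInv_zero (s : Sph n) : stereoInv s 0 = -s := by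
  rw [← stereo_symm_eq, ← stereo_neg s]
  refine (stereo s).left_inv ?_
  rw [stereo_source]
  intro h
  have h1 : -(s : Vec (n + 1)) = s := congrArg Subtype.val h
  have h2 : (s : Vec (n + 1)) = 0 := by
    rw [neg_eq_iff_add_eq_zero, ← two_smul ℝ, smul_eq_zero] at h1
    simpa using h1
  have h3 := norm_eq_of_mem_sphere s
  rw [h2, norm_zero] at h3
  norm_num at h3

theorem cohDimLE_sphere_compl (s : Sph n) (N : ℕ) : CohDimLE ({s}ᶜ : Set (Sph n)) N :=
  (cohDimLE_of_convex (convex_univ (𝕜 := ℝ) (E := Vec n)) N).of_openPartialHomeomorph (stereo s)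
    (by rw [stereo_source]) (fun _ _ => trivial) (by rw [stereo_target])
    (fun x _ => by
      rw [← stereo_source]
      exact (stereo s).map_target (by rw [stereo_target]; trivial))

/-- The complements of two antipodal points are contractible, and stereographic projection
identifies their intersection with a punctured vector space. -/
theorem cohDimLE_sphere (n : ℕ) : CohDimLE (Set.univ : Set (Sph (n + 1))) (n + 1) := by
  set s := infPt (n + 1)
  have hs : s ≠ -s := by
    intro h
    have h1 : (s : Vec (n + 2)) = -s := congrArg Subtype.val h
    have h2 := congrArg (fun v : Vec (n + 2) => v 0) h1
    simp [s, infPt] at h2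
    norm_num at h2
  have h : (Set.univ : Set (Sph (n + 1))) = {s}ᶜ ∪ {-s}ᶜ := by
    ext x
    simp only [Set.mem_univ, Set.mem_union, Set.mem_compl_iff, Set.mem_singleton_iff, true_iff]
    by_contra! hc
    exact hs (hc.1.symm.trans hc.2)
  rw [h]
  refine CohDimLE.union isOpen_compl_singleton isOpen_compl_singleton
    (cohDimLE_sphere_compl _ _) (cohDimLE_sphere_compl _ _) ?_
  refine (cohDimLE_compl_zero n).of_openPartialHomeomorph (stereo s) (by
    rw [stereo_source]; exact Set.inter_subset_left) ?_ (by rw [stereo_target]; simp) ?_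
  · rintro x ⟨hx, hx'⟩ h0
    rw [Set.mem_singleton_iff, ← stereo_neg s] at h0
    refine hx' ((stereo s).injOn ?_ ?_ h0)
    · rwa [stereo_source]
    · rw [stereo_source]
      exact hs.symm
  · intro y hy
    have h1 : (stereo s).symm y ∈ (stereo s).source :=
      (stereo s).map_target (by rw [stereo_target]; trivial)
    refine ⟨by rwa [stereo_source] at h1, fun h2 => hy ?_⟩
    rw [Set.mem_singleton_iff] at h2 ⊢
    rw [← stereo_neg s, ← h2, (stereo s).right_inv (by rw [stereo_target]; trivial)]

end Sphere

/-! ### Products with circles -/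

section Circle

variable {Y : Type} [TopologicalSpace Y]

/-- The image of an interval in the circle. -/
def arc (a b : ℝ) : Set UnitAddCircle := (fun x : ℝ => (x : UnitAddCircle)) '' Set.Ioo a b

theorem isOpen_arc (a b : ℝ) : IsOpen (arc a b) :=
  QuotientAddGroup.isOpenMap_coe _ isOpen_Ioo

theorem arc_eq_compl (a : ℝ) : arc a (a + 1) = {(a : UnitAddCircle)}ᶜ :=
  (AddCircle.openPartialHomeomorphCoe (1 : ℝ) a).image_source_eq_target

/-- In the angular chart the arc is an interval of length at most one, which contracts linearly to
its midpoint. -/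
theorem CohDimLE.prod_arc {A : Set Y} {N : ℕ} (h : CohDimLE A N) {a b : ℝ} (hab : a < b)
    (hb : b ≤ a + 1) : CohDimLE (A ×ˢ arc a b) N := by
  set e := AddCircle.openPartialHomeomorphCoe (1 : ℝ) a with he
  have hsub : Set.Ioo a b ⊆ e.source := Set.Ioo_subset_Ioo_right hb
  have harc : arc a b ⊆ e.target := by
    rw [← e.image_source_eq_target]
    exact Set.image_mono hsub
  have hsymm : ∀ x ∈ arc a b, e.symm x ∈ Set.Ioo a b := by
    rintro _ ⟨x, hx, rfl⟩
    have : e.symm (x : UnitAddCircle) = x := e.left_inv (hsub hx)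
    change e.symm (x : UnitAddCircle) ∈ _
    rwa [this]
  set c := (a + b) / 2 with hc
  have hcm : c ∈ Set.Ioo a b := ⟨by linarith, by linarith⟩
  have hcont : Continuous fun z : (A ×ˢ arc a b : Set (Y × UnitAddCircle)) => e.symm z.1.2 :=
    e.symm.continuousOn.comp_continuous (by fun_prop) fun z => harc z.2.2
  let f : C((A ×ˢ arc a b : Set (Y × UnitAddCircle)), A) :=
    ⟨fun z => ⟨z.1.1, z.2.1⟩, by fun_prop⟩
  let g : C(A, (A ×ˢ arc a b : Set (Y × UnitAddCircle))) :=
    ⟨fun y => ⟨(y, (c : UnitAddCircle)), y.2, c, hcm, rfl⟩, by fun_prop⟩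
  refine h.of_homotopy f g ⟨⟨⟨fun p => ⟨(p.2.1.1,
    (((1 - (p.1 : ℝ)) * c + (p.1 : ℝ) * e.symm p.2.1.2 : ℝ) : UnitAddCircle)),
    p.2.2.1, _, ?_, rfl⟩, ?_⟩, ?_, ?_⟩⟩
  · exact (convex_Ioo a b) hcm (hsymm _ p.2.2.2) (by linarith [p.1.2.2]) p.1.2.1 (by ring)
  · refine Continuous.subtype_mk (Continuous.prodMk (by fun_prop) ?_) _
    refine (AddCircle.continuous_mk' (1 : ℝ)).comp ?_
    have := hcont.comp (continuous_snd (X := unitInterval))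
    simp only [Function.comp_def] at this
    fun_prop
  · intro z
    refine Subtype.ext (Prod.ext rfl ?_)
    simp [f, g]
  · intro z
    refine Subtype.ext (Prod.ext rfl ?_)
    simp only [Set.Icc.coe_one, sub_self, zero_mul, zero_add, one_mul]
    exact e.right_inv (harc z.2.2)

theorem CohDimLE.prod_compl {A : Set Y} {N : ℕ} (h : CohDimLE A N) (c : UnitAddCircle) :
    CohDimLE (A ×ˢ {c}ᶜ) N := by
  obtain ⟨a, rfl⟩ := QuotientAddGroup.mk_surjective c
  have := h.prod_arc (a := a) (b := a + 1) (by linarith) le_rfl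
  rwa [arc_eq_compl] at this

theorem arc_inter (a : ℝ) :
    arc a (a + 1) ∩ arc (a + 1 / 2) (a + 1 / 2 + 1) =
      arc a (a + 1 / 2) ∪ arc (a + 1 / 2) (a + 1) ∧
    arc a (a + 1 / 2) ∩ arc (a + 1 / 2) (a + 1) = ∅ := by
  have hinj : Set.InjOn (fun x : ℝ => (x : UnitAddCircle)) (Set.Ioo a (a + 1)) :=
    (AddCircle.openPartialHomeomorphCoe (1 : ℝ) a).injOn
  constructor
  · rw [arc_eq_compl (a + 1 / 2)]
    ext z
    constructor
    · rintro ⟨⟨x, hx, rfl⟩, hz⟩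
      rcases lt_trichotomy x (a + 1 / 2) with h | h | h
      · exact Or.inl ⟨x, ⟨hx.1, h⟩, rfl⟩
      · exact absurd (by rw [h]; rfl) hz
      · exact Or.inr ⟨x, ⟨h, hx.2⟩, rfl⟩
    · have h0 : a + 1 / 2 ∈ Set.Ioo a (a + 1) := ⟨by linarith, by linarith⟩
      rintro (⟨x, hx, rfl⟩ | ⟨x, hx, rfl⟩)
      · have h1 : x ∈ Set.Ioo a (a + 1) := ⟨hx.1, by linarith [hx.2]⟩
        exact ⟨⟨x, h1, rfl⟩, fun h => hx.2.ne (hinj h1 h0 h)⟩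
      · have h1 : x ∈ Set.Ioo a (a + 1) := ⟨by linarith [hx.1], hx.2⟩
        exact ⟨⟨x, h1, rfl⟩, fun h => hx.1.ne' (hinj h1 h0 h)⟩
  · ext z
    simp only [Set.mem_inter_iff, Set.mem_empty_iff_false, iff_false]
    rintro ⟨⟨x, hx, rfl⟩, y, hy, hxy⟩
    have := hinj (⟨by linarith [hy.1], hy.2⟩ : y ∈ Set.Ioo a (a + 1)) ⟨hx.1, by linarith [hx.2]⟩ hxy
    linarith [hx.2, hy.1]

/-- Cover the circle by the complements of two points. The overlap consists of two disjoint arcs, so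
the bound rises by one. -/
theorem CohDimLE.prod_circle {A : Set Y} (hA : IsOpen A) {N : ℕ} (h : CohDimLE A N) :
    CohDimLE (A ×ˢ (Set.univ : Set UnitAddCircle)) (N + 1) := by
  obtain ⟨h1, h2⟩ := arc_inter 0
  have hcover : arc 0 (0 + 1) ∪ arc (0 + 1 / 2) (0 + 1 / 2 + 1) = Set.univ := by
    rw [arc_eq_compl, arc_eq_compl, ← Set.compl_inter, Set.compl_univ_iff,
      Set.singleton_inter_eq_empty, Set.mem_singleton_iff]
    intro h
    have hm : (((0 : ℝ) + 1 / 2 : ℝ) : UnitAddCircle) ∈ arc 0 (0 + 1) := ⟨_, by norm_num, rfl⟩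
    rw [arc_eq_compl] at hm
    exact hm h.symm
  rw [← hcover, Set.prod_union]
  refine CohDimLE.union (hA.prod (isOpen_arc _ _)) (hA.prod (isOpen_arc _ _))
    ((h.prod_arc (by norm_num) (by norm_num)).mono (by lia))
    ((h.prod_arc (by norm_num) (by norm_num)).mono (by lia)) ?_
  rw [← Set.prod_inter, h1, Set.prod_union]
  refine CohDimLE.union_of_disjoint (hA.prod (isOpen_arc _ _)) (hA.prod (isOpen_arc _ _))
    (h.prod_arc (by norm_num) (by norm_num)) (h.prod_arc (by norm_num) (by norm_num)) ?_
  rw [← Set.prod_inter, h2, Set.prod_empty]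

/-- With `A` the complement of a point, this set is the product with the circle punctured at one
point. The two open pieces overlap in `A` times a punctured circle, whose bound is still `N`. -/
theorem CohDimLE.prod_punctured {A : Set Y} (hA : IsOpen A) {N : ℕ}
    (h : CohDimLE (Set.univ : Set Y) (N + 1)) (h' : CohDimLE A N) (c : UnitAddCircle) :
    CohDimLE (A ×ˢ Set.univ ∪ Set.univ ×ˢ {c}ᶜ) (N + 1) := by
  refine CohDimLE.union (hA.prod isOpen_univ) (isOpen_univ.prod isOpen_compl_singleton)
    (h'.prod_circle hA) (h.prod_compl c) ?_
  rw [Set.prod_inter_prod, Set.inter_univ, Set.univ_inter]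
  exact h'.prod_compl c

end Circle

/-- Splitting off the first circle of a torus. -/
def torusSplit (j : ℕ) (Z : Type) [TopologicalSpace Z] :
    ((Fin (j + 1) → UnitAddCircle) × Z) ≃ₜ ((Fin j → UnitAddCircle) × Z) × UnitAddCircle where
  toFun z := ((Fin.tail z.1, z.2), z.1 0)
  invFun w := (Fin.cons w.2 w.1.1, w.1.2)
  left_inv z := by simp
  right_inv w := by simp
  continuous_toFun := by
    refine Continuous.prodMk (Continuous.prodMk ?_ continuous_snd) (by fun_prop)
    exact continuous_pi fun i => by
      simp only [Fin.tail]
      fun_prop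
  continuous_invFun := by
    refine Continuous.prodMk (Continuous.finCons ?_ ?_) ?_ <;> fun_prop

/-- The bounds for the full and for the punctured product are proved together, since the punctured
case for `j + 1` circles uses both for `j` circles. The puncture always saves one degree. -/
theorem cohDimLE_torus_prod {Z : Type} [TopologicalSpace Z] [T1Space Z] {N : ℕ}
    (hZ : CohDimLE (Set.univ : Set Z) (N + 1)) (hZ' : ∀ z : Z, CohDimLE ({z}ᶜ : Set Z) N)
    (j : ℕ) :
    CohDimLE (Set.univ : Set ((Fin j → UnitAddCircle) × Z)) (N + 1 + j) ∧
    ∀ p, CohDimLE ({p}ᶜ : Set ((Fin j → UnitAddCircle) × Z)) (N + j) := by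
  induction j with
  | zero =>
    let e : ((Fin 0 → UnitAddCircle) × Z) ≃ₜ Z :=
      { toFun := fun z => z.2
        invFun := fun z => (fun i => i.elim0, z)
        left_inv := fun z => Prod.ext (funext fun i => i.elim0) rfl
        right_inv := fun _ => rfl }
    refine ⟨hZ.of_openPartialHomeomorph e.toOpenPartialHomeomorph (by simp) (by simp [Set.MapsTo])
      (by simp) (by simp [Set.MapsTo]), fun p => ?_⟩
    refine (hZ' p.2).of_openPartialHomeomorph e.toOpenPartialHomeomorph (by simp) ?_ (by simp) ?_
    · intro z hz h
      exact hz (e.injective h)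
    · intro z hz h
      exact hz (congrArg Prod.snd h)
  | succ j ih =>
    set e := torusSplit j Z
    constructor
    · refine ((ih.1.prod_circle isOpen_univ)).of_openPartialHomeomorph
        e.toOpenPartialHomeomorph (by simp) (by simp [Set.MapsTo]) (by simp) (by simp [Set.MapsTo])
    · intro p
      have hu : CohDimLE (Set.univ : Set ((Fin j → UnitAddCircle) × Z)) (N + j + 1) :=
        ih.1.mono (by lia)
      refine (CohDimLE.prod_punctured isOpen_compl_singleton hu (ih.2 (e p).1)
        (e p).2).of_openPartialHomeomorph e.toOpenPartialHomeomorph (by simp) ?_ (by simp) ?_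
      · intro z hz
        by_cases h1 : (e z).1 = (e p).1
        · refine Or.inr ⟨trivial, fun h2 => hz (e.injective (Prod.ext h1 h2))⟩
        · exact Or.inl ⟨h1, trivial⟩
      · intro w hw h
        have hwp : w = e p := by
          rw [← Set.mem_singleton_iff.mp h]
          exact (e.apply_symm_apply w).symm
        subst hwp
        rcases hw with ⟨h1, -⟩ | ⟨-, h1⟩ <;> exact h1 rfl

/-- A top degree cocycle of `T^n × S^n` is cohomologous to one which vanishes off a point. -/
theorem exists_vanishesOn_compl_point {n : ℕ} (hn : 1 ≤ n) (p : Base n)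
    {μ : Cochain (Base n) (2 * n)} (hμ : coboundary μ = 0) :
    ∃ μ' : Cochain (Base n) (2 * n), VanishesOn {p}ᶜ μ' ∧ coboundary μ' = 0 ∧
      ∀ A, IsCob A ∅ (μ - μ') := by
  obtain ⟨n, rfl⟩ : ∃ k, n = k + 1 := ⟨n - 1, by lia⟩
  have h := (cohDimLE_torus_prod (cohDimLE_sphere n)
    (fun z => cohDimLE_sphere_compl z n) (n + 1)).2 p
  -- The punctured `T^(n+1) × S^(n+1)` has no cohomology above degree `n + (n + 1)`, which is one
  -- less than the degree of `μ`.
  obtain ⟨μ', h1, h2, h3⟩ := (h (2 * (n + 1)) (by lia) μ (by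
    rw [hμ]; exact vanishesOn_zero _)).exists_vanishesOn
  exact ⟨μ', h1, by rw [h2, hμ], h3⟩

/-! ### Cross products -/

section Cross

variable {X Y X' Y' : Type} [TopologicalSpace X] [TopologicalSpace Y] [TopologicalSpace X']
  [TopologicalSpace Y'] {m d l : ℕ}

/-- The cross product, in a degree which is propositionally the sum of the degrees. -/
def crossAt (h : l = m + d) (a : Cochain X m) (b : Cochain Y d) : Cochain (X × Y) l :=
  fun s =>
    a (SingularSimplex.pull (ContinuousMap.fst.comp s) (Fin.castLE (by lia))) *
      b (SingularSimplex.pull (ContinuousMap.snd.comp s) (fun i => ⟨m + i, by lia⟩))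

theorem crossAt_sub_left (h : l = m + d) (a a' : Cochain X m) (b : Cochain Y d) :
    crossAt h (a - a') b = crossAt h a b - crossAt h a' b := by
  funext s
  simp [crossAt, sub_mul]

theorem crossAt_sub_right (h : l = m + d) (a : Cochain X m) (b b' : Cochain Y d) :
    crossAt h a (b - b') = crossAt h a b - crossAt h a b' := by
  funext s
  simp [crossAt, mul_sub]

theorem crossAt_zsmul_right (h : l = m + d) (a : Cochain X m) (j : ℤ) (b : Cochain Y d) :
    crossAt h a (j • b) = j • crossAt h a b := by
  funext s
  simp [crossAt, mul_left_comm]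

theorem vanishesOn_crossAt_left (h : l = m + d) {a : Cochain X m} (b : Cochain Y d) {A : Set X}
    (ha : VanishesOn A a) {C : Set (X × Y)} (hC : Set.MapsTo Prod.fst C A) :
    VanishesOn C (crossAt h a b) := fun s hs => by
  rw [crossAt, ha _ (SingularSimplex.LiesIn.pull (fun p => hC (hs p)) _), zero_mul]

theorem vanishesOn_crossAt_right (h : l = m + d) (a : Cochain X m) {b : Cochain Y d} {B : Set Y}
    (hb : VanishesOn B b) {C : Set (X × Y)} (hC : Set.MapsTo Prod.snd C B) :
    VanishesOn C (crossAt h a b) := fun s hs => by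
  rw [crossAt, hb _ (SingularSimplex.LiesIn.pull (fun p => hC (hs p)) _), mul_zero]

/-- The Leibniz rule. -/
theorem coboundary_crossAt (h : l = m + d) (a : Cochain X m) (b : Cochain Y d) :
    coboundary (crossAt h a b) =
      crossAt (show l + 1 = m + 1 + d by lia) (coboundary a) b +
        (-1 : ℤ) ^ m • crossAt (show l + 1 = m + (d + 1) by lia) a (coboundary b) := by
  funext s
  set x : SingularSimplex X (l + 1) := ContinuousMap.fst.comp s with hx
  set y : SingularSimplex Y (l + 1) := ContinuousMap.snd.comp s with hy
  have hl : (m + 1) + (d + 1) = l + 2 := by lia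
  have L : coboundary (crossAt h a b) s = ∑ i : Fin (l + 2), (-1 : ℤ) ^ (i : ℕ) *
      (a (x.pull (i.succAbove ∘ Fin.castLE (by lia))) *
        b (y.pull (i.succAbove ∘ fun j => ⟨m + j, by lia⟩))) := by
    simp only [coboundary, crossAt]
    refine Finset.sum_congr rfl fun i _ => ?_
    rw [← SingularSimplex.pull_pull, ← SingularSimplex.pull_pull]
    rfl
  set a₀ := a (x.pull (Fin.castLE (by lia))) with ha₀
  set b₀ := b (y.pull (fun j => ⟨m + 1 + j, by lia⟩)) with hb₀
  have R1 : crossAt (show l + 1 = m + 1 + d by lia) (coboundary a) b s =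
      (∑ i : Fin (m + 2), (-1 : ℤ) ^ (i : ℕ) *
        a (x.pull (Fin.castLE (by lia) ∘ i.succAbove))) * b₀ := by
    simp only [coboundary, crossAt, SingularSimplex.pull_pull]
    rfl
  have R2 : crossAt (show l + 1 = m + (d + 1) by lia) a (coboundary b) s =
      a₀ * ∑ j : Fin (d + 2), (-1 : ℤ) ^ (j : ℕ) *
        b (y.pull ((fun j : Fin (d + 2) => (⟨m + j, by lia⟩ : Fin (l + 2))) ∘ j.succAbove)) := by
    simp only [coboundary, crossAt, SingularSimplex.pull_pull]
    rfl
  -- The first `m + 1` faces delete a vertex seen by the first factor, the last `d + 1` one seen by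
  -- the second. The right-hand side has two further terms, the last of `R1` and the first of `R2`;
  -- both equal `a₀ * b₀` up to sign, and they cancel.
  rw [Pi.add_apply, Pi.smul_apply, L, R1, R2, ← Fin.sum_congr' _ hl, Fin.sum_univ_add,
    Fin.sum_univ_castSucc (n := m + 1), Fin.sum_univ_succ (n := d + 1)]
  have e1 : ∀ i : Fin (m + 1),
      ((Fin.cast hl (Fin.castAdd (d + 1) i)).succAbove ∘ Fin.castLE (by lia) :
        Fin (m + 1) → Fin (l + 2)) = Fin.castLE (by lia) ∘ i.castSucc.succAbove := by
    intro i
    funext j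
    simp only [Function.comp_apply, Fin.ext_iff, Fin.succAbove, Fin.lt_def, Fin.val_cast,
      Fin.val_castAdd, Fin.val_castLE, Fin.val_castSucc]
    split_ifs <;> simp
  have e2 : ∀ i : Fin (m + 1),
      ((Fin.cast hl (Fin.castAdd (d + 1) i)).succAbove ∘ (fun j => ⟨m + j, by lia⟩) :
        Fin (d + 1) → Fin (l + 2)) = fun j => ⟨m + 1 + j, by lia⟩ := by
    intro i
    funext j
    simp only [Function.comp_apply, Fin.ext_iff, Fin.succAbove, Fin.lt_def, Fin.val_cast,
      Fin.val_castAdd, Fin.val_castSucc]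
    split_ifs <;> simp <;> lia
  have e3 : ∀ i : Fin (d + 1),
      ((Fin.cast hl (Fin.natAdd (m + 1) i)).succAbove ∘ Fin.castLE (by lia) :
        Fin (m + 1) → Fin (l + 2)) = Fin.castLE (by lia) := by
    intro i
    funext j
    simp only [Function.comp_apply, Fin.ext_iff, Fin.succAbove, Fin.lt_def, Fin.val_cast,
      Fin.val_natAdd, Fin.val_castLE, Fin.val_castSucc]
    rw [if_pos (by lia)]
    simp
  have e4 : ∀ i : Fin (d + 1),
      ((Fin.cast hl (Fin.natAdd (m + 1) i)).succAbove ∘ (fun j => ⟨m + j, by lia⟩) :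
        Fin (d + 1) → Fin (l + 2)) =
          (fun j : Fin (d + 2) => (⟨m + j, by lia⟩ : Fin (l + 2))) ∘ i.succ.succAbove := by
    intro i
    funext j
    simp only [Function.comp_apply, Fin.ext_iff, Fin.succAbove, Fin.lt_def, Fin.val_cast,
      Fin.val_natAdd, Fin.val_castSucc, Fin.val_succ]
    split_ifs <;> simp <;> lia
  have e5 : (Fin.castLE (by lia) ∘ (Fin.last (m + 1)).succAbove : Fin (m + 1) → Fin (l + 2)) =
      Fin.castLE (by lia) := by
    funext j
    simp
  have e6 : ((fun j : Fin (d + 2) => (⟨m + j, by lia⟩ : Fin (l + 2))) ∘ (0 : Fin (d + 2)).succAbove :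
      Fin (d + 1) → Fin (l + 2)) = fun j => ⟨m + 1 + j, by lia⟩ := by
    funext j
    simp only [Function.comp_apply, Fin.succAbove_zero, Fin.val_succ, Fin.ext_iff]
    lia
  simp only [e1, e2, e3, e4, e5, e6, ← hb₀, ← ha₀, Fin.val_cast, Fin.val_castAdd, Fin.val_natAdd,
    Fin.val_castSucc, Fin.val_last, Fin.val_zero, Fin.val_succ, smul_eq_mul, mul_add, add_mul,
    Finset.mul_sum, Finset.sum_mul]
  have comb : ∀ p q p' q' t₁ t₂ : ℤ, p = p' → q = q' → t₁ + t₂ = 0 →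
      p + q = (p' + t₁) + (t₂ + q') := by intros; linarith
  refine comb _ _ _ _ _ _ (Finset.sum_congr rfl fun i _ => by ring)
    (Finset.sum_congr rfl fun i _ => by ring) (by ring)

theorem isCob_crossAt_left (h : l = m + d) {a : Cochain X m} {b : Cochain Y d} {V B : Set Y}
    (ha : IsCob Set.univ ∅ a) (hb : IsRelCocycle V B b) :
    IsCob (Set.univ ×ˢ V) {Set.univ ×ˢ B} (crossAt h a b) := by
  cases m with
  | zero => exact IsCob.of_vanishesOn (vanishesOn_crossAt_left h b ha fun _ _ => trivial) _
  | succ m =>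
    obtain ⟨w, -, hw⟩ := ha
    obtain ⟨l, rfl⟩ : ∃ k, l = k + 1 := ⟨l - 1, by lia⟩
    refine ⟨crossAt (by lia) w b, ?_, ?_⟩
    · rintro _ rfl
      exact vanishesOn_crossAt_right _ _ hb.1 fun z hz => hz.2
    · rw [coboundary_crossAt (show l = m + d by lia), ← sub_sub, ← crossAt_sub_left]
      exact (vanishesOn_crossAt_left _ _ hw fun _ _ => trivial).sub
        ((vanishesOn_crossAt_right _ _ hb.2 fun z hz => hz.2).zsmul _)

theorem isCob_crossAt_right (h : l = m + d) {a : Cochain X m} {b : Cochain Y d} {V : Set Y}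
    {𝓑 : Set (Set Y)} (ha : coboundary a = 0) (hb : IsCob V 𝓑 b) (K : Set X) :
    IsCob (K ×ˢ V) ((fun B => K ×ˢ B) '' 𝓑) (crossAt h a b) := by
  cases d with
  | zero => exact IsCob.of_vanishesOn (vanishesOn_crossAt_right h a hb fun _ hz => hz.2) _
  | succ d =>
    obtain ⟨w, hw, hwb⟩ := hb
    obtain ⟨l, rfl⟩ : ∃ k, l = k + 1 := ⟨l - 1, by lia⟩
    refine ⟨(-1 : ℤ) ^ m • crossAt (by lia) a w, ?_, ?_⟩
    · rintro _ ⟨B, hB, rfl⟩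
      exact (vanishesOn_crossAt_right _ _ (hw B hB) fun z hz => hz.2).zsmul _
    · have h0 : crossAt (show l + 1 = m + 1 + d by lia) (coboundary a) w = 0 := by
        rw [ha]
        funext s
        simp [crossAt]
      rw [coboundary_zsmul, coboundary_crossAt (show l = m + d by lia), h0, zero_add, smul_smul,
        ← mul_pow, neg_one_mul, neg_neg, one_pow, one_smul, ← crossAt_sub_right]
      exact vanishesOn_crossAt_right _ _ hwb fun z hz => hz.2

theorem isRelCocycle_crossAt (h : l = m + d) {a : Cochain X m} {b : Cochain Y d} {V B : Set Y}
    (ha : coboundary a = 0) (hb : IsRelCocycle V B b) :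
    IsRelCocycle (Set.univ ×ˢ V) (Set.univ ×ˢ B) (crossAt h a b) := by
  refine ⟨vanishesOn_crossAt_right _ _ hb.1 fun z hz => hz.2, ?_⟩
  rw [coboundary_crossAt h, ha]
  exact (vanishesOn_crossAt_left _ _ (vanishesOn_zero Set.univ) fun _ _ => trivial).add
    ((vanishesOn_crossAt_right _ _ hb.2 fun z hz => hz.2).zsmul _)

end Cross

/-! ### The classes of coordinate functions -/

section Coordinates

variable {Z Z' : Type} [TopologicalSpace Z] [TopologicalSpace Z'] {m : ℕ}

/-- The indicator function of the positive numbers. -/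
def posIndicator (r : ℝ) : ℤ := if 0 < r then 1 else 0

/-- The cup product with the indicator cochain of `{x > 0}`. -/
def cupIndicator (x : C(Z, ℝ)) (β : Cochain Z m) : Cochain Z m :=
  fun s => β s * posIndicator (x (s (stdSimplex.vertex (Fin.last m))))

/-- The cup product with the coboundary of the indicator cochain of `{x > 0}`. -/
def cupStep (x : C(Z, ℝ)) (β : Cochain Z m) : Cochain Z (m + 1) :=
  fun s => β (s.pull Fin.castSucc) * (posIndicator (x (s (stdSimplex.vertex (Fin.last (m + 1))))) -
    posIndicator (x (s (stdSimplex.vertex (Fin.last m).castSucc))))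

theorem SingularSimplex.pull_vertex {l : ℕ} (s : SingularSimplex Z m)
    (f : Fin (l + 1) → Fin (m + 1)) (i : Fin (l + 1)) :
    s.pull f (stdSimplex.vertex i) = s (stdSimplex.vertex (f i)) := by
  simp [SingularSimplex.pull]

theorem coboundary_cupIndicator (x : C(Z, ℝ)) (β : Cochain Z m) :
    coboundary (cupIndicator x β) =
      cupIndicator x (coboundary β) + (-1 : ℤ) ^ m • cupStep x β := by
  funext s
  simp only [coboundary, cupIndicator, cupStep, Pi.add_apply, Pi.smul_apply, smul_eq_mul,
    SingularSimplex.pull_vertex]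
  rw [Fin.sum_univ_castSucc (n := m + 1), Fin.sum_univ_castSucc (n := m + 1)]
  have h : ∀ i : Fin (m + 1), i.castSucc.succAbove (Fin.last m) = Fin.last (m + 1) := fun i => by
    rw [Fin.succAbove_castSucc_of_le _ _ (Fin.le_last i), Fin.succ_last]
  have h' : ((Fin.last (m + 1)).succAbove : Fin (m + 1) → Fin (m + 2)) = Fin.castSucc := by
    funext i
    simp
  simp only [h, h', Fin.val_castSucc, Fin.val_last, add_mul, Finset.sum_mul, mul_assoc]
  ring

/-- Absolutely, the new class is trivial. It carries information only relatively to the far sides of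
the hyperplane: the primitive `cupIndicator x β` vanishes where `x ≤ 0` but equals `β` where `x >
0`. -/
theorem cupStep_eq (x : C(Z, ℝ)) {β : Cochain Z m} (hβ : coboundary β = 0) :
    cupStep x β = (-1 : ℤ) ^ m • coboundary (cupIndicator x β) := by
  have h : cupIndicator x (0 : Cochain Z (m + 1)) = 0 := by
    funext s
    simp [cupIndicator]
  rw [coboundary_cupIndicator, hβ, h, zero_add, smul_smul, ← mul_pow, neg_one_mul, neg_neg,
    one_pow, one_smul]

theorem coboundary_cupStep (x : C(Z, ℝ)) {β : Cochain Z m} (hβ : coboundary β = 0) :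
    coboundary (cupStep x β) = 0 := by
  rw [cupStep_eq x hβ, coboundary_zsmul, coboundary_coboundary, smul_zero]

theorem VanishesOn.cupStep {B : Set Z} {β : Cochain Z m} (hβ : VanishesOn B β) (x : C(Z, ℝ)) :
    VanishesOn B (cupStep x β) := fun s hs => by
  rw [TorusCapacity.cupStep, hβ _ (hs.pull _), zero_mul]

theorem VanishesOn.cupIndicator {B : Set Z} {β : Cochain Z m} (hβ : VanishesOn B β) (x : C(Z, ℝ)) :
    VanishesOn B (cupIndicator x β) := fun s hs => by
  rw [TorusCapacity.cupIndicator, hβ _ hs, zero_mul]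

theorem vanishesOn_cupStep_pos (x : C(Z, ℝ)) (β : Cochain Z m) :
    VanishesOn {z | 0 < x z} (cupStep x β) := fun s hs => by
  have h : ∀ p, posIndicator (x (s p)) = 1 := fun p => if_pos (hs p)
  rw [cupStep, h, h, sub_self, mul_zero]

theorem vanishesOn_cupStep_neg (x : C(Z, ℝ)) (β : Cochain Z m) :
    VanishesOn {z | x z < 0} (cupStep x β) := fun s hs => by
  have h : ∀ p, posIndicator (x (s p)) = 0 := fun p => if_neg (not_lt.mpr (le_of_lt (hs p)))
  rw [cupStep, h, h, sub_self, mul_zero]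

theorem cupStep_pullback (x : C(Z, ℝ)) (β : Cochain Z m) (f : C(Z', Z)) :
    (cupStep x β).pullback f = cupStep (x.comp f) (β.pullback f) := rfl

theorem cupStep_congr {x x' : C(Z, ℝ)} (h : ∀ z, 0 < x z ↔ 0 < x' z) (β : Cochain Z m) :
    cupStep x β = cupStep x' β := by
  have h' : ∀ z, posIndicator (x z) = posIndicator (x' z) := fun z => by
    simp only [posIndicator, h]
  funext s
  simp only [cupStep, h']

/-- The iterated cup product with the classes of coordinate functions. -/
def cupSteps (x : ℕ → C(Z, ℝ)) (β : Cochain Z m) : ∀ j, Cochain Z (m + j)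
  | 0 => β
  | j + 1 => cupStep (x j) (cupSteps x β j)

/-- The cup product of the classes of coordinate functions. -/
def coordClass (x : ℕ → C(Z, ℝ)) : ∀ j, Cochain Z j
  | 0 => fun _ => 1
  | j + 1 => cupStep (x j) (coordClass x j)

theorem coboundary_cupSteps (x : ℕ → C(Z, ℝ)) {β : Cochain Z m} (hβ : coboundary β = 0) (j : ℕ) :
    coboundary (cupSteps x β j) = 0 := by
  induction j with
  | zero => exact hβ
  | succ j ih => exact coboundary_cupStep _ ih

theorem coboundary_coordClass (x : ℕ → C(Z, ℝ)) (j : ℕ) : coboundary (coordClass x j) = 0 := by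
  induction j with
  | zero =>
    funext s
    simp [coboundary, coordClass, Fin.sum_univ_two]
  | succ j ih => exact coboundary_cupStep _ ih

theorem vanishesOn_cupSteps (x : ℕ → C(Z, ℝ)) (β : Cochain Z m) {i j : ℕ} (hij : i < j) {B : Set Z}
    (hB : (∀ z ∈ B, 0 < x i z) ∨ ∀ z ∈ B, x i z < 0) : VanishesOn B (cupSteps x β j) := by
  induction j with
  | zero => lia
  | succ j ih =>
    rcases Nat.lt_succ_iff_lt_or_eq.mp hij with h | rfl
    · exact (ih h).cupStep _
    · rcases hB with hB | hB
      · exact (vanishesOn_cupStep_pos _ _).mono hB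
      · exact (vanishesOn_cupStep_neg _ _).mono hB

theorem vanishesOn_coordClass (x : ℕ → C(Z, ℝ)) {i j : ℕ} (hij : i < j) {B : Set Z}
    (hB : (∀ z ∈ B, 0 < x i z) ∨ ∀ z ∈ B, x i z < 0) : VanishesOn B (coordClass x j) := by
  induction j with
  | zero => lia
  | succ j ih =>
    rcases Nat.lt_succ_iff_lt_or_eq.mp hij with h | rfl
    · exact (ih h).cupStep _
    · rcases hB with hB | hB
      · exact (vanishesOn_cupStep_pos _ _).mono hB
      · exact (vanishesOn_cupStep_neg _ _).mono hB

theorem crossAt_cupStep {X : Type} [TopologicalSpace X] {d l : ℕ} (h : l = m + d)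
    (h' : l + 1 = m + (d + 1)) (a : Cochain X m) (b : Cochain Z d) (x : C(Z, ℝ)) :
    crossAt h' a (cupStep x b) =
      cupStep (x.comp (ContinuousMap.snd : C(X × Z, Z))) (crossAt h a b) := by
  subst h
  funext s
  have e1 : ∀ {r : ℕ} (f : Fin (r + 1) → Fin (m + d + 1)),
      SingularSimplex.pull (ContinuousMap.fst.comp (s.pull Fin.castSucc)) f =
        SingularSimplex.pull (ContinuousMap.fst.comp s) (Fin.castSucc ∘ f) :=
    fun f => SingularSimplex.pull_pull (ContinuousMap.fst.comp s) Fin.castSucc f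
  have e2 : ∀ {r : ℕ} (f : Fin (r + 1) → Fin (m + d + 1)),
      SingularSimplex.pull (ContinuousMap.snd.comp (s.pull Fin.castSucc)) f =
        SingularSimplex.pull (ContinuousMap.snd.comp s) (Fin.castSucc ∘ f) :=
    fun f => SingularSimplex.pull_pull (ContinuousMap.snd.comp s) Fin.castSucc f
  simp only [crossAt, cupStep, SingularSimplex.pull_pull, SingularSimplex.pull_vertex,
    mul_assoc, e1, e2]
  rfl

/-- Rewrites a cross product as successive cup products on `M × V`, so that the coordinates can be
removed one at a time. -/
theorem crossAt_coordClass {X : Type} [TopologicalSpace X] (a : Cochain X m) (x : ℕ → C(Z, ℝ))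
    (j : ℕ) : crossAt rfl a (coordClass x j) =
      cupSteps (fun i => (x i).comp ContinuousMap.snd) (a.pullback (ContinuousMap.fst : C(X × Z, X)))
        j := by
  induction j with
  | zero =>
    funext s
    simp only [crossAt, coordClass, mul_one, cupSteps, Cochain.pullback]
    exact congrArg a (SingularSimplex.pull_id _)
  | succ j ih =>
    rw [cupSteps, ← ih]
    exact crossAt_cupStep rfl rfl a _ _

/-- Removing the class of a coordinate function along which the space may be translated. -/
theorem isCob_of_cupStep {K : Set Z} {𝓑 : Set (Set Z)} {x : C(Z, ℝ)} (H : C(unitInterval × Z, Z))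
    (h0 : ∀ z, x (H (0, z)) = -1) (h1 : ∀ z, x (H (1, z)) = 1)
    (hK : ∀ t, Set.MapsTo (H.curry t) K K) {β : Cochain Z m} (hβ : coboundary β = 0)
    (hβH : ∀ t, β.pullback (H.curry t) = β)
    (h𝓑 : ∀ B ∈ 𝓑, (∀ t, Set.MapsTo (H.curry t) B B) ∧ VanishesOn B β)
    (h : IsCob K (𝓑 ∪ {K ∩ {z | 1 ≤ x z}, K ∩ {z | x z ≤ -1}}) (cupStep x β)) : IsCob K 𝓑 β := by
  obtain ⟨w, hw, hwu⟩ := h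
  -- Both terms of `y` are primitives of the same class, so `y` is a cocycle on `K`. Where `x = -1`
  -- it vanishes, where `x = 1` it equals `β` up to sign, and the homotopy connects these two
  -- restrictions.
  set y := (-1 : ℤ) ^ m • cupIndicator x β - w with hy
  have hyδ : VanishesOn K (coboundary y) := by
    rwa [hy, coboundary_sub, coboundary_zsmul, ← cupStep_eq x hβ]
  have key := isCob_homotopy H y hK hyδ (𝓑 := 𝓑) (fun B hB => ⟨B, (h𝓑 B hB).1,
    (((h𝓑 B hB).2.cupIndicator x).zsmul _).sub (hw B (Or.inl hB))⟩)
  have e0 : VanishesOn K (y.pullback (H.curry 0)) := by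
    intro s hs
    have hw0 : w ((H.curry 0).comp s) = 0 := hw (K ∩ {z | x z ≤ -1}) (by simp) _
      fun p => ⟨hK 0 (hs p), (h0 _).le⟩
    have : posIndicator (-1) = 0 := by simp [posIndicator]
    simp only [hy, Cochain.pullback, Pi.sub_apply, Pi.smul_apply, hw0, cupIndicator,
      ContinuousMap.comp_apply, ContinuousMap.curry_apply, h0, this]
    simp
  have e1 : VanishesOn K (y.pullback (H.curry 1) - (-1 : ℤ) ^ m • β) := by
    intro s hs
    have hw0 : w ((H.curry 1).comp s) = 0 := hw (K ∩ {z | 1 ≤ x z}) (by simp) _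
      fun p => ⟨hK 1 (hs p), (h1 _).ge⟩
    have : posIndicator 1 = 1 := by simp [posIndicator]
    have hβ1 : β ((H.curry 1).comp s) = β s := congrFun (hβH 1) s
    simp only [hy, Cochain.pullback, Pi.sub_apply, Pi.smul_apply, hw0, cupIndicator,
      ContinuousMap.comp_apply, ContinuousMap.curry_apply, h1, this, hβ1]
    simp
  have h2 : IsCob K 𝓑 ((-1 : ℤ) ^ m • β) := by
    have := (key.add (IsCob.of_vanishesOn e0 𝓑)).sub (IsCob.of_vanishesOn e1 𝓑)
    simpa using this
  have h3 := h2.zsmul ((-1 : ℤ) ^ m)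
  rwa [smul_smul, ← mul_pow, neg_one_mul, neg_neg, one_pow, one_smul] at h3

end Coordinates

/-! ### The Künneth injection for a disc -/

section Disc

variable {V : Type} [NormedAddCommGroup V] [InnerProductSpace ℝ V]

/-- The radial retraction onto the unit ball. -/
def ballRetract (V : Type) [NormedAddCommGroup V] [InnerProductSpace ℝ V] : C(V, V) where
  toFun v := (max 1 ‖v‖)⁻¹ • v
  continuous_toFun := by
    refine Continuous.smul (Continuous.inv₀ (by fun_prop) fun v => ?_) continuous_id
    positivity

theorem ballRetract_apply (v : V) : ballRetract V v = (max 1 ‖v‖)⁻¹ • v := rfl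

theorem norm_ballRetract (v : V) : ‖ballRetract V v‖ = min 1 ‖v‖ := by
  rw [ballRetract_apply, norm_smul, norm_inv, Real.norm_of_nonneg (by positivity)]
  rcases le_total 1 ‖v‖ with h | h
  · rw [max_eq_right h, min_eq_left h, inv_mul_cancel₀ (by linarith)]
  · rw [max_eq_left h, min_eq_right h, inv_one, one_mul]

theorem ballRetract_of_norm_le {v : V} (h : ‖v‖ ≤ 1) : ballRetract V v = v := by
  rw [ballRetract_apply, max_eq_left h, inv_one, one_smul]

theorem ballRetract_mem_closedBall (v : V) : ballRetract V v ∈ Metric.closedBall (0 : V) 1 := by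
  rw [mem_closedBall_zero_iff, norm_ballRetract]
  exact min_le_left _ _

theorem ballRetract_mem_sphere {v : V} (h : 1 ≤ ‖v‖) :
    ballRetract V v ∈ Metric.sphere (0 : V) 1 := by
  rw [mem_sphere_zero_iff_norm, norm_ballRetract, min_eq_left h]

variable [FiniteDimensional ℝ V]

/-- The coordinates in an orthonormal basis. -/
def orthoCoord (V : Type) [NormedAddCommGroup V] [InnerProductSpace ℝ V] [FiniteDimensional ℝ V]
    (i : ℕ) : C(V, ℝ) :=
  if h : i < Module.finrank ℝ V then
    ⟨fun v => inner ℝ (stdOrthonormalBasis ℝ V ⟨i, h⟩) v, by fun_prop⟩ else 0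

theorem orthoCoord_apply {i : ℕ} (h : i < Module.finrank ℝ V) (v : V) :
    orthoCoord V i v = inner ℝ (stdOrthonormalBasis ℝ V ⟨i, h⟩) v := by
  rw [orthoCoord, dif_pos h]
  rfl

theorem orthoCoord_smul (i : ℕ) (r : ℝ) (v : V) : orthoCoord V i (r • v) = r * orthoCoord V i v := by
  by_cases h : i < Module.finrank ℝ V
  · rw [orthoCoord_apply h, orthoCoord_apply h, inner_smul_right]
  · rw [orthoCoord, dif_neg h]
    simp

theorem abs_orthoCoord_le (i : ℕ) (v : V) : |orthoCoord V i v| ≤ ‖v‖ := by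
  by_cases h : i < Module.finrank ℝ V
  · rw [orthoCoord_apply h]
    refine (abs_real_inner_le_norm _ _).trans ?_
    rw [(stdOrthonormalBasis ℝ V).norm_eq_one, one_mul]
  · rw [orthoCoord, dif_neg h]
    simp

theorem exists_orthoCoord_ne_zero {v : V} (hv : v ≠ 0) :
    ∃ i < Module.finrank ℝ V, orthoCoord V i v ≠ 0 := by
  by_contra! hc
  refine hv ((stdOrthonormalBasis ℝ V).repr.map_eq_zero_iff.mp (PiLp.ext fun i => ?_))
  have := hc i i.2
  rw [orthoCoord_apply i.2] at this
  rwa [(stdOrthonormalBasis ℝ V).repr_apply_apply]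

/-- The coordinate classes depend only on the signs of the coordinates, which positive rescaling
preserves. -/
theorem coordClass_pullback_ballRetract (j : ℕ) :
    (coordClass (orthoCoord V) j).pullback (ballRetract V) = coordClass (orthoCoord V) j := by
  induction j with
  | zero => rfl
  | succ j ih =>
    rw [coordClass, cupStep_pullback, ih]
    refine cupStep_congr (fun v => ?_) _
    rw [ContinuousMap.comp_apply, ballRetract_apply, orthoCoord_smul]
    have : 0 < (max 1 ‖v‖)⁻¹ := by positivity
    exact mul_pos_iff_of_pos_left this

/-- The half spaces on which the coordinate classes vanish. -/
def halfSpaces (V : Type) [NormedAddCommGroup V] [InnerProductSpace ℝ V] [FiniteDimensional ℝ V]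
    (j : ℕ) : Set (Set V) :=
  {B | ∃ i < j, B = {v | 1 ≤ orthoCoord V i v} ∨ B = {v | orthoCoord V i v ≤ -1}}

theorem one_le_norm_of_mem_halfSpaces {j : ℕ} {B : Set V} (hB : B ∈ halfSpaces V j) {v : V}
    (hv : v ∈ B) : 1 ≤ ‖v‖ := by
  obtain ⟨i, -, rfl | rfl⟩ := hB
  · exact le_trans hv ((le_abs_self _).trans (abs_orthoCoord_le i v))
  · refine le_trans ?_ ((neg_le_abs _).trans (abs_orthoCoord_le i v))
    simp only [Set.mem_ofPred_eq] at hv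
    linarith

/-- The product of the coordinate classes is a multiple of a generator of the cohomology of the
disc. -/
theorem exists_isCob_coordClass_sub {T : Cochain V (Module.finrank ℝ V)}
    (hT : IsGenerator (Metric.closedBall 0 1) (Metric.sphere 0 1) T) :
    ∃ j : ℤ, IsCob Set.univ (halfSpaces V (Module.finrank ℝ V))
      (coordClass (orthoCoord V) (Module.finrank ℝ V) - j • T.pullback (ballRetract V)) := by
  set e := coordClass (orthoCoord V) (Module.finrank ℝ V) with he
  let O : Fin (Module.finrank ℝ V) × Bool → Set V := fun p =>
    cond p.2 {v | 0 < orthoCoord V p.1 v} {v | orthoCoord V p.1 v < 0}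
  have hO : ∀ p, IsOpen (O p) := by
    rintro ⟨i, b⟩
    cases b
    · exact isOpen_lt (orthoCoord V i).continuous continuous_const
    · exact isOpen_lt continuous_const (orthoCoord V i).continuous
  have hcov : ({0}ᶜ : Set V) ⊆ ⋃ p, O p := by
    intro v hv
    obtain ⟨i, hi, h⟩ := exists_orthoCoord_ne_zero hv
    rcases lt_or_gt_of_ne h with h | h
    · exact Set.mem_iUnion.mpr ⟨(⟨i, hi⟩, false), h⟩
    · exact Set.mem_iUnion.mpr ⟨(⟨i, hi⟩, true), h⟩
  have hδ : coboundary e = 0 := coboundary_coordClass _ _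
  -- Off the origin `e` vanishes on each of the half-spaces that cover, so it may be replaced by a
  -- cocycle `t` vanishing off the origin, hence on the unit sphere. Only then does the generator
  -- property of `T` apply.
  have hsmall := isCob_of_vanishesOn_small hO hcov (u := e)
    (by rw [hδ]; exact vanishesOn_zero _) (fun p => by
      refine vanishesOn_coordClass _ p.1.2 ?_
      obtain ⟨i, b⟩ := p
      cases b
      · exact Or.inr fun v hv => hv.2
      · exact Or.inl fun v hv => hv.2)
  obtain ⟨t, ht, htδ, hte⟩ := hsmall.exists_vanishesOn
  have hsph : Metric.sphere (0 : V) 1 ⊆ {0}ᶜ := by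
    rintro v hv rfl
    simp at hv
  obtain ⟨j, hj⟩ := hT.2 t ⟨ht.mono hsph, by rw [htδ, hδ]; exact vanishesOn_zero _⟩
  rw [isRelCoboundary_iff_isCob] at hj
  refine ⟨j, ?_⟩
  have h1 : IsCob Set.univ (halfSpaces V (Module.finrank ℝ V))
      ((t - j • T).pullback (ballRetract V)) :=
    hj.pullback (fun v _ => ballRetract_mem_closedBall v) (fun B hB => ⟨_, rfl, fun v hv =>
      ballRetract_mem_sphere (one_le_norm_of_mem_halfSpaces hB hv)⟩)
  have h2 : IsCob Set.univ (halfSpaces V (Module.finrank ℝ V)) ((e - t).pullback (ballRetract V)) := by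
    refine (hte Set.univ).pullback (fun _ _ => trivial) fun B hB => ?_
    have hne : ∀ v ∈ B, ballRetract V v ∈ ({0}ᶜ : Set V) := fun v hv =>
      hsph (ballRetract_mem_sphere (one_le_norm_of_mem_halfSpaces hB hv))
    obtain ⟨i, hi, rfl | rfl⟩ := hB
    · refine ⟨_, ⟨(⟨i, hi⟩, true), rfl⟩, fun v hv => ⟨hne v hv, ?_⟩⟩
      change 0 < orthoCoord V i (ballRetract V v)
      rw [ballRetract_apply, orthoCoord_smul]
      have h0 : 0 < (max 1 ‖v‖)⁻¹ := by positivity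
      have h1 : 0 < orthoCoord V i v := lt_of_lt_of_le one_pos hv
      positivity
    · refine ⟨_, ⟨(⟨i, hi⟩, false), rfl⟩, fun v hv => ⟨hne v hv, ?_⟩⟩
      change orthoCoord V i (ballRetract V v) < 0
      rw [ballRetract_apply, orthoCoord_smul]
      have h0 : 0 < (max 1 ‖v‖)⁻¹ := by positivity
      have h1 : orthoCoord V i v < 0 := lt_of_le_of_lt hv (by norm_num)
      exact mul_neg_of_pos_of_neg h0 h1
  have h3 := h2.add h1
  have h4 : (e - t).pullback (ballRetract V) + (t - j • T).pullback (ballRetract V) =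
      e - j • T.pullback (ballRetract V) := by
    have h5 : (e - t).pullback (ballRetract V) = e - t.pullback (ballRetract V) := by
      conv_rhs => rw [he, ← coordClass_pullback_ballRetract, ← he]
      rfl
    rw [h5]
    change e - t.pullback (ballRetract V) + (t.pullback (ballRetract V) -
      j • T.pullback (ballRetract V)) = _
    abel
  rwa [h4] at h3

variable {M : Type} [TopologicalSpace M] {m : ℕ}

/-- The homotopy moving the `j`-th coordinate from `-1` to `1`. -/
def coordTranslate (M V : Type) [TopologicalSpace M] [NormedAddCommGroup V]
    [InnerProductSpace ℝ V] [FiniteDimensional ℝ V] {j : ℕ} (hj : j < Module.finrank ℝ V) :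
    C(unitInterval × (M × V), M × V) where
  toFun p := (p.2.1, p.2.2 + ((2 * (p.1 : ℝ) - 1) - orthoCoord V j p.2.2) •
    stdOrthonormalBasis ℝ V ⟨j, hj⟩)
  continuous_toFun := by fun_prop

theorem orthoCoord_coordTranslate_of_ne {j : ℕ} (hj : j < Module.finrank ℝ V) {i : ℕ} (hi : i ≠ j)
    (t : unitInterval) (z : M × V) :
    orthoCoord V i (coordTranslate M V hj (t, z)).2 = orthoCoord V i z.2 := by
  by_cases h : i < Module.finrank ℝ V
  · rw [orthoCoord_apply h, orthoCoord_apply h]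
    simp only [coordTranslate, ContinuousMap.coe_mk, inner_add_right, inner_smul_right]
    rw [(stdOrthonormalBasis ℝ V).orthonormal.2 (by simpa using hi), mul_zero, add_zero]
  · rw [orthoCoord, dif_neg h]
    rfl

theorem orthoCoord_coordTranslate {j : ℕ} (hj : j < Module.finrank ℝ V)
    (t : unitInterval) (z : M × V) :
    orthoCoord V j (coordTranslate M V hj (t, z)).2 = 2 * (t : ℝ) - 1 := by
  rw [orthoCoord_apply hj]
  simp only [coordTranslate, ContinuousMap.coe_mk, inner_add_right, inner_smul_right]
  rw [real_inner_self_eq_norm_sq, (stdOrthonormalBasis ℝ V).norm_eq_one, orthoCoord_apply hj]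
  ring

theorem cupSteps_pullback_coordTranslate {j : ℕ} (hj : j < Module.finrank ℝ V)
    (α : Cochain M m) (t : unitInterval) (i : ℕ) (hi : i ≤ j) :
    (cupSteps (fun i => (orthoCoord V i).comp ContinuousMap.snd)
      (α.pullback (ContinuousMap.fst : C(M × V, M))) i).pullback ((coordTranslate M V hj).curry t) =
    cupSteps (fun i => (orthoCoord V i).comp ContinuousMap.snd)
      (α.pullback (ContinuousMap.fst : C(M × V, M))) i := by
  induction i with
  | zero => rfl
  | succ i ih =>
    rw [cupSteps, cupStep_pullback, ih (by lia)]
    congr 1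
    ext z
    exact orthoCoord_coordTranslate_of_ne hj (by lia) t z

/-- Remove the last coordinate by translating along it; the earlier coordinates, and hence the
half-spaces defined by them, are unchanged. When none is left, restrict to the zero section. -/
theorem isCob_of_isCob_cupSteps {K : Set M} {α : Cochain M m} (hα : coboundary α = 0) (j : ℕ)
    (hj : j ≤ Module.finrank ℝ V)
    (h : IsCob (K ×ˢ (Set.univ : Set V)) ((fun B => K ×ˢ B) '' halfSpaces V j)
      (cupSteps (fun i => (orthoCoord V i).comp ContinuousMap.snd)
        (α.pullback (ContinuousMap.fst : C(M × V, M))) j)) : IsCob K ∅ α := by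
  induction j with
  | zero =>
    exact h.pullback (A' := K) (𝓑' := ∅) (f := ⟨fun m => (m, (0 : V)), by fun_prop⟩)
      (fun _ hm => ⟨hm, trivial⟩) (fun _ h => h.elim)
  | succ j ih =>
    refine ih (by lia) (isCob_of_cupStep (K := K ×ˢ Set.univ)
      (x := (orthoCoord V j).comp ContinuousMap.snd)
      (coordTranslate M V hj) (fun z => ?_) (fun z => ?_)
      (fun t z hz => ⟨hz.1, trivial⟩) (coboundary_cupSteps _ (by rw [coboundary_pullback, hα]; rfl) j)
      (fun t => cupSteps_pullback_coordTranslate hj α t j le_rfl)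
      (𝓑 := (fun B => K ×ˢ B) '' halfSpaces V j) ?_ (h.mono subset_rfl ?_))
    · exact (orthoCoord_coordTranslate hj 0 z).trans (by simp)
    · exact (orthoCoord_coordTranslate hj 1 z).trans (by simp; norm_num)
    · rintro _ ⟨_, ⟨i, hi, rfl | rfl⟩, rfl⟩
      · refine ⟨fun t z hz => ⟨hz.1, ?_⟩, vanishesOn_cupSteps _ _ hi (Or.inl fun z hz =>
          lt_of_lt_of_le one_pos hz.2)⟩
        exact le_of_le_of_eq hz.2 (orthoCoord_coordTranslate_of_ne hj hi.ne t z).symm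
      · refine ⟨fun t z hz => ⟨hz.1, ?_⟩, vanishesOn_cupSteps _ _ hi (Or.inr fun z hz =>
          lt_of_le_of_lt hz.2 (by norm_num))⟩
        exact (orthoCoord_coordTranslate_of_ne hj hi.ne t z).trans_le hz.2
    · rintro B (⟨B, ⟨i, hi, hB⟩, rfl⟩ | rfl | rfl)
      · exact ⟨_, ⟨B, ⟨i, by lia, hB⟩, rfl⟩, subset_rfl⟩
      · exact ⟨_, ⟨_, ⟨j, by lia, Or.inl rfl⟩, rfl⟩, fun z hz => ⟨hz.1.1, hz.2⟩⟩
      · exact ⟨_, ⟨_, ⟨j, by lia, Or.inr rfl⟩, rfl⟩, fun z hz => ⟨hz.1.1, hz.2⟩⟩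

/-- The product with a generator of the cohomology of the disc is injective in cohomology. -/
theorem isCob_of_isCob_cross {K : Set M} {α : Cochain M m} (hα : coboundary α = 0)
    {T : Cochain V (Module.finrank ℝ V)}
    (hT : IsGenerator (Metric.closedBall 0 1) (Metric.sphere 0 1) T)
    (h : IsCob (K ×ˢ Metric.closedBall (0 : V) 1) {K ×ˢ Metric.sphere (0 : V) 1} (α.cross T)) :
    IsCob K ∅ α := by
  obtain ⟨j, hj⟩ := exists_isCob_coordClass_sub hT
  refine isCob_of_isCob_cupSteps hα (Module.finrank ℝ V) le_rfl (V := V) ?_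
  rw [← crossAt_coordClass]
  have h1 := isCob_crossAt_right rfl hα hj K
  have h2 : IsCob (K ×ˢ (Set.univ : Set V))
      ((fun B => K ×ˢ B) '' halfSpaces V (Module.finrank ℝ V))
      ((α.cross T).pullback ((ContinuousMap.id M).prodMap (ballRetract V))) := by
    refine h.pullback (fun z hz => ⟨hz.1, ballRetract_mem_closedBall _⟩) ?_
    rintro _ ⟨B, hB, rfl⟩
    exact ⟨_, rfl, fun z hz => ⟨hz.1, ballRetract_mem_sphere
      (one_le_norm_of_mem_halfSpaces hB hz.2)⟩⟩
  -- The coordinate class is `j` times `T` in cohomology, so triviality of the product with `T`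
  -- implies triviality of the product with the coordinate class. The value of `j` is irrelevant.
  have h3 := h1.add (h2.zsmul j)
  rw [crossAt_sub_right, crossAt_zsmul_right] at h3
  have h4 : (α.cross T).pullback ((ContinuousMap.id M).prodMap (ballRetract V)) =
      crossAt rfl α (T.pullback (ballRetract V)) := rfl
  rwa [h4, sub_add_cancel] at h3

end Disc

/-! ### The splitting defined by a nondegenerate quadratic form -/

section Splitting

variable {k : ℕ} {A : Vec k →ₗ[ℝ] Vec k}

theorem mem_negSpace_of_apply_eq_smul {l : ℝ} (hl : l < 0) {x : Vec k} (hx : A x = l • x) :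
    x ∈ negSpace A :=
  Submodule.mem_iSup_of_mem l (Submodule.mem_iSup_of_mem hl
    (Module.End.mem_eigenspace_iff.mpr hx))

theorem apply_mem_negSpace {x : Vec k} (hx : x ∈ negSpace A) : A x ∈ negSpace A := by
  suffices h : negSpace A ≤ (negSpace A).comap A from h hx
  refine iSup_le fun l => iSup_le fun hl y hy => ?_
  rw [Submodule.mem_comap, Module.End.mem_eigenspace_iff.mp hy]
  exact Submodule.smul_mem _ _ (mem_negSpace_of_apply_eq_smul hl
    (Module.End.mem_eigenspace_iff.mp hy))

theorem inner_eq_zero_of_mem_negSpace (hA : A.IsSymmetric) {l : ℝ} (hl : 0 < l) {b : Vec k}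
    (hb : A b = l • b) {x : Vec k} (hx : x ∈ negSpace A) : inner ℝ b x = 0 := by
  suffices h : negSpace A ≤ (Submodule.span ℝ {b})ᗮ from
    (Submodule.mem_orthogonal_singleton_iff_inner_right).mp (h hx)
  refine iSup_le fun r => iSup_le fun hr y hy => ?_
  rw [Submodule.mem_orthogonal_singleton_iff_inner_right]
  have h1 := hA b y
  rw [hb, Module.End.mem_eigenspace_iff.mp hy, real_inner_smul_left, real_inner_smul_right] at h1
  have h2 : (l - r) * inner ℝ b y = 0 := by
    linarith
  exact (mul_eq_zero.mp h2).resolve_left (by linarith)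

/-- A nondegenerate quadratic form is definite on its negative eigenspace and on the orthogonal
complement. -/
theorem exists_definite_on_negSpace (hA : A.IsSymmetric) (hinj : Function.Injective A) :
    ∃ r > 0, (∀ x ∈ negSpace A, inner ℝ (A x) x ≤ -r * ‖x‖ ^ 2) ∧
      ∀ x ∈ (negSpace A)ᗮ, r * ‖x‖ ^ 2 ≤ inner ℝ (A x) x := by
  have hk : Module.finrank ℝ (Vec k) = k := finrank_euclideanSpace_fin
  set b := hA.eigenvectorBasis hk with hb
  set l := hA.eigenvalues hk with hl
  have hAb : ∀ i, A (b i) = l i • b i := fun i => hA.apply_eigenvectorBasis hk i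
  have hl0 : ∀ i, l i ≠ 0 := fun i h0 => by
    have h1 : A (b i) = A 0 := by rw [hAb, h0, zero_smul, map_zero]
    exact b.toBasis.ne_zero i (by simpa using! hinj h1)
  have hpos : 0 ≤ ∑ i, |l i|⁻¹ := Finset.sum_nonneg fun i _ => by positivity
  -- A positive lower bound for all `|l i|` that also makes sense when `k = 0`.
  refine ⟨(1 + ∑ i, |l i|⁻¹)⁻¹, by positivity, ?_⟩
  set r := (1 + ∑ i, |l i|⁻¹)⁻¹ with hr
  have hrl : ∀ i, r ≤ |l i| := fun i => by
    rw [hr, inv_le_comm₀ (by positivity) (abs_pos.mpr (hl0 i))]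
    have := Finset.single_le_sum (f := fun i => |l i|⁻¹) (fun j _ => by positivity)
      (Finset.mem_univ i)
    linarith
  have hform : ∀ x, inner ℝ (A x) x = ∑ i, l i * inner ℝ (b i) x ^ 2 := fun x => by
    rw [← b.sum_inner_mul_inner]
    refine Finset.sum_congr rfl fun i _ => ?_
    rw [hA x (b i), hAb, inner_smul_right, real_inner_comm]
    ring
  have hnorm : ∀ x, ‖x‖ ^ 2 = ∑ i, inner ℝ (b i) x ^ 2 := fun x => by
    rw [← b.sum_sq_norm_inner_right x]
    simp
  refine ⟨fun x hx => ?_, fun x hx => ?_⟩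
  · rw [hform, hnorm, Finset.mul_sum]
    refine Finset.sum_le_sum fun i _ => ?_
    rcases lt_or_gt_of_ne (hl0 i) with h | h
    · have h1 := hrl i
      rw [abs_of_neg h] at h1
      exact mul_le_mul_of_nonneg_right (by linarith) (sq_nonneg _)
    · rw [inner_eq_zero_of_mem_negSpace hA h (hAb i) hx]
      simp
  · rw [hform, hnorm, Finset.mul_sum]
    refine Finset.sum_le_sum fun i _ => ?_
    rcases lt_or_gt_of_ne (hl0 i) with h | h
    · rw [(Submodule.mem_orthogonal _ _).mp hx _ (mem_negSpace_of_apply_eq_smul h (hAb i))]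
      simp
    · have h1 := hrl i
      rw [abs_of_pos h] at h1
      exact mul_le_mul_of_nonneg_right h1 (sq_nonneg _)

/-- The quadratic form is the sum of its restrictions to the two summands. -/
theorem inner_apply_eq_add (hA : A.IsSymmetric) {x y : Vec k} (hx : x ∈ (negSpace A)ᗮ)
    (hy : y ∈ negSpace A) (x' y' : Vec k) (hx' : x' ∈ (negSpace A)ᗮ) (hy' : y' ∈ negSpace A) :
    inner ℝ (A (x + y)) (x' + y') = inner ℝ (A x) x' + inner ℝ (A y) y' := by
  have h1 : inner ℝ (A x) y' = 0 := by
    rw [hA x y', real_inner_comm]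
    exact (Submodule.mem_orthogonal _ _).mp hx _ (apply_mem_negSpace hy')
  have h2 : inner ℝ (A y) x' = 0 := (Submodule.mem_orthogonal _ _).mp hx' _ (apply_mem_negSpace hy)
  rw [map_add, inner_add_left, inner_add_right, inner_add_right, h1, h2]
  ring

end Splitting

/-! ### Functions quadratic at infinity on the fibres -/

/-- `G` is the fibre gradient of the function `S`, which is quadratic at infinity with quadratic form
`⟪A v, v⟫`. -/
structure IsQuadraticAtInfty {M : Type} [TopologicalSpace M] {k : ℕ} (A : Vec k →ₗ[ℝ] Vec k)
    (S : M × Vec k → ℝ) (G : M × Vec k → Vec k) (C : ℝ) : Prop where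
  symm : A.IsSymmetric
  injective : Function.Injective A
  continuous : Continuous S
  continuous_grad : Continuous G
  hasGradientAt : ∀ m v, HasGradientAt (fun w => S (m, w)) (G (m, v)) v
  norm_sub_le : ∀ z, ‖G z - (2 : ℝ) • A z.2‖ ≤ C

/-- `S` is quadratic at infinity and has the value `f m` at its fibre critical points over `m`. -/
structure IsFibreQuadratic {M : Type} [TopologicalSpace M] {k : ℕ} (A : Vec k →ₗ[ℝ] Vec k)
    (S : M × Vec k → ℝ) (G : M × Vec k → Vec k) (f : M → ℝ) (C : ℝ) : Prop
    extends IsQuadraticAtInfty A S G C where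
  continuous_crit : Continuous f
  eq_of_grad_eq_zero : ∀ z, G z = 0 → S z = f z.1

theorem hasGradientAt_inner_apply {k : ℕ} {A : Vec k →ₗ[ℝ] Vec k} (hA : A.IsSymmetric) (v : Vec k) :
    HasGradientAt (fun w => inner ℝ (A w) w) ((2 : ℝ) • A v) v := by
  have h1 : HasFDerivAt A (LinearMap.toContinuousLinearMap A) v :=
    (LinearMap.toContinuousLinearMap A).hasFDerivAt
  rw [hasGradientAt_iff_hasFDerivAt]
  refine (h1.inner ℝ (hasFDerivAt_id v)).congr_fderiv ?_
  ext x
  have h2 := hA x v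
  simp [real_inner_comm x (A v)]
  rw [h2, real_inner_comm]
  ring

namespace IsQuadraticAtInfty

variable {M : Type} [TopologicalSpace M] {k : ℕ} {A : Vec k →ₗ[ℝ] Vec k}
  {S : M × Vec k → ℝ} {G : M × Vec k → Vec k} {C : ℝ}

theorem nonneg [Nonempty M] (hS : IsQuadraticAtInfty A S G C) : 0 ≤ C :=
  (norm_nonneg _).trans (hS.norm_sub_le (Classical.arbitrary M, 0))

/-- The derivative of `S` along a curve in a fibre. -/
theorem hasDerivAt_comp (hS : IsQuadraticAtInfty A S G C) (m : M) {y : ℝ → Vec k} {y' : Vec k}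
    {t : ℝ} (hy : HasDerivAt y y' t) :
    HasDerivAt (fun t => S (m, y t)) (inner ℝ (G (m, y t)) y') t := by
  have h := (hS.hasGradientAt m (y t)).hasFDerivAt.comp_hasDerivAt t hy
  simpa using! h

/-- The difference has fibre gradient of norm at most `C`, and its values on the zero section are
bounded by compactness of `M`. -/
theorem exists_abs_sub_le [CompactSpace M] (hS : IsQuadraticAtInfty A S G C) :
    ∃ C₀, ∀ m v, |S (m, v) - inner ℝ (A v) v| ≤ C₀ + C * ‖v‖ := by
  obtain ⟨C₀, hC₀⟩ := (isCompact_univ (X := M)).exists_bound_of_continuousOn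
    (f := fun m => S (m, 0)) (hS.continuous.comp (by fun_prop)).continuousOn
  refine ⟨C₀, fun m v => ?_⟩
  have hderiv : ∀ w, HasGradientAt (fun w => S (m, w) - inner ℝ (A w) w)
      (G (m, w) - (2 : ℝ) • A w) w := fun w => by
    have h1 := (hS.hasGradientAt m w).hasFDerivAt
    have h2 := (hasGradientAt_inner_apply hS.symm w).hasFDerivAt
    rw [hasGradientAt_iff_hasFDerivAt, map_sub]
    exact h1.sub h2
  have h1 := (convex_univ (𝕜 := ℝ) (E := Vec k)).norm_image_sub_le_of_norm_hasFDerivWithin_le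
    (fun w _ => (hderiv w).hasFDerivAt.hasFDerivWithinAt)
    (fun w _ => by
      rw [LinearIsometryEquiv.norm_map]
      exact hS.norm_sub_le (m, w)) (Set.mem_univ 0) (Set.mem_univ v)
  simp only [map_zero, inner_zero_left, sub_zero, Real.norm_eq_abs] at h1
  have h2 := hC₀ m trivial
  rw [Real.norm_eq_abs] at h2
  have h3 := abs_add_le (S (m, v) - inner ℝ (A v) v - S (m, 0)) (S (m, 0))
  rw [sub_add_cancel] at h3
  linarith

/-- The fibre gradient is proper. -/
theorem exists_norm_le (hS : IsQuadraticAtInfty A S G C) :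
    ∃ K > 0, ∀ z : M × Vec k, ‖z.2‖ ≤ K * (‖G z‖ + C) := by
  obtain ⟨K, hK, h⟩ := A.exists_antilipschitzWith (LinearMap.ker_eq_bot.mpr hS.injective)
  refine ⟨K, by exact_mod_cast hK, fun z => ?_⟩
  have h1 := h.le_mul_dist z.2 0
  rw [map_zero, dist_zero_right, dist_zero_right] at h1
  have h2 : ‖A z.2‖ ≤ ‖G z‖ + C := by
    have h3 := norm_sub_norm_le ((2 : ℝ) • A z.2) (G z)
    rw [norm_sub_rev] at h3
    have h4 := hS.norm_sub_le z
    rw [norm_smul, Real.norm_two] at h3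
    have := norm_nonneg (A z.2)
    linarith
  exact h1.trans (mul_le_mul_of_nonneg_left h2 K.2)

/-- The set of the points at which the fibre gradient is bounded is contained in a compact set. -/
theorem exists_isCompact [CompactSpace M] (hS : IsQuadraticAtInfty A S G C) (L : ℝ) :
    ∃ Q : Set (M × Vec k), IsCompact Q ∧ ∀ z, ‖G z‖ ≤ L → z ∈ Q := by
  obtain ⟨K, hK, h⟩ := hS.exists_norm_le
  refine ⟨Set.univ ×ˢ Metric.closedBall 0 (K * (L + C)),
    isCompact_univ.prod (isCompact_closedBall _ _), fun z hz => ⟨trivial, ?_⟩⟩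
  rw [mem_closedBall_zero_iff]
  exact (h z).trans (mul_le_mul_of_nonneg_left (by linarith) hK.le)

end IsQuadraticAtInfty

namespace IsFibreQuadratic

variable {M : Type} [TopologicalSpace M] {k : ℕ} {A : Vec k →ₗ[ℝ] Vec k}
  {S : M × Vec k → ℝ} {G : M × Vec k → Vec k} {f : M → ℝ} {C : ℝ}

/-- Where the fibre gradient is small, the function is close to the critical values. -/
theorem exists_forall_abs_sub_lt [CompactSpace M] (hS : IsFibreQuadratic A S G f C) {δ : ℝ}
    (hδ : 0 < δ) : ∃ κ > 0, ∀ z, ‖G z‖ < κ → |S z - f z.1| < δ := by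
  obtain ⟨Q, hQ, hGQ⟩ := hS.exists_isCompact 1
  have hcl : IsClosed {z : M × Vec k | δ ≤ |S z - f z.1|} :=
    isClosed_le continuous_const
      (hS.continuous.sub (hS.continuous_crit.comp continuous_fst)).abs
  have hpos : ∀ z ∈ Q ∩ {z : M × Vec k | δ ≤ |S z - f z.1|}, 0 < ‖G z‖ := by
    rintro z ⟨-, hz⟩
    refine norm_pos_iff.mpr fun h0 => ?_
    simp only [Set.mem_ofPred_eq, hS.eq_of_grad_eq_zero z h0, sub_self, abs_zero] at hz
    linarith
  obtain ⟨κ, hκ, h⟩ := (hQ.inter_right hcl).exists_forall_le' hS.continuous_grad.norm.continuousOn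
    hpos
  refine ⟨min κ 1, by positivity, fun z hz => ?_⟩
  by_contra! hc
  have h1 := h z ⟨hGQ z (hz.le.trans (min_le_right _ _)), hc⟩
  exact absurd (hz.trans_le (min_le_left _ _)) h1.not_gt

/-- A uniform step size for the descent along the fibre gradient. -/
theorem exists_forall_norm_sub_le [CompactSpace M] [Nonempty M] (hS : IsFibreQuadratic A S G f C)
    {κ : ℝ} (hκ : 0 < κ) : ∃ ε > 0, ∀ z : M × Vec k, κ ≤ ‖G z‖ → ∀ t ∈ Set.Icc (0 : ℝ) ε,
      ‖G (z.1, z.2 - t • G z) - G z‖ ≤ ‖G z‖ / 2 := by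
  -- Where `‖G‖ ≤ 8 * C + 1`, uniform continuity on a compact set suffices. Elsewhere `G` is linear
  -- up to errors of total size `2 * C ≤ ‖G‖ / 4`, and the bound on `ε` keeps the linear variation
  -- below `‖G‖ / 4` as well.
  obtain ⟨Q, hQ, hGQ⟩ := hS.exists_isCompact (8 * C + 1)
  have hC := hS.nonneg
  have hG := hS.continuous_grad
  have h1 : ∀ᶠ t : ℝ in nhds 0, ∀ z ∈ Q, ‖G (z.1, z.2 - t • G z) - G z‖ < κ / 2 := by
    refine hQ.eventually_forall_of_forall_eventually fun z _ => ?_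
    have hc : Continuous fun p : ℝ × (M × Vec k) =>
        ‖G (p.2.1, p.2.2 - p.1 • G p.2) - G p.2‖ := by fun_prop
    refine hc.continuousAt.eventually_lt continuousAt_const ?_
    simpa using hκ
  obtain ⟨ε, hε, h2⟩ := Metric.eventually_nhds_iff_ball.mp h1
  set A' := LinearMap.toContinuousLinearMap A with hA'
  refine ⟨min (ε / 2) (8 * ‖A'‖ + 8)⁻¹, by positivity, fun z hz t ht => ?_⟩
  rcases le_total ‖G z‖ (8 * C + 1) with h | h
  · have h3 := h2 t (by
      rw [mem_ball_zero_iff, Real.norm_eq_abs, abs_of_nonneg ht.1]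
      linarith [ht.2.trans (min_le_left _ _)]) z (hGQ z h)
    linarith
  · have h3 := hS.norm_sub_le (z.1, z.2 - t • G z)
    have h4 := hS.norm_sub_le z
    have h5 : ‖(2 : ℝ) • A' (t • G z)‖ ≤ ‖G z‖ / 4 := by
      rw [norm_smul, Real.norm_two]
      have h6 := A'.le_opNorm (t • G z)
      rw [norm_smul, Real.norm_of_nonneg ht.1] at h6
      have h7 := ht.2.trans (min_le_right _ _)
      have h8 : t * (8 * ‖A'‖ + 8) ≤ 1 := (le_inv_mul_iff₀' (by positivity)).mp (by simpa using h7)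
      have h9 : (8 * (‖A'‖ * t)) * ‖G z‖ ≤ 1 * ‖G z‖ := by
        refine mul_le_mul_of_nonneg_right ?_ (norm_nonneg _)
        linarith [ht.1]
      linarith
    have h6 : G (z.1, z.2 - t • G z) - G z =
        (G (z.1, z.2 - t • G z) - (2 : ℝ) • A (z.2 - t • G z)) - (G z - (2 : ℝ) • A z.2) -
          (2 : ℝ) • A' (t • G z) := by
      simp only [hA', LinearMap.coe_toContinuousLinearMap', map_sub, smul_sub]
      abel
    rw [h6]
    have h7 := _root_.norm_sub_le ((G (z.1, z.2 - t • G z) - (2 : ℝ) • A (z.2 - t • G z)) -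
      (G z - (2 : ℝ) • A z.2)) ((2 : ℝ) • A' (t • G z))
    have h8 := _root_.norm_sub_le (G (z.1, z.2 - t • G z) - (2 : ℝ) • A (z.2 - t • G z))
      (G z - (2 : ℝ) • A z.2)
    simp only at h3
    linarith

/-- Along the segment the gradient stays within half its norm of its initial value, so the
directional derivative is at most `-‖G z‖ ^ 2 / 2`. Continuity of `G` is enough, which is why steps
are used instead of a gradient flow. -/
theorem exists_forall_le_sub [CompactSpace M] [Nonempty M] (hS : IsFibreQuadratic A S G f C)
    {κ : ℝ} (hκ : 0 < κ) : ∃ ε > 0, ∀ z : M × Vec k, κ ≤ ‖G z‖ → ∀ t ∈ Set.Icc (0 : ℝ) ε,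
      S (z.1, z.2 - t • G z) ≤ S z - t * (‖G z‖ ^ 2 / 2) := by
  obtain ⟨ε, hε, h⟩ := hS.exists_forall_norm_sub_le hκ
  refine ⟨ε, hε, fun z hz t ht => ?_⟩
  have hd : ∀ s, HasDerivAt (fun s : ℝ => S (z.1, z.2 - s • G z))
      (inner ℝ (G (z.1, z.2 - s • G z)) (-G z)) s := fun s => by
    refine hS.hasDerivAt_comp z.1 (y := fun s : ℝ => z.2 - s • G z) ?_
    simpa using ((hasDerivAt_id s).smul_const (G z)).const_sub z.2
  have h1 := (convex_Icc 0 ε).image_sub_le_mul_sub_of_deriv_le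
    (f := fun s : ℝ => S (z.1, z.2 - s • G z)) (C := -(‖G z‖ ^ 2 / 2))
    (fun s _ => (hd s).continuousAt.continuousWithinAt)
    (fun s _ => (hd s).differentiableAt.differentiableWithinAt) (fun s hs => by
      rw [(hd s).deriv]
      have h2 := h z hz s (interior_subset hs)
      have h3 : inner ℝ (G (z.1, z.2 - s • G z)) (-G z) =
          -(inner ℝ (G (z.1, z.2 - s • G z) - G z) (G z)) - ‖G z‖ ^ 2 := by
        rw [inner_sub_left, inner_neg_right, real_inner_self_eq_norm_sq]
        ring
      have h4 := abs_real_inner_le_norm (G (z.1, z.2 - s • G z) - G z) (G z)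
      have h5 := neg_le_of_abs_le h4
      have h6 := mul_le_mul_of_nonneg_right h2 (norm_nonneg (G z))
      rw [h3]
      nlinarith) 0 ⟨le_rfl, hε.le⟩ t ht ht.1
  simp only [zero_smul, sub_zero] at h1
  linarith

end IsFibreQuadratic

/-! ### Descent along the fibre gradient -/

theorem sublevel_mono {M : Type} {k : ℕ} {S : M × Vec k → ℝ} {a b : ℝ} (h : a ≤ b) :
    sublevel S a ⊆ sublevel S b :=
  fun _ hz => le_trans hz h

section Descent

variable {M : Type} [TopologicalSpace M] {k : ℕ}

/-- The step of size `s ε` along the fibre gradient `G`, cut off where `‖G‖ ≤ κ / 2`. -/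
def descentStep {G : M × Vec k → Vec k} (hG : Continuous G) (ε κ : ℝ) :
    C(unitInterval × (M × Vec k), M × Vec k) where
  toFun p := (p.2.1, p.2.2 - ((p.1 : ℝ) * ε * max 0 (min 1 (2 * ‖G p.2‖ / κ - 1))) • G p.2)
  continuous_toFun := by
    have : Continuous fun p : unitInterval × (M × Vec k) => G p.2 := by fun_prop
    fun_prop

/-- A self-map `F` of `M × ℝ^k` is a descent for `S` if it is homotopic to the identity through
maps which do not increase `S`; it then acts as the identity on the cohomology of sublevels. -/
structure IsDescent (S : M × Vec k → ℝ) (F : C(M × Vec k, M × Vec k)) : Prop where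
  fst_eq : ∀ z, (F z).1 = z.1
  le : ∀ z, S (F z) ≤ S z
  isCob : ∀ {m : ℕ} (u : Cochain (M × Vec k) m) (a b : ℝ),
    VanishesOn (sublevel S a) (coboundary u) → VanishesOn (sublevel S b) u →
    IsCob (sublevel S a) {sublevel S b} (u.pullback F - u)

theorem IsDescent.mapsTo {S : M × Vec k → ℝ} {F : C(M × Vec k, M × Vec k)} (hF : IsDescent S F)
    (a : ℝ) : Set.MapsTo F (sublevel S a) (sublevel S a) := fun z hz => (hF.le z).trans hz

theorem isDescent_id (S : M × Vec k → ℝ) : IsDescent S (ContinuousMap.id (M × Vec k)) where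
  fst_eq _ := rfl
  le _ := le_rfl
  isCob u a b _ _ := by
    have : u.pullback (ContinuousMap.id (M × Vec k)) - u = 0 := sub_self u
    rw [this]
    exact IsCob.of_vanishesOn (vanishesOn_zero _) _

theorem IsDescent.comp {S : M × Vec k → ℝ} {F F' : C(M × Vec k, M × Vec k)} (hF : IsDescent S F)
    (hF' : IsDescent S F') : IsDescent S (F.comp F') where
  fst_eq z := (hF.fst_eq _).trans (hF'.fst_eq z)
  le z := (hF.le _).trans (hF'.le z)
  isCob u a b hδ hu := by
    have h1 : IsCob (sublevel S a) {sublevel S b} ((u.pullback F - u).pullback F') :=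
      (hF.isCob u a b hδ hu).pullback (hF'.mapsTo a) fun B hB => ⟨_, hB.symm ▸ rfl, hB ▸ hF'.mapsTo b⟩
    have h2 := h1.add (hF'.isCob u a b hδ hu)
    have h3 : (u.pullback F - u).pullback F' + (u.pullback F' - u) =
        u.pullback (F.comp F') - u := by
      change u.pullback (F.comp F') - u.pullback F' + (u.pullback F' - u) = _
      abel
    rwa [h3] at h2

/-- A homotopy from the identity which does not increase `S` defines a descent. -/
theorem isDescent_of_homotopy {S : M × Vec k → ℝ} (H : C(unitInterval × (M × Vec k), M × Vec k))
    (h0 : ∀ z, H (0, z) = z) (hfst : ∀ p, (H p).1 = p.2.1) (hle : ∀ p, S (H p) ≤ S p.2) :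
    IsDescent S (H.curry 1) where
  fst_eq z := hfst (1, z)
  le z := hle (1, z)
  isCob u a b hδ hu := by
    have h1 := isCob_homotopy H u (A := sublevel S a) (A' := sublevel S a) (𝓑 := {sublevel S b})
      (fun t z hz => (hle (t, z)).trans hz) hδ
      fun B hB => ⟨_, fun t z hz => (hle (t, z)).trans (hB ▸ hz : z ∈ sublevel S b), hu⟩
    have h2 : u.pullback (H.curry 0) = u := by
      have : H.curry 0 = ContinuousMap.id _ := ContinuousMap.ext h0
      rw [this]
      rfl
    rwa [h2] at h1

namespace IsFibreQuadratic

variable {A : Vec k →ₗ[ℝ] Vec k} {S : M × Vec k → ℝ} {G : M × Vec k → Vec k} {f : M → ℝ} {C : ℝ}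
  [CompactSpace M] [Nonempty M]

theorem exists_isDescent_step (hS : IsFibreQuadratic A S G f C) {κ : ℝ} (hκ : 0 < κ) :
    ∃ F, IsDescent S F ∧ ∃ η > 0, ∀ z, κ ≤ ‖G z‖ → S (F z) ≤ S z - η := by
  -- The cut-off in `descentStep` grows from `0` at `‖G‖ = κ / 2` to `1` at `‖G‖ = κ`, so the step
  -- size must be valid from `κ / 2` on.
  obtain ⟨ε, hε, h⟩ := hS.exists_forall_le_sub (half_pos hκ)
  have hχ : ∀ r : ℝ, max 0 (min 1 r) ∈ Set.Icc (0 : ℝ) 1 := fun r =>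
    ⟨le_max_left _ _, max_le zero_le_one (min_le_left _ _)⟩
  refine ⟨(descentStep hS.continuous_grad ε κ).curry 1,
    isDescent_of_homotopy _ (fun z => ?_) (fun _ => rfl) (fun p => ?_),
    ε * (κ ^ 2 / 2), by positivity, fun z hz => ?_⟩
  · simp [descentStep]
  · obtain ⟨t, z⟩ := p
    simp only [descentStep, ContinuousMap.coe_mk]
    rcases le_total (κ / 2) ‖G z‖ with hz | hz
    · have h1 := hχ (2 * ‖G z‖ / κ - 1)
      have h2 : (t : ℝ) * ε * max 0 (min 1 (2 * ‖G z‖ / κ - 1)) ∈ Set.Icc 0 ε := by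
        refine ⟨mul_nonneg (mul_nonneg t.2.1 hε.le) h1.1, ?_⟩
        have h3 : (t : ℝ) * ε ≤ ε := by nlinarith [t.2.2]
        have h4 : 0 ≤ (t : ℝ) * ε := mul_nonneg t.2.1 hε.le
        nlinarith [h1.2, h1.1]
      have h3 := h z hz _ h2
      have h4 : 0 ≤ (t : ℝ) * ε * max 0 (min 1 (2 * ‖G z‖ / κ - 1)) * (‖G z‖ ^ 2 / 2) :=
        mul_nonneg h2.1 (by positivity)
      linarith
    · have h1 : 2 * ‖G z‖ / κ - 1 ≤ 0 := by
        rw [sub_nonpos, div_le_one hκ]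
        linarith
      rw [max_eq_left ((min_le_right _ _).trans h1), mul_zero, zero_smul, sub_zero]
  · have h1 : 1 ≤ 2 * ‖G z‖ / κ - 1 := by
      rw [le_sub_iff_add_le, le_div_iff₀ hκ]
      linarith
    have h2 := h z (by linarith) ε ⟨hε.le, le_rfl⟩
    have h3 : (descentStep hS.continuous_grad ε κ).curry 1 z = (z.1, z.2 - ε • G z) := by
      simp [descentStep, h1]
    have h4 : ε * (κ ^ 2 / 2) ≤ ε * (‖G z‖ ^ 2 / 2) := by
      have := pow_le_pow_left₀ hκ.le hz 2
      exact mul_le_mul_of_nonneg_left (by linarith) hε.le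
    rw [h3]
    linarith

/-- Away from the critical values, points can be pushed down to arbitrarily low levels. -/
theorem exists_isDescent (hS : IsFibreQuadratic A S G f C) {δ : ℝ} (hδ : 0 < δ) (c : ℝ) :
    ∃ F, IsDescent S F ∧ (∀ z, S z ≤ c → S z ≤ f z.1 - δ → S (F z) ≤ -c) ∧
      ∀ z, S z ≤ c → S (F z) ≤ max (f z.1 + δ) (-c) := by
  obtain ⟨κ, hκ, hκS⟩ := hS.exists_forall_abs_sub_lt hδ
  obtain ⟨F, hF, η, hη, hdrop⟩ := hS.exists_isDescent_step hκ
  -- Steps stay in the fibre and never raise `S`. A point below `f - δ` therefore stays there and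
  -- loses `η` at each step; a point above `f + δ` loses `η` at each step until it falls below that
  -- level.
  have hN : ∀ N : ℕ, ∃ F', IsDescent S F' ∧
      (∀ z, S z ≤ c → S z ≤ f z.1 - δ → S (F' z) ≤ c - N * η) ∧
      ∀ z, S z ≤ c → S (F' z) ≤ max (f z.1 + δ) (c - N * η) := by
    intro N
    induction N with
    | zero => exact ⟨_, isDescent_id S, fun z hz _ => by simpa using hz, fun z hz => by
        simpa using Or.inr hz⟩
    | succ N ih =>
      obtain ⟨F', hF', h1, h2⟩ := ih
      refine ⟨F.comp F', hF.comp hF', fun z hz hzf => ?_, fun z hz => ?_⟩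
      · have h3 := hdrop (F' z) (by
          by_contra! hc
          have h4 := hκS _ hc
          rw [hF'.fst_eq, abs_lt] at h4
          linarith [h4.1, hF'.le z])
        have h4 := h1 z hz hzf
        push_cast
        rw [ContinuousMap.comp_apply]
        linarith
      · rw [ContinuousMap.comp_apply]
        rcases le_or_gt (S (F' z)) (f z.1 + δ) with hle | hlt
        · exact le_max_of_le_left ((hF.le _).trans hle)
        · have h3 := hdrop (F' z) (by
            by_contra! hc
            have h4 := hκS _ hc
            rw [hF'.fst_eq, abs_lt] at h4
            linarith [h4.2])
          have h4 := (le_max_iff.mp (h2 z hz)).resolve_left hlt.not_ge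
          refine le_max_of_le_right ?_
          push_cast
          linarith
  -- Enough steps to descend from level `c` to level `-c`.
  obtain ⟨N, hNc⟩ := exists_nat_ge (2 * c / η)
  rw [div_le_iff₀ hη] at hNc
  obtain ⟨F', hF', h1, h2⟩ := hN N
  exact ⟨F', hF', fun z hz hzf => (h1 z hz hzf).trans (by linarith), fun z hz =>
    (h2 z hz).trans (max_le_max le_rfl (by linarith))⟩

end IsFibreQuadratic

end Descent

/-! ### Retraction of the sublevels onto a disc bundle -/

section Retraction

variable {M : Type} [TopologicalSpace M] {k : ℕ}

/-- The retraction of `M × ℝ^k` to the unit disc bundle of the negative eigenspace. -/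
def discRetract (M : Type) [TopologicalSpace M] {k : ℕ} (A : Vec k →ₗ[ℝ] Vec k) :
    C(M × Vec k, M × negSpace A) where
  toFun z := (z.1, ballRetract (negSpace A) ((negSpace A).orthogonalProjectionOnto z.2))
  continuous_toFun := by fun_prop

theorem discRetract_mem (A : Vec k →ₗ[ℝ] Vec k) (z : M × Vec k) :
    discRetract M A z ∈ (Set.univ : Set M) ×ˢ Metric.closedBall (0 : negSpace A) 1 :=
  ⟨trivial, ballRetract_mem_closedBall _⟩

/-- The retraction is a homotopy inverse of the inclusion of a disc bundle. -/
theorem isCob_pullback_discRetract_comp_discMap (A : Vec k →ₗ[ℝ] Vec k) {R : ℝ} (hR : 1 ≤ R)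
    {m : ℕ} {u : Cochain (M × negSpace A) m}
    (hu : IsRelCocycle (Set.univ ×ˢ Metric.closedBall 0 1) (Set.univ ×ˢ Metric.sphere 0 1) u) :
    IsCob (Set.univ ×ˢ Metric.closedBall 0 1) {Set.univ ×ˢ Metric.sphere 0 1}
      (u.pullback ((discRetract M A).comp (discMap M A R)) - u) := by
  let H : C(unitInterval × (M × negSpace A), M × negSpace A) :=
    ⟨fun p => (p.2.1, ballRetract (negSpace A) ((1 + (p.1 : ℝ) * (R - 1)) • p.2.2)), by fun_prop⟩
  have h1 := isCob_homotopy H u (A := Set.univ ×ˢ Metric.closedBall 0 1)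
    (A' := Set.univ ×ˢ Metric.closedBall 0 1) (𝓑 := {Set.univ ×ˢ Metric.sphere 0 1})
    (fun t z _ => ⟨trivial, ballRetract_mem_closedBall _⟩) hu.2 (by
      rintro _ rfl
      refine ⟨Set.univ ×ˢ Metric.sphere 0 1,
        fun t z hz => ⟨trivial, ballRetract_mem_sphere ?_⟩, hu.1⟩
      have h2 : ‖z.2‖ = 1 := mem_sphere_zero_iff_norm.mp hz.2
      have h3 : 0 ≤ (t : ℝ) * (R - 1) := mul_nonneg t.2.1 (by linarith)
      rw [norm_smul, h2, mul_one, Real.norm_of_nonneg (by positivity)]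
      linarith)
  have h2 : H.curry 1 = (discRetract M A).comp (discMap M A R) := by
    ext1 z
    refine Prod.ext rfl ?_
    have h3 : (negSpace A).orthogonalProjectionOnto (R • (z.2 : Vec k)) = R • z.2 := by
      rw [← Submodule.coe_smul, Submodule.orthogonalProjectionOnto_mem_subspace_eq_self]
    change ballRetract _ ((1 + ((1 : unitInterval) : ℝ) * (R - 1)) • z.2) =
      ballRetract _ ((negSpace A).orthogonalProjectionOnto (R • (z.2 : Vec k)))
    rw [h3, Set.Icc.coe_one, one_mul, add_sub_cancel]
  have h3 : ∀ z ∈ (Set.univ : Set M) ×ˢ Metric.closedBall (0 : negSpace A) 1, H.curry 0 z = z := by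
    rintro z ⟨-, hz⟩
    refine Prod.ext rfl ?_
    change ballRetract _ ((1 + ((0 : unitInterval) : ℝ) * (R - 1)) • z.2) = z.2
    rw [Set.Icc.coe_zero, zero_mul, add_zero, one_smul]
    exact ballRetract_of_norm_le (mem_closedBall_zero_iff.mp hz)
  rw [h2] at h1
  have h4 : IsCob (Set.univ ×ˢ Metric.closedBall 0 1) {Set.univ ×ˢ Metric.sphere 0 1}
      (u.pullback (H.curry 0) - u) := by
    refine IsCob.of_vanishesOn (fun s hs => ?_) _
    have : (H.curry 0).comp s = s := ContinuousMap.ext fun p => h3 _ (hs p)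
    change u ((H.curry 0).comp s) - u s = 0
    rw [this, sub_self]
  have h5 := h1.add h4
  rwa [sub_add_sub_cancel] at h5

namespace IsFibreQuadratic

variable {A : Vec k →ₗ[ℝ] Vec k} {S : M × Vec k → ℝ} {G : M × Vec k → Vec k} {f : M → ℝ} {C : ℝ}

/-- Everything follows from the definiteness of the form on the two summands, with errors linear in
`‖x‖ + ‖y‖`. The third estimate bounds the derivative of `S` along the hyperbolic field `-x + y`,
which is thus negative outside a bounded set of the fibres. -/
theorem exists_bounds [CompactSpace M] (hS : IsFibreQuadratic A S G f C) :
    ∃ r > 0, ∃ Λ ≥ 0, ∃ C₀ ≥ 0, ∀ m, ∀ x ∈ (negSpace A)ᗮ, ∀ y ∈ negSpace A,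
      S (m, x + y) ≤ Λ * ‖x‖ ^ 2 - r * ‖y‖ ^ 2 + C₀ + C * (‖x‖ + ‖y‖) ∧
      r * ‖x‖ ^ 2 - Λ * ‖y‖ ^ 2 - C₀ - C * (‖x‖ + ‖y‖) ≤ S (m, x + y) ∧
      inner ℝ (G (m, x + y)) (-x + y) ≤
        -(2 * r) * (‖x‖ ^ 2 + ‖y‖ ^ 2) + C * (‖x‖ + ‖y‖) := by
  obtain ⟨r, hr, hneg, hpos⟩ := exists_definite_on_negSpace hS.symm hS.injective
  obtain ⟨C₀, hC₀⟩ := hS.exists_abs_sub_le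
  set A' := LinearMap.toContinuousLinearMap A with hA'
  have hΛ : ∀ x, |inner ℝ (A x) x| ≤ ‖A'‖ * ‖x‖ ^ 2 := fun x => by
    refine (abs_real_inner_le_norm _ _).trans ?_
    rw [sq, ← mul_assoc]
    exact mul_le_mul_of_nonneg_right (A'.le_opNorm x) (norm_nonneg _)
  refine ⟨r, hr, ‖A'‖, norm_nonneg _, |C₀|, abs_nonneg _, fun m x hx y hy => ?_⟩
  have hC : 0 ≤ C := (norm_nonneg _).trans (hS.norm_sub_le (m, 0))
  have h1 := abs_le.mp (hC₀ m (x + y))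
  rw [inner_apply_eq_add hS.symm hx hy x y hx hy] at h1
  have h2 := mul_le_mul_of_nonneg_left (norm_add_le x y) hC
  have h3 := abs_le.mp (hΛ x)
  have h4 := abs_le.mp (hΛ y)
  have h5 := hneg y hy
  have h6 := hpos x hx
  have h7 := le_abs_self C₀
  refine ⟨by linarith, by linarith, ?_⟩
  have h8 : inner ℝ (G (m, x + y)) (-x + y) =
      inner ℝ (G (m, x + y) - (2 : ℝ) • A (x + y)) (-x + y) +
        2 * inner ℝ (A (x + y)) (-x + y) := by
    rw [inner_sub_left, real_inner_smul_left]
    ring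
  rw [h8, inner_apply_eq_add hS.symm hx hy (-x) y (Submodule.neg_mem _ hx) hy, inner_neg_right]
  have h9 := (le_abs_self _).trans
    (abs_real_inner_le_norm (G (m, x + y) - (2 : ℝ) • A (x + y)) (-x + y))
  have h10 : ‖G (m, x + y) - (2 : ℝ) • A (x + y)‖ * ‖-x + y‖ ≤ C * (‖x‖ + ‖y‖) := by
    refine mul_le_mul (hS.norm_sub_le (m, x + y)) ?_ (norm_nonneg _) hC
    rw [← norm_neg x]
    exact norm_add_le _ _
  linarith

/-- The hyperbolic flow preserves the sublevels of high and of low level. -/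
theorem exists_le_hyperbolic [CompactSpace M] [Nonempty M] (hS : IsFibreQuadratic A S G f C) :
    ∃ c₁, ∀ b, c₁ ≤ |b| → ∀ m, ∀ x ∈ (negSpace A)ᗮ, ∀ y ∈ negSpace A, S (m, x + y) ≤ b →
      ∀ t : ℝ, 0 ≤ t → S (m, Real.exp (-t) • x + Real.exp t • y) ≤ b := by
  obtain ⟨r, hr, Λ, hΛ, C₀, hC₀, hbd⟩ := hS.exists_bounds
  have hC := hS.nonneg
  -- Where the derivative along the hyperbolic flow is not negative, `‖x‖ + ‖y‖ ≤ C / r`, and there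
  -- `|S|` is less than this constant. So `S` decreases strictly whenever a trajectory meets a level
  -- `b` with `|b|` at least the constant.
  refine ⟨(r + Λ) * (C / r) ^ 2 + C₀ + C * (C / r) + 1, fun b hb m x hx y hy hle t ht => ?_⟩
  have hd : ∀ s, HasDerivAt (fun s => S (m, Real.exp (-s) • x + Real.exp s • y))
      (inner ℝ (G (m, Real.exp (-s) • x + Real.exp s • y))
        (-(Real.exp (-s) • x) + Real.exp s • y)) s := fun s => by
    refine hS.hasDerivAt_comp m (y := fun s => Real.exp (-s) • x + Real.exp s • y) ?_
    have h1 := ((hasDerivAt_neg s).exp.smul_const x).add ((Real.hasDerivAt_exp s).smul_const y)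
    simpa using! h1
  refine image_le_of_deriv_right_lt_deriv_boundary (a := 0) (b := t) (B := fun _ => b)
    (B' := fun _ => 0) (fun s _ => (hd s).continuousAt.continuousWithinAt)
    (fun s _ => (hd s).hasDerivWithinAt) (by simpa using hle) (fun s => hasDerivAt_const s b)
    (fun s _ hsb => ?_) ⟨ht, le_rfl⟩
  have hx' := Submodule.smul_mem _ (Real.exp (-s)) hx
  have hy' := Submodule.smul_mem _ (Real.exp s) hy
  obtain ⟨h1, h2, h3⟩ := hbd m _ hx' _ hy'
  rw [hsb] at h1 h2
  set X := ‖Real.exp (-s) • x‖ with hX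
  set Y := ‖Real.exp s • y‖ with hY
  have hX0 : 0 ≤ X := norm_nonneg _
  have hY0 : 0 ≤ Y := norm_nonneg _
  by_contra! hc
  have h4 : r * (X + Y) ^ 2 ≤ C * (X + Y) := by nlinarith [sq_nonneg (X - Y)]
  have h5 : X + Y ≤ C / r := by
    rw [le_div_iff₀ hr]
    rcases (add_nonneg hX0 hY0).eq_or_lt with h0 | h0
    · rw [← h0, zero_mul]
      exact hC
    · nlinarith
  have h6 : (X + Y) ^ 2 ≤ (C / r) ^ 2 := pow_le_pow_left₀ (by positivity) h5 2
  have h7 : X ^ 2 ≤ (C / r) ^ 2 := le_trans (by nlinarith) h6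
  have h8 : Y ^ 2 ≤ (C / r) ^ 2 := le_trans (by nlinarith) h6
  have h9 : C * (X + Y) ≤ C * (C / r) := mul_le_mul_of_nonneg_left h5 hC
  have h10 := mul_le_mul_of_nonneg_left h7 hΛ
  have h11 := mul_le_mul_of_nonneg_left h8 hΛ
  have h12 := mul_nonneg hr.le (sq_nonneg X)
  have h13 := mul_nonneg hr.le (sq_nonneg Y)
  have h14 := mul_nonneg hr.le (sq_nonneg (C / r))
  have h15 : |b| ≤ (r + Λ) * (C / r) ^ 2 + C₀ + C * (C / r) := by
    rw [abs_le]
    constructor <;> linarith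
  linarith

/-- The function is bounded above, and tends to `-∞`, on a cone around the negative eigenspace. -/
theorem exists_le_on_cone [CompactSpace M] [Nonempty M] (hS : IsFibreQuadratic A S G f C) :
    ∃ ε > 0, ∃ D, (∀ m, ∀ x ∈ (negSpace A)ᗮ, ∀ y ∈ negSpace A, ‖x‖ ≤ ε * (1 + ‖y‖) →
      S (m, x + y) ≤ D) ∧ ∀ b, ∃ Q, ∀ m, ∀ x ∈ (negSpace A)ᗮ, ∀ y ∈ negSpace A,
      ‖x‖ ≤ ε * (1 + ‖y‖) → Q ≤ ‖y‖ → S (m, x + y) ≤ b := by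
  obtain ⟨r, hr, Λ, hΛ, C₀, hC₀, hbd⟩ := hS.exists_bounds
  have hC := hS.nonneg
  have hε : ∃ ε : ℝ, 0 < ε ∧ ε ≤ 1 ∧ 2 * Λ * ε ^ 2 ≤ r / 2 := by
    -- The cone is narrow enough that `Λ * ‖x‖ ^ 2` absorbs only half of `r * ‖y‖ ^ 2`, up to a
    -- constant.
    refine ⟨min 1 (r / (4 * Λ + r)), by positivity, min_le_left _ _, ?_⟩
    set ε := min 1 (r / (4 * Λ + r)) with hε
    have h0 : 0 < ε := by positivity
    have h1 : ε ≤ 1 := min_le_left _ _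
    have h2 : ε * (4 * Λ + r) ≤ r := (le_div_iff₀ (by positivity)).mp (min_le_right _ _)
    have h3 : ε ^ 2 ≤ ε := by nlinarith
    nlinarith [mul_le_mul_of_nonneg_left h3 hΛ]
  obtain ⟨ε, hε0, hε1, hε⟩ := hε
  have key : ∀ m, ∀ x ∈ (negSpace A)ᗮ, ∀ y ∈ negSpace A, ‖x‖ ≤ ε * (1 + ‖y‖) →
      S (m, x + y) ≤ -(r / 2) * ‖y‖ ^ 2 + 2 * C * ‖y‖ + (r / 2 + C₀ + C) := by
    intro m x hx y hy hxy
    have h1 := (hbd m x hx y hy).1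
    have hx0 := norm_nonneg x
    have hy0 := norm_nonneg y
    have h2 : ‖x‖ ^ 2 ≤ ε ^ 2 * (2 * (1 + ‖y‖ ^ 2)) := by
      refine (pow_le_pow_left₀ hx0 hxy 2).trans ?_
      rw [mul_pow]
      exact mul_le_mul_of_nonneg_left (by nlinarith [sq_nonneg (1 - ‖y‖)]) (sq_nonneg _)
    have h3 := mul_le_mul_of_nonneg_left h2 hΛ
    have h4 : 2 * Λ * ε ^ 2 * (1 + ‖y‖ ^ 2) ≤ r / 2 * (1 + ‖y‖ ^ 2) :=
      mul_le_mul_of_nonneg_right hε (by positivity)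
    have h5 : ‖x‖ ≤ 1 + ‖y‖ := hxy.trans (mul_le_of_le_one_left (by positivity) hε1)
    have h6 := mul_le_mul_of_nonneg_left h5 hC
    linarith
  refine ⟨ε, hε0, 2 * C ^ 2 / r + (r / 2 + C₀ + C), fun m x hx y hy hxy => ?_, fun b => ?_⟩
  · refine (key m x hx y hy hxy).trans ?_
    have h1 : -(r / 2) * ‖y‖ ^ 2 + 2 * C * ‖y‖ ≤ 2 * C ^ 2 / r := by
      rw [le_div_iff₀ hr]
      nlinarith [sq_nonneg (r * ‖y‖ - 2 * C)]
    linarith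
  · refine ⟨max 1 (2 / r * (2 * C + (r / 2 + C₀ + C) + |b|)), fun m x hx y hy hxy hQ => ?_⟩
    refine (key m x hx y hy hxy).trans ?_
    have h1 := (le_max_left _ _).trans hQ
    have h2 := (le_max_right _ _).trans hQ
    have h3 : 2 * C + (r / 2 + C₀ + C) + |b| ≤ r / 2 * ‖y‖ := by
      rw [div_mul_eq_mul_div, div_le_iff₀ hr] at h2
      linarith
    have h4 : 0 ≤ r / 2 + C₀ + C + |b| := by positivity
    have h5 := mul_le_mul_of_nonneg_right h3 (norm_nonneg y)
    have h6 : (r / 2 + C₀ + C) + |b| ≤ ((r / 2 + C₀ + C) + |b|) * ‖y‖ :=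
      le_mul_of_one_le_right h4 h1
    nlinarith [neg_abs_le b]

/-- On a sublevel, the positive component is controlled by the negative one. -/
theorem exists_norm_le_of_le [CompactSpace M] [Nonempty M] (hS : IsFibreQuadratic A S G f C)
    (c : ℝ) : ∃ K > 0, ∀ m, ∀ x ∈ (negSpace A)ᗮ, ∀ y ∈ negSpace A, S (m, x + y) ≤ c →
      ‖x‖ ≤ K * (1 + ‖y‖) := by
  obtain ⟨r, hr, Λ, hΛ, C₀, hC₀, hbd⟩ := hS.exists_bounds
  have hC := hS.nonneg
  refine ⟨1 + (|c| + C₀ + Λ + 2 * C) / r, by positivity, fun m x hx y hy hle => ?_⟩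
  have h1 := (hbd m x hx y hy).2.1.trans hle
  have hy0 := norm_nonneg y
  by_contra! hc
  have hE : 0 ≤ (|c| + C₀ + Λ + 2 * C) / r := by positivity
  have h2 : 1 + ‖y‖ ≤ ‖x‖ := by nlinarith
  have h3 : (|c| + C₀ + Λ + 2 * C) / r * (1 + ‖y‖) < ‖x‖ := by nlinarith
  rw [div_mul_eq_mul_div, div_lt_iff₀ hr] at h3
  have h4 := mul_lt_mul_of_pos_right h3 (show 0 < ‖x‖ by linarith)
  have h5 : 1 ≤ (1 + ‖y‖) * ‖x‖ := by nlinarith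
  have h6 : ‖y‖ ^ 2 ≤ (1 + ‖y‖) * ‖x‖ := by nlinarith
  have h7 : ‖x‖ + ‖y‖ ≤ 2 * ((1 + ‖y‖) * ‖x‖) := by nlinarith
  have h8 := mul_le_mul_of_nonneg_left h5 (show 0 ≤ |c| + C₀ by positivity)
  have h9 := mul_le_mul_of_nonneg_left h6 hΛ
  have h10 := mul_le_mul_of_nonneg_left h7 hC
  nlinarith [le_abs_self c]

/-- On a low sublevel, the negative component is large. -/
theorem exists_one_le_norm_of_le [CompactSpace M] [Nonempty M] (hS : IsFibreQuadratic A S G f C) :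
    ∃ c₁, ∀ m, ∀ x ∈ (negSpace A)ᗮ, ∀ y ∈ negSpace A, S (m, x + y) ≤ -c₁ → 1 ≤ ‖y‖ := by
  obtain ⟨r, hr, Λ, hΛ, C₀, hC₀, hbd⟩ := hS.exists_bounds
  have hC := hS.nonneg
  -- The first term is the maximum of `C * s - r * s ^ 2`; the others bound the contribution of `‖y‖
  -- < 1`.
  refine ⟨C ^ 2 / (4 * r) + Λ + C₀ + C + 1, fun m x hx y hy hle => ?_⟩
  have h1 := (hbd m x hx y hy).2.1.trans hle
  by_contra! hc
  have hy0 := norm_nonneg y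
  have h2 : ‖y‖ ^ 2 ≤ 1 := by nlinarith
  have h3 := mul_le_mul_of_nonneg_left h2 hΛ
  have h4 := mul_le_mul_of_nonneg_left hc.le hC
  have h5 : C * ‖x‖ - r * ‖x‖ ^ 2 ≤ C ^ 2 / (4 * r) := by
    rw [le_div_iff₀ (by positivity)]
    nlinarith [sq_nonneg (2 * r * ‖x‖ - C)]
  linarith

end IsFibreQuadratic

end Retraction

section RetractionHomotopy

variable {M : Type} [TopologicalSpace M] {k : ℕ}

/-- The hyperbolic flow up to time `τ`. -/
def hyperbolicHomotopy (M : Type) [TopologicalSpace M] {k : ℕ} (A : Vec k →ₗ[ℝ] Vec k) (τ : ℝ) :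
    C(unitInterval × (M × Vec k), M × Vec k) where
  toFun p := (p.2.1, Real.exp (-((p.1 : ℝ) * τ)) • (p.2.2 - (negSpace A).starProjection p.2.2) +
    Real.exp ((p.1 : ℝ) * τ) • (negSpace A).starProjection p.2.2)
  continuous_toFun := by fun_prop

/-- The straight homotopy from the hyperbolic flow at time `τ` to the retraction onto the disc of
radius `R`. -/
def straightHomotopy (M : Type) [TopologicalSpace M] {k : ℕ} (A : Vec k →ₗ[ℝ] Vec k) (τ R : ℝ) :
    C(unitInterval × (M × Vec k), M × Vec k) where
  toFun p := (p.2.1, (1 - (p.1 : ℝ)) • (hyperbolicHomotopy M A τ (1, p.2)).2 +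
    (p.1 : ℝ) • (discMap M A R (discRetract M A p.2)).2)
  continuous_toFun := by fun_prop

namespace IsFibreQuadratic

variable {A : Vec k →ₗ[ℝ] Vec k} {S : M × Vec k → ℝ} {G : M × Vec k → Vec k} {f : M → ℝ} {C : ℝ}

theorem exists_mapsTo_discRetract [CompactSpace M] [Nonempty M]
    (hS : IsFibreQuadratic A S G f C) : ∃ c₁, ∀ c ≥ c₁,
      Set.MapsTo (discRetract M A) (sublevel S (-c)) (Set.univ ×ˢ Metric.sphere 0 1) := by
  obtain ⟨c₁, h⟩ := hS.exists_one_le_norm_of_le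
  refine ⟨c₁, fun c hc z hz => ⟨trivial, ballRetract_mem_sphere ?_⟩⟩
  refine h z.1 (z.2 - (negSpace A).starProjection z.2)
    ((negSpace A).sub_starProjection_mem_orthogonal z.2) ((negSpace A).starProjection z.2)
    ((negSpace A).starProjection_apply_mem z.2) ?_
  rw [sub_add_cancel]
  exact le_trans hz (neg_le_neg hc)

theorem exists_mapsTo_discMap [CompactSpace M] [Nonempty M]
    (hS : IsFibreQuadratic A S G f C) : ∃ c₁, ∀ c ≥ c₁, ∃ R₀, ∀ R ≥ R₀,
      Set.MapsTo (discMap M A R) (Set.univ ×ˢ Metric.closedBall 0 1) (sublevel S c) ∧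
      Set.MapsTo (discMap M A R) (Set.univ ×ˢ Metric.sphere 0 1) (sublevel S (-c)) := by
  obtain ⟨ε, hε, D, hD, hQ⟩ := hS.exists_le_on_cone
  have h0 : ∀ y : Vec k, ‖(0 : Vec k)‖ ≤ ε * (1 + ‖y‖) := fun y => by
    rw [norm_zero]
    positivity
  refine ⟨D, fun c hc => ?_⟩
  obtain ⟨Q, hQ⟩ := hQ (-c)
  refine ⟨Q, fun R hR => ⟨fun z _ => ?_, fun z hz => ?_⟩⟩
  · have h := hD z.1 0 (Submodule.zero_mem _) (R • (z.2 : Vec k))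
      (Submodule.smul_mem _ _ z.2.2) (h0 _)
    rw [zero_add] at h
    exact h.trans hc
  · have h2 : ‖(z.2 : Vec k)‖ = 1 := mem_sphere_zero_iff_norm.mp hz.2
    have h := hQ z.1 0 (Submodule.zero_mem _) (R • (z.2 : Vec k))
      (Submodule.smul_mem _ _ z.2.2) (h0 _) (by
        rw [norm_smul, h2, mul_one]
        exact hR.trans (le_abs_self R))
    rwa [zero_add] at h

/-- On high sublevels, relatively to low sublevels, the inclusion of a large disc bundle is a right
inverse of the retraction in cohomology. -/
theorem exists_isCob_pullback_discMap_comp_discRetract [CompactSpace M] [Nonempty M]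
    (hS : IsFibreQuadratic A S G f C) : ∃ c₁, ∀ c ≥ c₁, ∃ R₀, ∀ R ≥ R₀,
      ∀ (m : ℕ) (u : Cochain (M × Vec k) m), IsRelCocycle (sublevel S c) (sublevel S (-c)) u →
        IsCob (sublevel S c) {sublevel S (-c)}
          (u.pullback ((discMap M A R).comp (discRetract M A)) - u) := by
  obtain ⟨ε, hε, D, hD, hQ⟩ := hS.exists_le_on_cone
  obtain ⟨c₁, hflow⟩ := hS.exists_le_hyperbolic
  obtain ⟨c₂, hone⟩ := hS.exists_one_le_norm_of_le
  refine ⟨max (max D c₁) (max c₂ 0), fun c hc => ?_⟩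
  have hcD : D ≤ c := ((le_max_left _ _).trans (le_max_left _ _)).trans hc
  have hc1 : c₁ ≤ |c| :=
    (((le_max_right _ _).trans (le_max_left _ _)).trans hc).trans (le_abs_self c)
  have hc2 : c₂ ≤ c := ((le_max_left _ _).trans (le_max_right _ _)).trans hc
  have hc0 : 0 ≤ c := ((le_max_right _ _).trans (le_max_right _ _)).trans hc
  obtain ⟨Q, hQ⟩ := hQ (-c)
  obtain ⟨K, hK, hbound⟩ := hS.exists_norm_le_of_le c
  -- `E` is the expansion factor of the hyperbolic flow at its final time `τ`. It is large enough to
  -- bring the sublevel `c` into the cone of `exists_le_on_cone`, and the sublevel `-c`, where `‖y‖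
  -- ≥ 1`, into the part `‖y‖ ≥ Q`.
  set E := 1 + K / ε + |Q| with hE
  have hE1 : 1 ≤ E := by
    have : 0 ≤ K / ε := by positivity
    linarith [abs_nonneg Q]
  have hEK : K / ε ≤ E := by linarith [abs_nonneg Q]
  have hEQ : Q ≤ E := by
    have : 0 ≤ K / ε := by positivity
    linarith [le_abs_self Q]
  have hE0 : 0 < E := by linarith
  set τ := Real.log E with hτ
  have hτ0 : 0 ≤ τ := Real.log_nonneg hE1
  refine ⟨max 0 Q, fun R hR m u hu => ?_⟩
  have hR0 : 0 ≤ R := (le_max_left _ _).trans hR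
  have hRQ : Q ≤ R := (le_max_right _ _).trans hR
  let N := negSpace A
  have hmem : ∀ ξ : Vec k, ξ - N.starProjection ξ ∈ Nᗮ := fun ξ =>
    N.sub_starProjection_mem_orthogonal ξ
  have hmem' : ∀ ξ : Vec k, N.starProjection ξ ∈ N := fun ξ => N.starProjection_apply_mem ξ
  have hH1 : ∀ b, c₁ ≤ |b| → ∀ t, Set.MapsTo ((hyperbolicHomotopy M A τ).curry t)
      (sublevel S b) (sublevel S b) := fun b hb t z hz =>
    hflow b hb z.1 _ (hmem z.2) _ (hmem' z.2) (by rwa [sub_add_cancel]) _ (mul_nonneg t.2.1 hτ0)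
  -- After the flow, the straight homotopy to the disc shrinks the positive component and only
  -- rescales the negative one, so it stays in the cone, and on the low sublevel also in `‖y‖ ≥ Q`.
  have hsplit : ∀ t z, ∃ x ∈ Nᗮ, ∃ y ∈ N, ((straightHomotopy M A τ R).curry t z) = (z.1, x + y) ∧
      (S z ≤ c → ‖x‖ ≤ ε * (1 + ‖y‖)) ∧ (S z ≤ -c → Q ≤ ‖y‖) := by
    intro t z
    obtain ⟨m, ξ⟩ := z
    set x₀ := ξ - N.starProjection ξ with hx₀
    set y₀ := N.starProjection ξ with hy₀
    set ρ := (max 1 ‖y₀‖)⁻¹ with hρ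
    have hρ0 : 0 ≤ ρ := by positivity
    have ht0 : 0 ≤ 1 - (t : ℝ) := by linarith [t.2.2]
    have hty : 0 ≤ (1 - (t : ℝ)) * E + t * R * ρ :=
      add_nonneg (mul_nonneg ht0 hE0.le) (mul_nonneg (mul_nonneg t.2.1 hR0) hρ0)
    have hny : ‖((1 - (t : ℝ)) * E + t * R * ρ) • y₀‖ =
        ((1 - (t : ℝ)) * E + t * R * ρ) * ‖y₀‖ := by
      rw [norm_smul, Real.norm_of_nonneg hty]
    refine ⟨((1 - (t : ℝ)) * E⁻¹) • x₀, Submodule.smul_mem _ _ (hmem ξ),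
      ((1 - (t : ℝ)) * E + t * R * ρ) • y₀, Submodule.smul_mem _ _ (hmem' ξ), ?_, ?_, ?_⟩
    · refine Prod.ext rfl ?_
      change (1 - (t : ℝ)) • (Real.exp (-(((1 : unitInterval) : ℝ) * τ)) • x₀ +
        Real.exp (((1 : unitInterval) : ℝ) * τ) • y₀) + (t : ℝ) • R • ((ballRetract N
          (N.orthogonalProjectionOnto ξ) : N) : Vec k) = _
      have h1 : ((ballRetract N (N.orthogonalProjectionOnto ξ) : N) : Vec k) = ρ • y₀ := rfl
      rw [h1, Set.Icc.coe_one, one_mul, Real.exp_neg, hτ, Real.exp_log hE0]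
      module
    · intro hle
      have h1 := hbound m x₀ (hmem ξ) y₀ (hmem' ξ) (by rwa [hx₀, sub_add_cancel])
      rw [norm_smul, Real.norm_of_nonneg (by positivity), hny]
      have h2 : K * E⁻¹ ≤ ε := by
        rw [← div_eq_mul_inv, div_le_iff₀ hE0, mul_comm]
        exact (div_le_iff₀ hε).mp hEK
      have h3 : (1 - (t : ℝ)) * E⁻¹ * ‖x₀‖ ≤ (1 - (t : ℝ)) * E⁻¹ * (K * (1 + ‖y₀‖)) :=
        mul_le_mul_of_nonneg_left h1 (by positivity)
      have h4 : (1 - (t : ℝ)) * E⁻¹ * (K * (1 + ‖y₀‖)) ≤ (1 - (t : ℝ)) * (ε * (1 + ‖y₀‖)) := by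
        have h5 : K * E⁻¹ * (1 + ‖y₀‖) ≤ ε * (1 + ‖y₀‖) :=
          mul_le_mul_of_nonneg_right h2 (by positivity)
        calc (1 - (t : ℝ)) * E⁻¹ * (K * (1 + ‖y₀‖))
            = (1 - (t : ℝ)) * (K * E⁻¹ * (1 + ‖y₀‖)) := by ring
          _ ≤ _ := mul_le_mul_of_nonneg_left h5 ht0
      refine h3.trans (h4.trans ?_)
      have h6 : (1 - (t : ℝ)) * (1 + ‖y₀‖) ≤ 1 + ((1 - (t : ℝ)) * E + t * R * ρ) * ‖y₀‖ := by
        have h7 : (1 - (t : ℝ)) * ‖y₀‖ ≤ (1 - (t : ℝ)) * E * ‖y₀‖ := by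
          rw [mul_assoc]
          exact mul_le_mul_of_nonneg_left (le_mul_of_one_le_left (norm_nonneg _) hE1) ht0
        have h8 : 0 ≤ t * R * ρ * ‖y₀‖ :=
          mul_nonneg (mul_nonneg (mul_nonneg t.2.1 hR0) hρ0) (norm_nonneg _)
        linarith [t.2.1]
      calc (1 - (t : ℝ)) * (ε * (1 + ‖y₀‖)) = ε * ((1 - (t : ℝ)) * (1 + ‖y₀‖)) := by ring
        _ ≤ _ := mul_le_mul_of_nonneg_left h6 hε.le
    · intro hle
      have h1 : 1 ≤ ‖y₀‖ := hone m x₀ (hmem ξ) y₀ (hmem' ξ) (by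
        rw [hx₀, sub_add_cancel]
        exact hle.trans (neg_le_neg hc2))
      rw [hny, add_mul]
      have h2 : t * R * ρ * ‖y₀‖ = t * R := by
        rw [hρ, max_eq_right h1, mul_assoc, inv_mul_cancel₀ (by linarith), mul_one]
      have h3 : (1 - (t : ℝ)) * E ≤ (1 - (t : ℝ)) * E * ‖y₀‖ :=
        le_mul_of_one_le_right (mul_nonneg ht0 hE0.le) h1
      rw [h2]
      have h4 := mul_le_mul_of_nonneg_left hEQ ht0
      have h5 := mul_le_mul_of_nonneg_left hRQ t.2.1
      linarith
  have hH2 : ∀ t, Set.MapsTo ((straightHomotopy M A τ R).curry t)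
      (sublevel S c) (sublevel S c) := fun t z hz => by
    obtain ⟨x, hx, y, hy, h, h1, -⟩ := hsplit t z
    change S _ ≤ c
    rw [h]
    exact (hD _ x hx y hy (h1 hz)).trans hcD
  have hH2' : ∀ t, Set.MapsTo ((straightHomotopy M A τ R).curry t)
      (sublevel S (-c)) (sublevel S (-c)) := fun t z hz => by
    obtain ⟨x, hx, y, hy, h, h1, h2⟩ := hsplit t z
    have hzc : S z ≤ c := le_trans hz (by linarith)
    change S _ ≤ -c
    rw [h]
    exact hQ _ x hx y hy (h1 hzc) (h2 hz)
  have h1 := isCob_homotopy (hyperbolicHomotopy M A τ) u (𝓑 := {sublevel S (-c)})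
    (hH1 c hc1) hu.2 (by
      rintro _ rfl
      exact ⟨sublevel S (-c), hH1 (-c) (by rwa [abs_neg]), hu.1⟩)
  have h2 := isCob_homotopy (straightHomotopy M A τ R) u (𝓑 := {sublevel S (-c)}) hH2 hu.2 (by
      rintro _ rfl
      exact ⟨sublevel S (-c), hH2', hu.1⟩)
  have e1 : (hyperbolicHomotopy M A τ).curry 0 = ContinuousMap.id (M × Vec k) := by
    ext1 z
    exact Prod.ext rfl (by simp [hyperbolicHomotopy])
  have e2 : (straightHomotopy M A τ R).curry 0 = (hyperbolicHomotopy M A τ).curry 1 := by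
    ext1 z
    exact Prod.ext rfl (by simp [straightHomotopy])
  have e3 : (straightHomotopy M A τ R).curry 1 = (discMap M A R).comp (discRetract M A) := by
    ext1 z
    exact Prod.ext rfl (by simp [straightHomotopy])
  rw [e1] at h1
  rw [e2, e3] at h2
  have h3 := h2.add h1
  rw [sub_add_sub_cancel] at h3
  exact h3

end IsFibreQuadratic

end RetractionHomotopy

/-! ### The min-max value of a class -/

section MinMax

variable {M : Type} [TopologicalSpace M] {k m : ℕ}

theorem IsRelCocycle.pullback {X Y : Type} [TopologicalSpace X] [TopologicalSpace Y] {l : ℕ}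
    {A B : Set X} {A' B' : Set Y} {u : Cochain Y l} (hu : IsRelCocycle A' B' u) {f : C(X, Y)}
    (hA : Set.MapsTo f A A') (hB : Set.MapsTo f B B') : IsRelCocycle A B (u.pullback f) := by
  refine ⟨hu.1.pullback hB, ?_⟩
  rw [coboundary_pullback]
  exact hu.2.pullback hA

namespace IsFibreQuadratic

variable {A : Vec k →ₗ[ℝ] Vec k} {S : M × Vec k → ℝ} {G : M × Vec k → Vec k} {f : M → ℝ} {C : ℝ}

/-- If a class is represented by a cocycle vanishing on an open set `W`, if the critical values are
at least `x` off `W`, and if the restriction of the class to a set over which the critical values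
are at most `x` is non-zero, then the min-max value of the class is `x`. -/
theorem isMinMax [CompactSpace M] [Nonempty M] (hS : IsFibreQuadratic A S G f C)
    {α α' : Cochain M m} (hα : coboundary α = 0) (hα' : coboundary α' = 0)
    (hαα' : IsCob Set.univ ∅ (α - α'))
    {W K : Set M} (hW : IsOpen W) (hαW : VanishesOn W α') (hαK : ¬ IsCob K ∅ α) {x : ℝ}
    (hfW : ∀ m ∉ W, x ≤ f m) (hfK : ∀ m ∈ K, f m ≤ x) : IsMinMax A S α x := by
  obtain ⟨c₁, h1⟩ := hS.exists_mapsTo_discRetract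
  obtain ⟨c₂, h2⟩ := hS.exists_mapsTo_discMap
  obtain ⟨c₃, h3⟩ := hS.exists_isCob_pullback_discMap_comp_discRetract
  -- The margin `c₁ + 1` puts the sublevel `-c` inside the open set `S < -c₁`, and `|x| + 1` puts
  -- `x` strictly between `-c` and `c`.
  refine ⟨max (max (c₁ + 1) c₂) (max c₃ (|x| + 1)), fun c hc => ?_⟩
  have hc1 : c₁ + 1 ≤ c := ((le_max_left _ _).trans (le_max_left _ _)).trans hc
  have hc2 : c₂ ≤ c := ((le_max_right _ _).trans (le_max_left _ _)).trans hc
  have hc3 : c₃ ≤ c := ((le_max_left _ _).trans (le_max_right _ _)).trans hc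
  have hcx : |x| + 1 ≤ c := ((le_max_right _ _).trans (le_max_right _ _)).trans hc
  obtain ⟨R₂, h2⟩ := h2 c hc2
  obtain ⟨R₃, h3⟩ := h3 c hc3
  refine ⟨max (max R₂ R₃) 1, fun R hR T hT => ?_⟩
  obtain ⟨hD, hS'⟩ := h2 R (((le_max_left _ _).trans (le_max_left _ _)).trans hR)
  have h3 := h3 R (((le_max_right _ _).trans (le_max_left _ _)).trans hR)
  have hR1 : 1 ≤ R := (le_max_right _ _).trans hR
  have hΦ := h1 c (by linarith)
  have hΦA : ∀ a, Set.MapsTo (discRetract M A) (sublevel S a)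
    (Set.univ ×ˢ Metric.closedBall 0 1) := fun a z _ => discRetract_mem A z
  refine ⟨fun a ha => ?_, fun b hb => ?_⟩
  · by_contra! hax
    obtain ⟨hca, hac, u, hu, hdisc, hess⟩ := ha
    apply hess
    rw [isRelCoboundary_iff_isCob] at hdisc ⊢
    have hSac := sublevel_mono (S := S) hac
    obtain ⟨F, hF, hpush, -⟩ := hS.exists_isDescent (sub_pos.mpr hax) c
    -- A representative of the same relative class as `u`, chosen so that it vanishes over `W` and
    -- on a whole low sublevel.
    set v := (α'.cross T).pullback (discRetract M A) with hv
    have hT' : IsRelCocycle (Set.univ ×ˢ Metric.closedBall 0 1) (Set.univ ×ˢ Metric.sphere 0 1)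
        (α'.cross T) := isRelCocycle_crossAt rfl hα' hT.1
    have hvc : IsRelCocycle (sublevel S c) (sublevel S (-c)) v := hT'.pullback (hΦA c) hΦ
    have hvc1 : VanishesOn (sublevel S (-c₁)) v := hT'.1.pullback (h1 c₁ le_rfl)
    have hvW : VanishesOn (Prod.fst ⁻¹' W) v :=
      (vanishesOn_crossAt_left rfl T hαW (C := Prod.fst ⁻¹' W) fun _ hz => hz).pullback
        fun _ hz => hz
    have huv : IsCob (sublevel S c) {sublevel S (-c)} (u - v) := by
      have e1 := h3 _ u hu
      have e2 : IsCob (sublevel S c) {sublevel S (-c)}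
          ((u.pullback (discMap M A R) - α.cross T).pullback (discRetract M A)) :=
        hdisc.pullback (hΦA c) fun B hB => ⟨_, rfl, hB ▸ hΦ⟩
      have e3 : IsCob (sublevel S c) {sublevel S (-c)}
          ((crossAt rfl (α - α') T).pullback (discRetract M A)) :=
        (isCob_crossAt_left rfl hαα' hT.1).pullback (hΦA c) fun B hB => ⟨_, rfl, hB ▸ hΦ⟩
      have e4 := (e2.add e3).sub e1
      rw [crossAt_sub_left] at e4
      refine (congrArg (IsCob (sublevel S c) {sublevel S (-c)}) ?_).mp e4
      change (u.pullback ((discMap M A R).comp (discRetract M A)) -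
        (α.cross T).pullback (discRetract M A)) +
        ((α.cross T).pullback (discRetract M A) - v) -
        (u.pullback ((discMap M A R).comp (discRetract M A)) - u) = u - v
      abel
    -- On `S^a` with `a < x`, the map `F` sends every point not lying over `W` below `-c₁`. The
    -- preimages of these two regions form an open cover, on each member of which `v.pullback F`
    -- vanishes, so the small simplices theorem makes it exact.
    have hFv : IsCob (sublevel S a) {sublevel S (-c)} (v.pullback F) := by
      let O : Bool → Set (M × Vec k) := fun b =>
        cond b (F ⁻¹' {z | S z < -c₁}) (F ⁻¹' (Prod.fst ⁻¹' W))
      have hO : ∀ b, IsOpen (O b) := by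
        rintro (_ | _)
        · exact (hW.preimage continuous_fst).preimage F.continuous
        · exact (isOpen_lt hS.continuous continuous_const).preimage F.continuous
      have hcov : sublevel S a ⊆ ⋃ b, O b := fun z hz => by
        by_cases hzW : z.1 ∈ W
        · refine Set.mem_iUnion.mpr ⟨false, ?_⟩
          change (F z).1 ∈ W
          rwa [hF.fst_eq]
        · refine Set.mem_iUnion.mpr ⟨true, ?_⟩
          have e1 := hpush z (hSac hz) (by
            have := hfW _ hzW
            have : S z ≤ a := hz
            linarith)
          change S (F z) < -c₁
          linarith
      refine (isCob_of_vanishesOn_small hO hcov (u := v.pullback F) ?_ ?_).mono subset_rfl ?_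
      · rw [coboundary_pullback]
        exact hvc.2.pullback fun z hz => hF.mapsTo c (hSac hz)
      · rintro (_ | _)
        · exact hvW.pullback fun z hz => hz.2
        · exact hvc1.pullback fun z hz => (le_of_lt hz.2 : S (F z) ≤ -c₁)
      · rintro _ rfl
        refine ⟨_, ⟨true, rfl⟩, fun z hz => ⟨sublevel_mono hca hz, ?_⟩⟩
        have e1 : S (F z) ≤ -c := hF.mapsTo _ hz
        change S (F z) < -c₁
        linarith
    have e1 := hF.isCob v a (-c) (hvc.2.mono hSac) hvc.1
    have e2 := ((huv.mono hSac fun B hB => ⟨B, hB, subset_rfl⟩).sub e1).add hFv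
    rwa [sub_sub_sub_cancel_right, sub_add_cancel] at e2
  · refine le_of_forall_gt_imp_ge_of_dense fun a' ha' => ?_
    -- Every level strictly between `x` and `c` is essential; truncating at `c` keeps the level in
    -- the allowed range.
    set a := min a' c with ha
    have hxa : x < a := lt_min ha' (by linarith [le_abs_self x])
    have hac : a ≤ c := min_le_right _ _
    have hca : -c ≤ a := by linarith [neg_abs_le x]
    refine (hb (show a ∈ _ from ⟨hca, hac, ?_⟩)).trans (min_le_left _ _)
    set u := (α.cross T).pullback (discRetract M A) with hu
    have hT' : IsRelCocycle (Set.univ ×ˢ Metric.closedBall 0 1) (Set.univ ×ˢ Metric.sphere 0 1)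
        (α.cross T) := isRelCocycle_crossAt rfl hα hT.1
    have huc : IsRelCocycle (sublevel S c) (sublevel S (-c)) u := hT'.pullback (hΦA c) hΦ
    have hdisc := isCob_pullback_discRetract_comp_discMap A hR1 hT'
    refine ⟨u, huc, isRelCoboundary_iff_isCob.mpr hdisc, fun hess => hαK ?_⟩
    rw [isRelCoboundary_iff_isCob] at hess
    obtain ⟨F, hF, -, hpush⟩ := hS.exists_isDescent (sub_pos.mpr hxa) c
    refine isCob_of_isCob_cross hα hT ?_
    have hsub : K ×ˢ Metric.closedBall (0 : negSpace A) 1 ⊆ Set.univ ×ˢ Metric.closedBall 0 1 :=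
      Set.prod_mono (Set.subset_univ _) subset_rfl
    have hsub' : K ×ˢ Metric.sphere (0 : negSpace A) 1 ⊆ Set.univ ×ˢ Metric.sphere 0 1 :=
      Set.prod_mono (Set.subset_univ _) subset_rfl
    -- Over `K` the descent `F` carries the disc bundle below level `a`. If `u` were trivial there,
    -- its pull-back to the disc bundle, which is cohomologous to `α.cross T`, would be trivial over
    -- `K`, and so would `α`.
    have e1 : IsCob (K ×ˢ Metric.closedBall (0 : negSpace A) 1) {K ×ˢ Metric.sphere 0 1}
        ((u.pullback F).pullback (discMap M A R)) := by
      refine hess.pullback (A' := K ×ˢ Metric.closedBall (0 : negSpace A) 1)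
        (𝓑' := {K ×ˢ Metric.sphere 0 1}) (f := F.comp (discMap M A R)) (fun z hz => ?_)
        fun B hB => ⟨_, rfl, ?_⟩
      · have e2 := hpush _ (hD (hsub hz))
        refine e2.trans (max_le ?_ hca)
        have e3 : f z.1 ≤ x := hfK _ hz.1
        change f z.1 + (a - x) ≤ a
        linarith
      · rw [hB]
        exact fun z hz => hF.mapsTo _ (hS' (hsub' hz))
    have e2 : IsCob (K ×ˢ Metric.closedBall (0 : negSpace A) 1) {K ×ˢ Metric.sphere 0 1}
        ((u.pullback F - u).pullback (discMap M A R)) :=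
      (hF.isCob u c (-c) huc.2 huc.1).pullback (fun z hz => hD (hsub hz))
        fun B hB => ⟨_, rfl, hB ▸ fun z hz => hS' (hsub' hz)⟩
    have e3 := (e1.sub e2).sub (hdisc.mono hsub fun B hB => ⟨_, rfl, hB ▸ hsub'⟩)
    refine (congrArg (IsCob _ _) ?_).mp e3
    change (u.pullback F).pullback (discMap M A R) - ((u.pullback F).pullback (discMap M A R) -
      u.pullback (discMap M A R)) - (u.pullback (discMap M A R) - α.cross T) = α.cross T
    abel

end IsFibreQuadratic

end MinMax

/-! ### Functions which are critical along a regular level set -/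

/-- A function whose derivative vanishes along a regular level set is locally constant on it. -/
theorem eventually_eq_of_hasFDerivAt_zero {E F : Type*} [NormedAddCommGroup E] [NormedSpace ℝ E]
    [CompleteSpace E] [NormedAddCommGroup F] [NormedSpace ℝ F] [FiniteDimensional ℝ F]
    {Θ : E → F} {Θ' : E →L[ℝ] F} {a : E} (hΘ : HasStrictFDerivAt Θ Θ' a)
    (hsurj : Function.Surjective Θ') {g : E → ℝ}
    (hg : ∀ᶠ z in nhds a, Θ z = Θ a → HasFDerivAt g (0 : E →L[ℝ] ℝ) z) :
    ∀ᶠ z in nhds a, Θ z = Θ a → g z = g a := by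
  have hr : Θ'.range = ⊤ := LinearMap.range_eq_top.mpr hsurj
  set ψ := hΘ.implicitFunction Θ Θ' hr (Θ a) with hψ
  have hψ0 : ψ 0 = a := hΘ.implicitFunction_apply_image hr
  have hψs : HasStrictFDerivAt ψ Θ'.ker.subtypeL 0 := hΘ.to_implicitFunction hr
  -- Strict differentiability at one point makes the parametrization of the level set Lipschitz
  -- nearby. This is enough for `g ∘ ψ` to have zero derivative at nearby points too, since `g` has
  -- zero derivative along the level set.
  obtain ⟨K, s, hs, hK⟩ := hψs.exists_lipschitzOnWith
  have h1 : ∀ᶠ y in nhds (0 : Θ'.ker), Θ (ψ y) = Θ a := by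
    have h2 : Filter.Tendsto (fun y : Θ'.ker => (Θ a, y)) (nhds 0) (nhds (Θ a, 0)) :=
      Continuous.tendsto (by fun_prop) 0
    exact h2.eventually (hΘ.map_implicitFunction_eq hr)
  have h2 : ∀ᶠ y in nhds (0 : Θ'.ker), Θ (ψ y) = Θ a → HasFDerivAt g (0 : E →L[ℝ] ℝ) (ψ y) := by
    have h3 : Filter.Tendsto ψ (nhds 0) (nhds a) := hψ0 ▸ hψs.continuousAt
    exact h3.eventually hg
  obtain ⟨r, hr0, hball⟩ := Metric.eventually_nhds_iff_ball.mp (h1.and (h2.and hs))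
  have hd : ∀ y ∈ Metric.ball (0 : Θ'.ker) r,
      HasFDerivAt (fun y => g (ψ y)) (0 : Θ'.ker →L[ℝ] ℝ) y := by
    intro y hy
    obtain ⟨h3, h4, h5⟩ := hball y hy
    have h6 : ∀ᶠ y' in nhds y, y' ∈ s :=
      (Metric.isOpen_ball.eventually_mem hy).mono fun y' hy' => (hball y' hy').2.2
    have h7 : (fun y' => ψ y' - ψ y) =O[nhds y] fun y' => y' - y := by
      refine Asymptotics.IsBigO.of_bound K (h6.mono fun y' hy' => ?_)
      rw [← dist_eq_norm, ← dist_eq_norm]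
      exact hK.dist_le_mul _ hy' _ h5
    have h8 : Filter.Tendsto ψ (nhds y) (nhds (ψ y)) := by
      have h9 : ContinuousWithinAt ψ s y := hK.continuousOn y h5
      exact h9.continuousAt h6
    have h10 := (h4 h3).isLittleO.comp_tendsto h8
    rw [hasFDerivAt_iff_isLittleO]
    simpa using! h10.trans_isBigO h7
  have hconst : ∀ y ∈ Metric.ball (0 : Θ'.ker) r, g (ψ y) = g a := fun y hy => by
    have h3 := Metric.isOpen_ball.is_const_of_fderiv_eq_zero (𝕜 := ℝ)
      (convex_ball (0 : Θ'.ker) r).isPreconnected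
      (fun y hy => (hd y hy).differentiableAt.differentiableWithinAt)
      (fun y hy => (hd y hy).fderiv) hy (Metric.mem_ball_self hr0)
    rwa [hψ0] at h3
  have h3 : ∀ᶠ z in nhds a,
      (hΘ.implicitToOpenPartialHomeomorph Θ Θ' hr z).2 ∈ Metric.ball (0 : Θ'.ker) r := by
    have h4 := (hΘ.implicitToOpenPartialHomeomorph Θ Θ' hr).continuousAt
      (hΘ.mem_implicitToOpenPartialHomeomorph_source hr)
    have h5 : Filter.Tendsto (fun z => (hΘ.implicitToOpenPartialHomeomorph Θ Θ' hr z).2) (nhds a)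
        (nhds 0) := by
      have h6 := (continuous_snd.tendsto _).comp h4
      rwa [hΘ.implicitToOpenPartialHomeomorph_self hr] at h6
    exact h5.eventually (Metric.ball_mem_nhds 0 hr0)
  filter_upwards [h3, hΘ.eq_implicitFunction hr] with z hz1 hz2 hz3
  rw [hz3] at hz2
  rw [← hz2]
  exact hconst _ hz1

/-! ### The parametrizations of `T^n × S^n` -/

section Param

variable {n : ℕ}

theorem toTorus_add (x y : Vec n) : toTorus (x + y) = toTorus x + toTorus y := rfl

theorem toTorus_surjective : Function.Surjective (toTorus (n := n)) := fun θ => by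
  choose x hx using fun i => QuotientAddGroup.mk_surjective (θ i)
  exact ⟨WithLp.toLp 2 x, funext hx⟩

theorem isOpenMap_toTorus : IsOpenMap (toTorus (n := n)) := by
  have h1 : IsOpenMap fun (x : Fin n → ℝ) i => (x i : UnitAddCircle) :=
    IsOpenMap.piMap (fun _ => QuotientAddGroup.isOpenMap_coe)
      (Filter.Eventually.of_forall fun _ => QuotientAddGroup.mk_surjective)
  exact h1.comp (EuclideanSpace.equiv (Fin n) ℝ).toHomeomorph.isOpenMap

theorem continuous_toTorus : Continuous (toTorus (n := n)) :=
  continuous_pi fun i => (AddCircle.continuous_mk' 1).comp (by fun_prop)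

theorem isOpenMap_stereoInv (s : Sph n) : IsOpenMap (stereoInv s) := fun U hU => by
  have h := (stereo s).isOpen_image_symm_of_subset_target hU (by rw [stereo_target]; exact U.subset_univ)
  rwa [stereo_symm_eq] at h

theorem continuous_stereoInv (s : Sph n) : Continuous (stereoInv s) := by
  rw [← continuousOn_univ, ← stereo_target s, ← stereo_symm_eq]
  exact (stereo s).continuousOn_symm

theorem stereoInv_stereo {s p : Sph n} (h : p ≠ s) : stereoInv s (stereo s p) = p :=
  (stereo s).left_inv (by rwa [stereo_source])

theorem stereo_stereoInv (s : Sph n) (y : Vec n) : stereo s (stereoInv s y) = y :=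
  (stereo s).right_inv (by rw [stereo_target]; trivial)

theorem stereoInv_ne (s : Sph n) (y : Vec n) : stereoInv s y ≠ s := by
  have h := (stereo s).map_target (x := y) (by rw [stereo_target]; trivial)
  rwa [stereo_source] at h

theorem contDiffAt_stereo_stereoInv {s s' : Sph n} {y : Vec n} (h : stereoInv s y ≠ s') :
    ContDiffAt ℝ ∞ (fun y => stereo s' (stereoInv s y)) y := by
  have := Fact.mk (@finrank_euclideanSpace_fin ℝ _ (n + 1))
  have h1 := (contDiffGroupoid (∞ : ℕ∞ω) (modelWithCornersSelf ℝ (Vec n))).compatible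
    (show stereo s ∈ atlas (Vec n) (Sph n) from ⟨s, rfl⟩)
    (show stereo s' ∈ atlas (Vec n) (Sph n) from ⟨s', rfl⟩)
  rw [contDiffGroupoid, mem_groupoid_of_pregroupoid] at h1
  have h2 : ContDiffOn ℝ ∞ (fun y => stereo s' (stereoInv s y))
      ((stereo s).symm.trans (stereo s')).source := by
    simpa [contDiffPregroupoid] using! h1.1
  refine h2.contDiffAt (((stereo s).symm.trans (stereo s')).open_source.mem_nhds ?_)
  rw [OpenPartialHomeomorph.trans_source, stereo_source]
  exact ⟨by simp [stereo_target], h⟩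

theorem continuous_param (b : Bool) : Continuous (param (n := n) b) := by
  cases b
  · exact (continuous_toTorus.comp continuous_fst).prodMk
      ((continuous_stereoInv _).comp continuous_snd)
  · exact (continuous_toTorus.comp continuous_fst).prodMk
      ((continuous_stereoInv _).comp continuous_snd)

theorem isOpenMap_param (b : Bool) : IsOpenMap (param (n := n) b) := by
  cases b
  · exact isOpenMap_toTorus.prodMap (isOpenMap_stereoInv _)
  · exact isOpenMap_toTorus.prodMap (isOpenMap_stereoInv _)

theorem exists_param_false {m : Base n} (hm : m.2 ≠ infPt n) : ∃ w, m = param false w := by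
  obtain ⟨x, hx⟩ := toTorus_surjective m.1
  exact ⟨(x, stereo (infPt n) m.2), Prod.ext hx.symm (stereoInv_stereo hm).symm⟩

theorem param_true_zero (x : Vec n) : param true (x, 0) = (toTorus x, infPt n) :=
  Prod.ext rfl ((stereoInv_zero _).trans (neg_neg _))

/-- Every point is in the first chart or at infinity. -/
theorem param_cases (m : Base n) : (∃ x y, m = param false (x, y)) ∨ ∃ x, m = param true (x, 0) := by
  by_cases hm : m.2 = infPt n
  · obtain ⟨x, hx⟩ := toTorus_surjective m.1
    exact Or.inr ⟨x, by rw [param_true_zero, hx, ← hm]⟩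
  · obtain ⟨w, hw⟩ := exists_param_false hm
    exact Or.inl ⟨w.1, w.2, hw⟩

theorem exists_param (m : Base n) : ∃ b w, m = param b w := by
  obtain ⟨x, y, h⟩ | ⟨x, h⟩ := param_cases m
  · exact ⟨_, _, h⟩
  · exact ⟨_, _, h⟩

/-- Continuity can be checked in the two charts. -/
theorem continuous_of_comp_param {k : ℕ} {Y : Type*} [TopologicalSpace Y] {F : Base n × Vec k → Y}
    (h : ∀ b, Continuous fun z : (Vec n × Vec n) × Vec k => F (param b z.1, z.2)) :
    Continuous F := by
  refine continuous_iff_continuousAt.mpr fun z => ?_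
  obtain ⟨m, v⟩ := z
  obtain ⟨b, w, rfl⟩ := exists_param m
  have h1 : IsOpenMap (Prod.map (param b) id : (Vec n × Vec n) × Vec k → Base n × Vec k) :=
    (isOpenMap_param b).prodMap IsOpenMap.id
  have h2 := h1.nhds_le (w, v)
  exact (Filter.tendsto_map'_iff.mpr ((h b).tendsto (w, v))).mono_left h2

end Param

/-! ### Integrable Hamiltonians as functions on `T^n × S^n` -/

section BaseExt

variable {n : ℕ}

/-- The function on `T^n × S^n` defined by a function of the momentum, extended by zero at
infinity. -/
def baseExt (h : Vec n → ℝ) (m : Base n) : ℝ := Function.extend (stereoInv (infPt n)) h 0 m.2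

theorem stereoInv_injective (s : Sph n) : Function.Injective (stereoInv s) := fun y y' hy => by
  rw [← stereo_stereoInv s y, hy, stereo_stereoInv]

theorem baseExt_param_false (h : Vec n → ℝ) (w : Vec n × Vec n) :
    baseExt h (param false w) = h w.2 :=
  (stereoInv_injective (infPt n)).extend_apply _ _ _

theorem baseExt_infPt (h : Vec n → ℝ) (θ : Torus n) : baseExt h (θ, infPt n) = 0 :=
  Function.extend_apply' _ _ _ fun ⟨y, hy⟩ => stereoInv_ne _ y hy

theorem baseExt_eq_zero {h : Vec n → ℝ} {m : Base n}
    (hm : m.2 ∉ stereoInv (infPt n) '' tsupport h) : baseExt h m = 0 := by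
  by_cases h1 : ∃ y, stereoInv (infPt n) y = m.2
  · obtain ⟨y, hy⟩ := h1
    rw [baseExt, ← hy, (stereoInv_injective (infPt n)).extend_apply]
    exact image_eq_zero_of_notMem_tsupport fun hy' => hm ⟨y, hy', hy⟩
  · exact Function.extend_apply' _ _ _ h1

variable {h : Vec n → ℝ}

theorem isClosed_stereoInv_image_tsupport (hsupp : HasCompactSupport h) :
    IsClosed (stereoInv (infPt n) '' tsupport h) :=
  (hsupp.isCompact.image (continuous_stereoInv _)).isClosed

theorem eventually_notMem_tsupport (hsupp : HasCompactSupport h) {w : Vec n × Vec n}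
    (hw : (param true w).2 ∉ stereoInv (infPt n) '' tsupport h) :
    ∀ᶠ w' in nhds w, (param true w').2 ∉ stereoInv (infPt n) '' tsupport h :=
  (continuous_snd.comp (continuous_param true)).continuousAt.eventually_mem
    ((isClosed_stereoInv_image_tsupport hsupp).isOpen_compl.mem_nhds hw)

/-- The change of charts. -/
def chartChange (w : Vec n × Vec n) : Vec n × Vec n :=
  (w.1, stereo (infPt n) (stereoInv (-infPt n) w.2))

theorem param_false_chartChange {w : Vec n × Vec n} (hw : (param true w).2 ≠ infPt n) :
    param false (chartChange w) = param true w :=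
  Prod.ext rfl (stereoInv_stereo hw)

theorem contDiffAt_chartChange {w : Vec n × Vec n} (hw : (param true w).2 ≠ infPt n) :
    ContDiffAt ℝ ∞ chartChange w :=
  contDiffAt_fst.prodMk ((contDiffAt_stereo_stereoInv hw).comp w contDiffAt_snd)

theorem eventually_ne_infPt {w : Vec n × Vec n} (hw : (param true w).2 ≠ infPt n) :
    ∀ᶠ w' in nhds w, (param true w').2 ≠ infPt n :=
  (continuous_snd.comp (continuous_param true)).continuousAt.eventually_ne hw

/-- In the chart at infinity, points of the image of the support are finite, and the change of
charts is smooth there. All other points have a neighbourhood on which the extension vanishes, the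
image of the support being closed. -/
theorem contDiff_baseExt_param (hsmooth : ContDiff ℝ ∞ h) (hsupp : HasCompactSupport h) (b : Bool) :
    ContDiff ℝ ∞ fun w => baseExt h (param b w) := by
  cases b
  · simp only [baseExt_param_false]
    exact hsmooth.comp contDiff_snd
  · refine contDiff_iff_contDiffAt.mpr fun w => ?_
    by_cases hw : (param true w).2 ∈ stereoInv (infPt n) '' tsupport h
    · have hne : (param true w).2 ≠ infPt n := by
        obtain ⟨y, -, hy⟩ := hw
        rw [← hy]
        exact stereoInv_ne _ y
      have h1 : ContDiffAt ℝ ∞ (fun w => h (chartChange w).2) w :=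
        hsmooth.contDiffAt.comp w (contDiffAt_snd.comp w (contDiffAt_chartChange hne))
      refine h1.congr_of_eventuallyEq ((eventually_ne_infPt hne).mono fun w' hw' => ?_)
      simp only
      rw [← param_false_chartChange hw', baseExt_param_false]
    · refine (contDiffAt_const (c := (0 : ℝ))).congr_of_eventuallyEq
        ((eventually_notMem_tsupport hsupp hw).mono fun w' hw' => baseExt_eq_zero hw')

theorem continuous_baseExt (hsmooth : ContDiff ℝ ∞ h) (hsupp : HasCompactSupport h) :
    Continuous (baseExt h) := by
  have h1 : Continuous fun z : Base n × Vec 0 => baseExt h z.1 :=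
    continuous_of_comp_param fun b =>
      (contDiff_baseExt_param hsmooth hsupp b).continuous.comp continuous_fst
  exact h1.comp (Continuous.prodMk continuous_id (continuous_const (y := (0 : Vec 0))))

theorem exists_notMem_tsupport (hn : 1 ≤ n) (hsupp : HasCompactSupport h) : ∃ y, y ∉ tsupport h := by
  have : Nonempty (Fin n) := ⟨⟨0, hn⟩⟩
  by_contra! hc
  exact noncompact_univ (Vec n) (Set.eq_univ_of_forall hc ▸ hsupp.isCompact)

/-- The value `0` at infinity is already taken by `h`, because `ℝ^n` is not compact for `n ≥ 1`. -/
theorem range_baseExt (hn : 1 ≤ n) (hsupp : HasCompactSupport h) :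
    Set.range (baseExt h) = Set.range h := by
  apply Set.Subset.antisymm
  · rintro _ ⟨m, rfl⟩
    by_cases hm : m.2 = infPt n
    · obtain ⟨y, hy⟩ := exists_notMem_tsupport hn hsupp
      refine ⟨y, ?_⟩
      have h1 : m = (m.1, infPt n) := Prod.ext rfl hm
      rw [image_eq_zero_of_notMem_tsupport hy, h1, baseExt_infPt]
    · obtain ⟨w, rfl⟩ := exists_param_false hm
      exact ⟨w.2, (baseExt_param_false h w).symm⟩
  · rintro _ ⟨y, rfl⟩
    exact ⟨param false (0, y), baseExt_param_false h (0, y)⟩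

theorem gradient_eq_zero_of_notMem_tsupport {y : Vec n} (hy : y ∉ tsupport h) :
    gradient h y = 0 := by
  have h1 : h =ᶠ[nhds y] fun _ => 0 := notMem_tsupport_iff_eventuallyEq.mp hy
  rw [gradient, h1.fderiv_eq]
  simp

theorem preconnectedSpace_base (hn : 1 ≤ n) : PreconnectedSpace (Base n) := by
  have h1 : 1 < Module.rank ℝ (Vec (n + 1)) := by
    rw [rank_eq_card_basis (EuclideanSpace.basisFun (Fin (n + 1)) ℝ).toBasis, Fintype.card_fin]
    exact_mod_cast (by lia : 1 < n + 1)
  have : PreconnectedSpace (Sph n) :=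
    isPreconnected_iff_preconnectedSpace.mp (isPreconnected_sphere h1 0 1)
  infer_instance

end BaseExt

/-! ### The flow of an integrable Hamiltonian -/

section Flow

variable {n : ℕ} {h : Vec n → ℝ}

theorem IsHamiltonianFlow.apply_one {φ : ℝ → CotTorus n → CotTorus n}
    (hφ : IsHamiltonianFlow (fun z : CotTorus n => h z.2) φ) (x p : Vec n) :
    φ 1 (toTorus x, p) = (toTorus (x + gradient h p), p) := by
  obtain ⟨X, P, hX0, hP0, hX, hP, hφ⟩ := hφ x p
  have h1 : ∀ t, HasDerivAt P 0 t := fun t => by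
    have h2 := hP t
    simp only [gradient_fun_const', neg_zero] at h2
    exact h2
  have hPc : ∀ t, P t = p := fun t => by
    rw [← hP0]
    exact is_const_of_deriv_eq_zero (fun t => (h1 t).differentiableAt) (fun t => (h1 t).deriv) t 0
  have h2 : ∀ t, HasDerivAt (fun t => X t - t • gradient h p) 0 t := fun t => by
    have h3 := (hX t).sub ((hasDerivAt_id t).smul_const (gradient h p))
    simp only [hPc, one_smul] at h3
    simpa using! h3
  have h3 := is_const_of_deriv_eq_zero (fun t => (h2 t).differentiableAt) (fun t => (h2 t).deriv) 1 0
  simp only [one_smul, zero_smul, sub_zero, hX0] at h3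
  rw [hφ 1, hPc, ← h3, sub_add_cancel]

theorem exists_int_of_toTorus_eq_zero {x : Vec n} (hx : toTorus x = 0) (i : Fin n) :
    ∃ j : ℤ, (j : ℝ) = x i := by
  have h1 : ((x i : ℝ) : UnitAddCircle) = 0 := congrFun hx i
  obtain ⟨j, hj⟩ := (AddCircle.coe_eq_zero_iff 1).mp h1
  exact ⟨j, by simpa using hj⟩

/-- A continuous determination of zero with compact support vanishes. -/
theorem eq_zero_of_toTorus_eq_zero (hn : 1 ≤ n) {D : CotTorus n → Vec n} (hD : Continuous D)
    (hsupp : HasCompactSupport D) (h0 : ∀ z, toTorus (D z) = 0) (z : CotTorus n) : D z = 0 := by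
  have : Nonempty (Fin n) := ⟨⟨0, hn⟩⟩
  obtain ⟨z', hz'⟩ : ∃ z', z' ∉ tsupport D := by
    by_contra! hc
    exact noncompact_univ (CotTorus n) (Set.eq_univ_of_forall hc ▸ hsupp.isCompact)
  ext i
  have h1 : IsDiscrete (Set.range ((↑) : ℤ → ℝ)) :=
    Int.isClosedEmbedding_coe_real.isInducing.isDiscrete_range
  have h2 := isPreconnected_univ.constant_of_mapsTo h1 (f := fun z => D z i)
    (Continuous.continuousOn (by fun_prop)) (fun z _ => exists_int_of_toTorus_eq_zero (h0 z) i)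
    (Set.mem_univ z) (Set.mem_univ z')
  simp only at h2
  rw [h2, image_eq_zero_of_notMem_tsupport hz']

theorem continuous_gradient (hsmooth : ContDiff ℝ ∞ h) : Continuous (gradient h) :=
  (InnerProductSpace.toDual ℝ (Vec n)).symm.continuous.comp (hsmooth.continuous_fderiv (by simp))

/-- Two determinations differ by a continuous function with integer coordinates and compact support,
which is zero. -/
theorem isDisplacement_iff (hn : 1 ≤ n) (hsmooth : ContDiff ℝ ∞ h) (hsupp : HasCompactSupport h)
    {φ : ℝ → CotTorus n → CotTorus n}
    (hφ : IsHamiltonianFlow (fun z : CotTorus n => h z.2) φ) (D : CotTorus n → Vec n) :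
    IsDisplacement (φ 1) D ↔ D = fun z => gradient h z.2 := by
  have hφ' : ∀ z : CotTorus n, (φ 1 z).1 = z.1 + toTorus (gradient h z.2) := fun z => by
    obtain ⟨x, hx⟩ := toTorus_surjective z.1
    have h1 : z = (toTorus x, z.2) := Prod.ext hx.symm rfl
    rw [h1, hφ.apply_one, toTorus_add]
  have hgc : Continuous fun z : CotTorus n => gradient h z.2 :=
    (continuous_gradient hsmooth).comp continuous_snd
  have hgs : HasCompactSupport fun z : CotTorus n => gradient h z.2 := by
    refine HasCompactSupport.intro (K := Set.univ ×ˢ tsupport h)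
      (isCompact_univ.prod hsupp.isCompact) fun z hz => ?_
    exact gradient_eq_zero_of_notMem_tsupport fun h1 => hz ⟨trivial, h1⟩
  constructor
  · rintro ⟨hDc, hDs, hD⟩
    funext z
    refine sub_eq_zero.mp (eq_zero_of_toTorus_eq_zero hn (D := fun z => D z - gradient h z.2)
      (hDc.sub hgc) (hDs.sub hgs) (fun z => ?_) z)
    have h1 := (hD z).symm.trans (hφ' z)
    rw [sub_eq_add_neg, toTorus_add]
    have h2 := add_left_cancel h1
    rw [h2, ← toTorus_add, add_neg_cancel]
    rfl
  · rintro rfl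
    exact ⟨hgc, hgs, hφ'⟩

/-- The lifted graph of the flow of an integrable Hamiltonian is the graph of its differential. -/
theorem mem_graphLift_iff (hn : 1 ≤ n) (hsmooth : ContDiff ℝ ∞ h) (hsupp : HasCompactSupport h)
    {φ : ℝ → CotTorus n → CotTorus n}
    (hφ : IsHamiltonianFlow (fun z : CotTorus n => h z.2) φ) (x y ξ η : Vec n) :
    ((toTorus x, y), (ξ, η)) ∈ graphLift (φ 1) ↔ ξ = 0 ∧ η = gradient h y := by
  have hφ2 : ∀ z : CotTorus n, (φ 1 z).2 = z.2 := fun z => by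
    obtain ⟨x, hx⟩ := toTorus_surjective z.1
    have h1 : z = (toTorus x, z.2) := Prod.ext hx.symm rfl
    rw [h1, hφ.apply_one]
  have hhalf : ∀ p : Vec n, (1 / 2 : ℝ) • (p + p) = p := fun p => by module
  constructor
  · rintro ⟨D, hD, z, hz⟩
    obtain rfl := (isDisplacement_iff hn hsmooth hsupp hφ D).mp hD
    simp only [hφ2, sub_self, hhalf, Prod.mk.injEq] at hz
    obtain ⟨⟨-, rfl⟩, h1, h2⟩ := hz
    exact ⟨h1, h2⟩
  · rintro ⟨rfl, rfl⟩
    refine ⟨_, (isDisplacement_iff hn hsmooth hsupp hφ _).mpr rfl,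
      -- The point `x` is the midpoint of `q` and `Q = q + gradient h y`.
      (toTorus (x - (1 / 2 : ℝ) • gradient h y), y), ?_⟩
    simp only [hφ2, sub_self, hhalf]
    rw [← toTorus_add, sub_add_cancel]

end Flow

/-- The fibre critical points over points near `m₀` are near the one over `m₀`. -/
theorem IsQuadraticAtInfty.eventually_forall_mem {M : Type} [TopologicalSpace M] [CompactSpace M]
    [T2Space M] {k : ℕ} {A : Vec k →ₗ[ℝ] Vec k} {S : M × Vec k → ℝ} {G : M × Vec k → Vec k} {C : ℝ}
    (hS : IsQuadraticAtInfty A S G C) {m₀ : M} {v₀ : Vec k} (huniq : ∀ v, G (m₀, v) = 0 → v = v₀)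
    {U : Set (M × Vec k)} (hU : U ∈ nhds (m₀, v₀)) :
    ∀ᶠ m in nhds m₀, ∀ v, G (m, v) = 0 → (m, v) ∈ U := by
  obtain ⟨Q, hQ, hGQ⟩ := hS.exists_isCompact 0
  have hcl : IsClosed ({z | G z = 0} ∩ (interior U)ᶜ) :=
    (isClosed_eq hS.continuous_grad continuous_const).inter isOpen_interior.isClosed_compl
  have h1 : IsClosed (Prod.fst '' (Q ∩ ({z | G z = 0} ∩ (interior U)ᶜ))) :=
    ((hQ.inter_right hcl).image continuous_fst).isClosed
  have h2 : m₀ ∉ Prod.fst '' (Q ∩ ({z | G z = 0} ∩ (interior U)ᶜ)) := by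
    rintro ⟨⟨m, v⟩, ⟨-, hz0, hzU⟩, rfl⟩
    obtain rfl := huniq v hz0
    exact hzU (mem_interior_iff_mem_nhds.mpr hU)
  filter_upwards [h1.isOpen_compl.mem_nhds h2] with m hm v hv
  by_contra hc
  exact hm ⟨(m, v), ⟨hGQ _ (by rw [hv, norm_zero]), hv, fun h3 => hc (interior_subset h3)⟩, rfl⟩

/-! ### Generating functions of the graph of `dh` -/

namespace IsGFQI

variable {n k : ℕ} {A : Vec k →ₗ[ℝ] Vec k} {S : Base n × Vec k → ℝ}
  {L : Set ((Torus n × Vec n) × (Vec n × Vec n))}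

/-- The fibre gradient. -/
def fibreGrad (S : Base n × Vec k → ℝ) (z : Base n × Vec k) : Vec k :=
  gradient (fun w => S (z.1, w)) z.2

theorem fibreGrad_param (b : Bool) (z : (Vec n × Vec n) × Vec k) :
    fibreGrad S (param b z.1, z.2) =
      (InnerProductSpace.toDual ℝ (Vec k)).symm (fibreDeriv S b z) := rfl

theorem fibreGrad_param_eq_zero_iff {b : Bool} {w : Vec n × Vec n} {v : Vec k} :
    fibreGrad S (param b w, v) = 0 ↔ fibreDeriv S b (w, v) = 0 := by
  rw [fibreGrad_param b (w, v), LinearIsometryEquiv.map_eq_zero_iff]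

theorem hasFDerivAt_localExpr (hS : IsGFQI A S L) (b : Bool) (z : (Vec n × Vec n) × Vec k) :
    HasFDerivAt (localExpr S b) (fderiv ℝ (localExpr S b) z) z :=
  ((hS.smooth b).differentiable (by simp) z).hasFDerivAt

theorem hasFDerivAt_localExpr_fibre (hS : IsGFQI A S L) (b : Bool) (w : Vec n × Vec n)
    (v : Vec k) : HasFDerivAt (fun v => localExpr S b (w, v))
      ((fderiv ℝ (localExpr S b) (w, v)).comp
        (ContinuousLinearMap.inr ℝ (Vec n × Vec n) (Vec k))) v :=
  HasFDerivAt.comp (g := localExpr S b) (f := fun v => (w, v)) v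
    (hS.hasFDerivAt_localExpr b (w, v)) (hasFDerivAt_prodMk_right w v)

theorem hasFDerivAt_localExpr_base (hS : IsGFQI A S L) (b : Bool) (w : Vec n × Vec n)
    (v : Vec k) : HasFDerivAt (fun w => localExpr S b (w, v))
      ((fderiv ℝ (localExpr S b) (w, v)).comp
        (ContinuousLinearMap.inl ℝ (Vec n × Vec n) (Vec k))) w :=
  HasFDerivAt.comp (g := localExpr S b) (f := fun w => (w, v)) w
    (hS.hasFDerivAt_localExpr b (w, v)) (hasFDerivAt_prodMk_left w v)

theorem fibreDeriv_eq (hS : IsGFQI A S L) (b : Bool) (z : (Vec n × Vec n) × Vec k) :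
    fibreDeriv S b z = (fderiv ℝ (localExpr S b) z).comp
      (ContinuousLinearMap.inr ℝ (Vec n × Vec n) (Vec k)) :=
  (hS.hasFDerivAt_localExpr_fibre b z.1 z.2).fderiv

theorem baseDeriv_eq (hS : IsGFQI A S L) (b : Bool) (z : (Vec n × Vec n) × Vec k) :
    baseDeriv S b z = (fderiv ℝ (localExpr S b) z).comp
      (ContinuousLinearMap.inl ℝ (Vec n × Vec n) (Vec k)) :=
  (hS.hasFDerivAt_localExpr_base b z.1 z.2).fderiv

theorem fderiv_localExpr_eq (hS : IsGFQI A S L) {b : Bool} {z : (Vec n × Vec n) × Vec k}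
    (hz : fibreDeriv S b z = 0) :
    fderiv ℝ (localExpr S b) z =
      (baseDeriv S b z).comp (ContinuousLinearMap.fst ℝ (Vec n × Vec n) (Vec k)) := by
  rw [hS.fibreDeriv_eq] at hz
  rw [hS.baseDeriv_eq]
  ext1
  · ext a <;> simp
  · rw [hz]
    exact ContinuousLinearMap.ext fun a => (map_zero (fderiv ℝ (localExpr S b) z)).symm

theorem contDiff_fibreDeriv (hS : IsGFQI A S L) (b : Bool) : ContDiff ℝ ∞ (fibreDeriv S b) := by
  have h1 : fibreDeriv S b = fun z => (fderiv ℝ (localExpr S b) z).comp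
      (ContinuousLinearMap.inr ℝ (Vec n × Vec n) (Vec k)) := funext (hS.fibreDeriv_eq b)
  rw [h1]
  exact ((hS.smooth b).fderiv_right (m := ∞) (by simp)).clm_comp contDiff_const

theorem exists_isQuadraticAtInfty (hS : IsGFQI A S L) :
    ∃ C, IsQuadraticAtInfty A S (fibreGrad S) C := by
  obtain ⟨C, hC⟩ := hS.quadratic
  refine ⟨C, hS.symm, hS.nondegenerate, continuous_of_comp_param fun b => (hS.smooth b).continuous,
    continuous_of_comp_param fun b => ?_, fun m v => ?_, fun z => ?_⟩
  · simp only [fibreGrad_param]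
    exact (LinearIsometryEquiv.continuous _).comp (hS.contDiff_fibreDeriv b).continuous
  · obtain ⟨b, w, rfl⟩ := exists_param m
    exact (hS.hasFDerivAt_localExpr_fibre b w v).differentiableAt.hasGradientAt
  · have h1 := hC z.1 z.2
    have h2 := (hasGradientAt_inner_apply hS.symm z.2).hasFDerivAt.fderiv
    rw [h2, ← LinearIsometryEquiv.norm_map (InnerProductSpace.toDual ℝ (Vec k)).symm, map_sub,
      LinearIsometryEquiv.symm_apply_apply] at h1
    exact h1

variable {h : Vec n → ℝ}

/-- A fibre critical point produces a covector of `L` over its base point, and `L` contains only one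
such covector. -/
theorem baseDeriv_false (hS : IsGFQI A S L)
    (hL : ∀ x y ξ η : Vec n, ((toTorus x, y), (ξ, η)) ∈ L ↔ ξ = 0 ∧ η = gradient h y)
    {z : (Vec n × Vec n) × Vec k} (hz : fibreDeriv S false z = 0) (a : Vec n × Vec n) :
    baseDeriv S false z a = inner ℝ (gradient h z.1.2) a.2 := by
  set β := baseDeriv S false z with hβ
  set ξ := (InnerProductSpace.toDual ℝ (Vec n)).symm
    (β.comp (ContinuousLinearMap.inl ℝ (Vec n) (Vec n))) with hξ
  set η := (InnerProductSpace.toDual ℝ (Vec n)).symm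
    (β.comp (ContinuousLinearMap.inr ℝ (Vec n) (Vec n))) with hη
  have h1 : ∀ a b, β (a, b) = inner ℝ ξ a + inner ℝ η b := fun a b => by
    rw [hξ, hη, InnerProductSpace.toDual_symm_apply, InnerProductSpace.toDual_symm_apply]
    simp [← map_add]
  obtain ⟨hξ0, hη0⟩ := (hL z.1.1 z.1.2 ξ η).mp ((hS.generates _ _ _ _).mpr ⟨z.2, hz, h1⟩)
  have h2 := h1 a.1 a.2
  rw [hξ0, hη0, inner_zero_left, zero_add] at h2
  exact h2

/-- The Lagrangian is a section of the cotangent bundle. It meets every fibre, which gives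
existence; the covector is determined by the base point, so the injectivity of `(m; ξ) ↦ (m, ∂S/∂m)`
gives uniqueness. -/
theorem existsUnique_crit (hS : IsGFQI A S L)
    (hL : ∀ x y ξ η : Vec n, ((toTorus x, y), (ξ, η)) ∈ L ↔ ξ = 0 ∧ η = gradient h y)
    (m : Base n) : ∃! v, fibreGrad S (m, v) = 0 := by
  obtain ⟨x, y, rfl⟩ | ⟨x, rfl⟩ := param_cases m
  · obtain ⟨v, hv, -⟩ := (hS.generates x y 0 (gradient h y)).mp ((hL _ _ _ _).mpr ⟨rfl, rfl⟩)
    refine ⟨v, fibreGrad_param_eq_zero_iff.mpr hv, fun v' hv' => ?_⟩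
    have hv' := fibreGrad_param_eq_zero_iff.mp hv'
    exact hS.injective false (x, y) v' v hv' hv (ContinuousLinearMap.ext fun a => by
      rw [hS.baseDeriv_false hL hv', hS.baseDeriv_false hL hv])
  · obtain ⟨v, hv, hv0⟩ := (hS.generates_infty x 0).mp rfl
    refine ⟨v, fibreGrad_param_eq_zero_iff.mpr hv, fun v' hv' => ?_⟩
    have hv' := fibreGrad_param_eq_zero_iff.mp hv'
    refine hS.injective true (x, 0) v' v hv' hv ?_
    rw [hv0]
    exact (hS.generates_infty x _).mpr ⟨v', hv', rfl⟩

/-- Near infinity, the base derivative vanishes at the fibre critical points. -/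
theorem baseDeriv_true (hS : IsGFQI A S L)
    (hL : ∀ x y ξ η : Vec n, ((toTorus x, y), (ξ, η)) ∈ L ↔ ξ = 0 ∧ η = gradient h y)
    {z : (Vec n × Vec n) × Vec k} (hz : fibreDeriv S true z = 0)
    (hsupp : (param true z.1).2 ∉ stereoInv (infPt n) '' tsupport h) : baseDeriv S true z = 0 := by
  obtain ⟨w, v⟩ := z
  by_cases hw : (param true w).2 = infPt n
  · have h1 : w = (w.1, 0) := by
      refine Prod.ext rfl (stereoInv_injective (-infPt n) ?_)
      rw [stereoInv_zero, neg_neg]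
      exact hw
    rw [h1] at hz ⊢
    exact (hS.generates_infty w.1 _).mpr ⟨v, hz, rfl⟩
  · have hz' : fibreDeriv S false (chartChange w, v) = 0 := by
      rw [← fibreGrad_param_eq_zero_iff] at hz ⊢
      rwa [param_false_chartChange hw]
    have h1 : baseDeriv S false (chartChange w, v) = 0 := ContinuousLinearMap.ext fun a => by
      rw [hS.baseDeriv_false hL hz', gradient_eq_zero_of_notMem_tsupport, inner_zero_left]
      · rfl
      · refine fun h2 => hsupp ⟨_, h2, ?_⟩
        exact stereoInv_stereo hw
    have h2 : HasFDerivAt (fun w => localExpr S false (w, v)) (baseDeriv S false (chartChange w, v))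
        (chartChange w) :=
      (hS.hasFDerivAt_localExpr_base false _ _).differentiableAt.hasFDerivAt
    have h3 := h2.comp w ((contDiffAt_chartChange hw).differentiableAt (by simp)).hasFDerivAt
    rw [h1, ContinuousLinearMap.zero_comp] at h3
    have h4 : (fun w => localExpr S true (w, v)) =ᶠ[nhds w]
        (fun w => localExpr S false (w, v)) ∘ chartChange :=
      (eventually_ne_infPt hw).mono fun w' hw' => by
        simp only [Function.comp_apply, localExpr, param_false_chartChange hw']
    exact (h3.congr_of_eventuallyEq h4).fderiv

/-- The difference of `S` and the Hamiltonian is locally constant on the fibre critical set. -/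
theorem eventually_sub_baseExt_eq (hS : IsGFQI A S L) (hsmooth : ContDiff ℝ ∞ h)
    (hsupp : HasCompactSupport h)
    (hL : ∀ x y ξ η : Vec n, ((toTorus x, y), (ξ, η)) ∈ L ↔ ξ = 0 ∧ η = gradient h y)
    {z₀ : Base n × Vec k} (hz₀ : fibreGrad S z₀ = 0) :
    ∀ᶠ z in nhds z₀, fibreGrad S z = 0 → S z - baseExt h z.1 = S z₀ - baseExt h z₀.1 := by
  obtain ⟨m, v⟩ := z₀
  have key : ∀ (b : Bool) (w : Vec n × Vec n), m = param b w →
      (∀ᶠ z in nhds (w, v), fibreDeriv S b z = 0 → ∀ a,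
        baseDeriv S b z a = fderiv ℝ (fun w => baseExt h (param b w)) z.1 a) →
      ∀ᶠ z in nhds (m, v), fibreGrad S z = 0 →
        S z - baseExt h z.1 = S (m, v) - baseExt h m := by
    rintro b w rfl hb
    have h0 := fibreGrad_param_eq_zero_iff.mp hz₀
    have h1 : ∀ᶠ z in nhds (w, v), fibreDeriv S b z = fibreDeriv S b (w, v) →
        localExpr S b z - baseExt h (param b z.1) =
          localExpr S b (w, v) - baseExt h (param b w) := by
      -- The fibre critical set is a regular level set of `fibreDeriv S b`. On it the fibre part of
      -- the derivative vanishes and the base part is that of the Hamiltonian, so the difference is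
      -- critical.
      refine eventually_eq_of_hasFDerivAt_zero
        (((hS.contDiff_fibreDeriv b).contDiffAt).hasStrictFDerivAt (by simp))
        (hS.regular b _ h0) (g := fun z => localExpr S b z - baseExt h (param b z.1)) ?_
      filter_upwards [hb] with z hz hz'
      rw [h0] at hz'
      have h2 := hS.hasFDerivAt_localExpr b z
      have h3 : HasFDerivAt (fun w => baseExt h (param b w)) _ z.1 :=
        ((contDiff_baseExt_param hsmooth hsupp b).differentiable (by simp) z.1).hasFDerivAt
      have h4 := h2.sub (h3.comp z hasFDerivAt_fst)
      refine h4.congr_fderiv ?_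
      rw [hS.fderiv_localExpr_eq hz', sub_eq_zero]
      exact ContinuousLinearMap.ext fun a => hz hz' a.1
    have h2 : IsOpenMap (Prod.map (param b) id : (Vec n × Vec n) × Vec k → Base n × Vec k) :=
      (isOpenMap_param b).prodMap IsOpenMap.id
    refine h2.nhds_le (w, v) (h1.mono fun z hz hz' => ?_)
    exact hz ((fibreGrad_param_eq_zero_iff.mp hz').trans h0.symm)
  obtain ⟨x, y, hm⟩ | ⟨x, hm⟩ := param_cases m
  · refine key false (x, y) hm (Filter.Eventually.of_forall fun z hz a => ?_)
    rw [hS.baseDeriv_false hL hz]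
    have h1 : HasFDerivAt h (InnerProductSpace.toDual ℝ (Vec n) (gradient h z.1.2)) z.1.2 :=
      (hsmooth.differentiable (by simp) z.1.2).hasGradientAt.hasFDerivAt
    have h2 := (h1.comp z.1 hasFDerivAt_snd).fderiv
    simp only [baseExt_param_false]
    change _ = fderiv ℝ (h ∘ Prod.snd) z.1 a
    rw [h2]
    rfl
  · refine key true (x, 0) hm ?_
    have h1 : (param true (x, (0 : Vec n))).2 ∉ stereoInv (infPt n) '' tsupport h := by
      rw [param_true_zero]
      rintro ⟨y, -, hy⟩
      exact stereoInv_ne _ y hy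
    have h2 := (eventually_notMem_tsupport hsupp h1).eventually_nhds
    filter_upwards [(continuous_fst.tendsto ((x, (0 : Vec n)), v)).eventually h2] with z hz hz' a
    rw [hS.baseDeriv_true hL hz' hz.self_of_nhds]
    have h3 : (fun w => baseExt h (param true w)) =ᶠ[nhds z.1] fun _ => 0 :=
      hz.mono fun w hw => baseExt_eq_zero hw
    rw [h3.fderiv_eq]
    simp

/-- The critical values of a generating function of the graph of the differential of `h` are those
of `h`, up to a constant. -/
theorem exists_isFibreQuadratic (hS : IsGFQI A S L) (hn : 1 ≤ n) (hsmooth : ContDiff ℝ ∞ h)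
    (hsupp : HasCompactSupport h)
    (hL : ∀ x y ξ η : Vec n, ((toTorus x, y), (ξ, η)) ∈ L ↔ ξ = 0 ∧ η = gradient h y) :
    ∃ C c, IsFibreQuadratic A S (fibreGrad S) (fun m => baseExt h m + c) C ∧
      (IsNormalized S → c = 0) := by
  obtain ⟨C, hC⟩ := hS.exists_isQuadraticAtInfty
  choose v hv huniq using hS.existsUnique_crit hL
  -- No regularity of the section `v` is available beforehand; properness of the fibre gradient
  -- keeps `v m` near `v m₀`, where the difference is constant on the critical set.
  have hloc : IsLocallyConstant fun m => S (m, v m) - baseExt h m := by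
    refine (IsLocallyConstant.iff_eventually_eq _).mpr fun m₀ => ?_
    filter_upwards [hC.eventually_forall_mem (huniq m₀)
      (hS.eventually_sub_baseExt_eq hsmooth hsupp hL (hv m₀))] with m hm
    exact hm _ (hv m) (hv m)
  have := preconnectedSpace_base hn
  have hconst := hloc.apply_eq_of_preconnectedSpace
  let m₁ : Base n := (0, infPt n)
  refine ⟨C, S (m₁, v m₁) - baseExt h m₁, ⟨hC, (continuous_baseExt hsmooth hsupp).add
    continuous_const, fun z hz => ?_⟩, fun hnorm => ?_⟩
  · have h1 := hconst z.1 m₁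
    rw [← huniq z.1 z.2 hz] at h1
    linarith
  · rw [baseExt_infPt, sub_zero]
    refine hnorm 0 (v m₁) ?_
    have h1 := hv m₁
    exact (LinearIsometryEquiv.map_eq_zero_iff _).mp h1

end IsGFQI

/-! ### Existence of a normalized generating function -/

section Existence

variable {n : ℕ} {h : Vec n → ℝ} {L : Set ((Torus n × Vec n) × (Vec n × Vec n))}

/-- The Hamiltonian itself is a generating function without fibre variables. -/
theorem isGFQI_baseExt (hsmooth : ContDiff ℝ ∞ h) (hsupp : HasCompactSupport h)
    (hL : ∀ x y ξ η : Vec n, ((toTorus x, y), (ξ, η)) ∈ L ↔ ξ = 0 ∧ η = gradient h y) :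
    IsGFQI (k := 0) 0 (fun z => baseExt h z.1) L where
  smooth b := (contDiff_baseExt_param hsmooth hsupp b).comp contDiff_fst
  symm _ _ := by simp
  nondegenerate := Function.injective_of_subsingleton _
  quadratic := ⟨0, fun m v => by rw [Subsingleton.elim v 0]; simp⟩
  regular b z _ := Function.surjective_to_subsingleton _
  injective b w v v' _ _ _ := Subsingleton.elim v v'
  generates x y ξ η := by
    have hd : ∀ v a b, baseDeriv (k := 0) (fun z => baseExt h z.1) false ((x, y), v) (a, b) =
        inner ℝ (gradient h y) b := fun v a b => by
      have h1 : HasFDerivAt h (InnerProductSpace.toDual ℝ (Vec n) (gradient h y)) y :=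
        (hsmooth.differentiable (by simp) y).hasGradientAt.hasFDerivAt
      have h2 := (HasFDerivAt.comp (f := Prod.snd) (x, y) h1 hasFDerivAt_snd).fderiv
      simp only [baseDeriv, localExpr, baseExt_param_false]
      change fderiv ℝ (h ∘ Prod.snd) (x, y) (a, b) = _
      rw [h2]
      rfl
    rw [hL]
    constructor
    · rintro ⟨rfl, rfl⟩
      exact ⟨0, Subsingleton.elim _ _, fun a b => by rw [hd, inner_zero_left, zero_add]⟩
    · rintro ⟨v, -, hv⟩
      simp only [hd] at hv
      constructor
      · have h1 := hv ξ 0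
        rw [inner_zero_right, inner_zero_right, add_zero] at h1
        exact inner_self_eq_zero.mp h1.symm
      · refine ext_inner_right ℝ fun b => ?_
        have h1 := hv 0 b
        rw [inner_zero_right, zero_add] at h1
        exact h1.symm
  generates_infty x β := by
    have h1 : (param true (x, (0 : Vec n))).2 ∉ stereoInv (infPt n) '' tsupport h := by
      rw [param_true_zero]
      rintro ⟨y, -, hy⟩
      exact stereoInv_ne _ y hy
    have hd : ∀ v, baseDeriv (k := 0) (fun z => baseExt h z.1) true ((x, 0), v) = 0 := fun v => by
      have h3 : (fun w => baseExt h (param true w)) =ᶠ[nhds (x, 0)] fun _ => 0 :=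
        (eventually_notMem_tsupport hsupp h1).mono fun w hw => baseExt_eq_zero hw
      refine (h3.fderiv_eq).trans ?_
      simp
    simp only [hd]
    exact ⟨fun hβ => ⟨0, Subsingleton.elim _ _, hβ.symm⟩, fun ⟨_, _, hβ⟩ => hβ.symm⟩

theorem isNormalized_baseExt : IsNormalized (k := 0) fun z : Base n × Vec 0 => baseExt h z.1 :=
  fun θ _ _ => baseExt_infPt h θ

end Existence

/-! ### Min-max values of the unit and of the top class -/

section Values

variable {X : Type} [TopologicalSpace X]

theorem IsCob.isRelCoboundary_empty {m : ℕ} {K : Set X} {u : Cochain X m} (h : IsCob K ∅ u) :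
    IsRelCoboundary K ∅ u := by
  cases m with
  | zero => exact h
  | succ m =>
    obtain ⟨w, -, hw⟩ := h
    exact ⟨w, vanishesOn_empty _, hw⟩

theorem not_isCob_one {K : Set X} (hK : K.Nonempty) : ¬ IsCob K ∅ (fun _ => 1 : Cochain X 0) := by
  obtain ⟨x, hx⟩ := hK
  intro h1
  exact one_ne_zero (h1 (ContinuousMap.const _ x) fun _ => hx)

theorem coboundary_one : coboundary (fun _ => 1 : Cochain X 0) = 0 := by
  funext s
  simp [coboundary]

variable {n k : ℕ} {A : Vec k →ₗ[ℝ] Vec k} {S : Base n × Vec k → ℝ} {G : Base n × Vec k → Vec k}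
  {f : Base n → ℝ} {C : ℝ}

/-- The min-max value of the unit is the minimum of the critical values. -/
theorem IsFibreQuadratic.isMinMax_unitClass (hS : IsFibreQuadratic A S G f C) {m : Base n}
    (hm : ∀ m', f m ≤ f m') : IsMinMax A S (unitClass n) (f m) := by
  have : Nonempty (Base n) := ⟨m⟩
  refine hS.isMinMax (α' := unitClass n) (W := ∅) (K := {m}) coboundary_one coboundary_one ?_
    isOpen_empty (vanishesOn_empty _) (not_isCob_one ⟨m, rfl⟩) (fun m' _ => hm m') ?_
  · exact IsCob.of_vanishesOn (fun _ _ => sub_self (1 : ℤ)) _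
  · rintro m' rfl
    exact le_rfl

/-- The min-max value of the top class is the maximum of the critical values. -/
theorem IsFibreQuadratic.isMinMax_topClass (hn : 1 ≤ n) (hS : IsFibreQuadratic A S G f C)
    {μ : Cochain (Base n) (2 * n)} (hμ : IsTopClass μ) {m : Base n} (hm : ∀ m', f m' ≤ f m) :
    IsMinMax A S μ (f m) := by
  have : Nonempty (Base n) := ⟨m⟩
  have hδ : coboundary μ = 0 := funext fun s => hμ.1.2 s fun _ => trivial
  obtain ⟨μ', hμ', hδ', hsub⟩ := exists_vanishesOn_compl_point hn m hδ
  -- The representative is concentrated at the maximum point `m`, so the lower bound is needed at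
  -- `m` only, while the non-vanishing of `μ` on the whole base gives the upper bound.
  refine hS.isMinMax (W := {m}ᶜ) (K := Set.univ) hδ hδ' (hsub _) isOpen_compl_singleton hμ'
    (fun h1 => hμ.2 h1.isRelCoboundary_empty) ?_ (fun m' _ => hm m')
  · intro m' hm'
    rw [not_not.mp hm']

end Values

theorem exists_forall_baseExt_le {n : ℕ} (hn : 1 ≤ n) {h : Vec n → ℝ} (hsmooth : ContDiff ℝ ∞ h)
    (hsupp : HasCompactSupport h) :
    ∃ m : Base n, (∀ m', baseExt h m' ≤ baseExt h m) ∧ baseExt h m = ⨆ p, h p := by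
  obtain ⟨m, -, hm⟩ := isCompact_univ.exists_isMaxOn ⟨(0, infPt n), Set.mem_univ _⟩
    (continuous_baseExt hsmooth hsupp).continuousOn
  refine ⟨m, fun m' => hm (Set.mem_univ m'), ?_⟩
  have h1 : IsGreatest (Set.range (baseExt h)) (baseExt h m) :=
    ⟨⟨m, rfl⟩, by rintro _ ⟨m', rfl⟩; exact hm (Set.mem_univ m')⟩
  rw [range_baseExt hn hsupp] at h1
  exact h1.csSup_eq.symm

theorem exists_forall_le_baseExt {n : ℕ} (hn : 1 ≤ n) {h : Vec n → ℝ} (hsmooth : ContDiff ℝ ∞ h)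
    (hsupp : HasCompactSupport h) :
    ∃ m : Base n, (∀ m', baseExt h m ≤ baseExt h m') ∧ baseExt h m = ⨅ p, h p := by
  obtain ⟨m, -, hm⟩ := isCompact_univ.exists_isMinOn ⟨(0, infPt n), Set.mem_univ _⟩
    (continuous_baseExt hsmooth hsupp).continuousOn
  refine ⟨m, fun m' => hm (Set.mem_univ m'), ?_⟩
  have h1 : IsLeast (Set.range (baseExt h)) (baseExt h m) :=
    ⟨⟨m, rfl⟩, by rintro _ ⟨m', rfl⟩; exact hm (Set.mem_univ m')⟩
  rw [range_baseExt hn hsupp] at h1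
  exact h1.csInf_eq.symm

end TorusCapacity

end

/-! ### The values of the three invariants -/

theorem propositionA1 (n : ℕ) (hn : 1 ≤ n) (h : TorusCapacity.Vec n → ℝ)
    (hsmooth : ContDiff ℝ ∞ h) (hsupp : HasCompactSupport h)
    (φ : ℝ → TorusCapacity.CotTorus n → TorusCapacity.CotTorus n)
    (hφ : TorusCapacity.IsHamiltonianFlow (fun z : TorusCapacity.CotTorus n => h z.2) φ) :
    TorusCapacity.HasCPlus (φ 1) (⨆ p, h p) ∧
    TorusCapacity.HasCMinus (φ 1) (⨅ p, h p) ∧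
    TorusCapacity.HasGamma (φ 1) ((⨆ p, h p) - ⨅ p, h p) := by
  have hL := TorusCapacity.mem_graphLift_iff hn hsmooth hsupp hφ
  have hex := TorusCapacity.isGFQI_baseExt hsmooth hsupp hL
  obtain ⟨m₁, hm₁, hmax⟩ := TorusCapacity.exists_forall_baseExt_le hn hsmooth hsupp
  obtain ⟨m₀, hm₀, hmin⟩ := TorusCapacity.exists_forall_le_baseExt hn hsmooth hsupp
  refine ⟨⟨⟨0, _, _, hex, TorusCapacity.isNormalized_baseExt⟩, fun k A S hS hnorm μ hμ => ?_⟩,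
    ⟨⟨0, _, _, hex, TorusCapacity.isNormalized_baseExt⟩, fun k A S hS hnorm => ?_⟩,
    ⟨0, _, _, hex⟩, fun k A S hS μ hμ => ?_⟩
  · obtain ⟨C, c, hC, hc⟩ := hS.exists_isFibreQuadratic hn hsmooth hsupp hL
    have h1 := hC.isMinMax_topClass hn hμ (m := m₁) fun m' => by simpa using hm₁ m'
    rwa [hc hnorm, add_zero, hmax] at h1
  · obtain ⟨C, c, hC, hc⟩ := hS.exists_isFibreQuadratic hn hsmooth hsupp hL
    have h1 := hC.isMinMax_unitClass (m := m₀) fun m' => by simpa using hm₀ m'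
    rwa [hc hnorm, add_zero, hmin] at h1
  · obtain ⟨C, c, hC, -⟩ := hS.exists_isFibreQuadratic hn hsmooth hsupp hL
    -- Without normalization both min-max values are shifted by the same constant `c`, which
    -- disappears from the difference.
    refine ⟨_, _, hC.isMinMax_topClass hn hμ (m := m₁) fun m' => by simpa using hm₁ m',
      hC.isMinMax_unitClass (m := m₀) fun m' => by simpa using hm₀ m', ?_⟩
    rw [hmax, hmin]
    ring
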